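/- **Theorem.** Let $(M,g)$ be a smooth complete Riemannian manifold, let $N$ be a smooth manifold and let $f:M\to N$ be a smooth map. Let $$U=\{x\in M : \operatorname{rank}(df_x)\ge \operatorname{rank}(df_y)\ \text{ for all } y\in M\}$$ be the (open) set of points at which the rank of $f$ is maximal. Assume that the distribution $\ker(df)|_U$ is autoparallel, that is, $\nabla_XY$ is a section of $\ker(df)$ whenever $X$ and $Y$ are smooth sections of $\ker(df)$ over an open subset of $U$, where $\nabla$ is the Levi-Civita connection of $g$. Then every maximal integral manifold of $\ker(df)|_U$ is a complete Riemannian manifold with respect to the metric induced by $g$. Here an integral manifold of $\ker(df)|_U$ is a connected manifold $L$ with an injective smooth immersion $j:L\to M$ such that $j(L)\subseteq U$ and $dj_q(T_qL)=\ker(df_{j(q)})$ for all $q\in L$; it is maximal if its image is not properly contained in the image of another integral manifold. A Riemannian manifold is complete if for every tangent vector $v$ there is a geodesic defined on all of $\mathbb{R}$ with initial velocity $v$. -/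

import Mathlib

open scoped Manifold ContDiff Bundle

universe u v

noncomputable section

namespace KernelFoliation

/-- The pullback `(v, w) ↦ B (A v) (A w)` of a bilinear form `B` under a linear map `A`. -/
def pullbackForm {V W : Type*} [AddCommGroup V] [Module ℝ V] [TopologicalSpace V]
    [AddCommGroup W] [Module ℝ W] [TopologicalSpace W]
    (B : W →L[ℝ] W →L[ℝ] ℝ) (A : V →L[ℝ] W) : V →L[ℝ] V →L[ℝ] ℝ :=
  (ContinuousLinearMap.precomp ℝ A).comp (B.comp A)

section LeviCivita

variable {E : Type*} [NormedAddCommGroup E] [NormedSpace ℝ E]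
  {M : Type*} [TopologicalSpace M] [ChartedSpace E M]

/-- The coordinate expression, in the chart around `x₀`, of a field `g` of bilinear forms on the
tangent spaces: the pullback of `g` under the inverse of the chart. -/
def formInChart (g : ∀ x : M, TangentSpace 𝓘(ℝ, E) x →L[ℝ] TangentSpace 𝓘(ℝ, E) x →L[ℝ] ℝ)
    (x₀ : M) (y : E) : E →L[ℝ] E →L[ℝ] ℝ :=
  pullbackForm (g ((extChartAt 𝓘(ℝ, E) x₀).symm y))
    (mfderiv 𝓘(ℝ, E) 𝓘(ℝ, E) (extChartAt 𝓘(ℝ, E) x₀).symm y)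

/-- The coordinate expression of a vector field in the chart around `x₀`. -/
def fieldInChart (X : ∀ x : M, TangentSpace 𝓘(ℝ, E) x) (x₀ : M) (y : E) : E :=
  mfderiv 𝓘(ℝ, E) 𝓘(ℝ, E) (extChartAt 𝓘(ℝ, E) x₀) ((extChartAt 𝓘(ℝ, E) x₀).symm y)
    (X ((extChartAt 𝓘(ℝ, E) x₀).symm y))

/-- The Christoffel symbol of the first kind in the chart around `x₀`: with `G` the coordinate
expression of the metric, it is the linear form
`w ↦ (D_v G (v', w) + D_{v'} G (v, w) - D_w G (v, v')) / 2`. -/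
def christoffelFirst
    (g : ∀ x : M, TangentSpace 𝓘(ℝ, E) x →L[ℝ] TangentSpace 𝓘(ℝ, E) x →L[ℝ] ℝ)
    (x₀ : M) (y v v' : E) : E →L[ℝ] ℝ :=
  (1 / 2 : ℝ) • (fderiv ℝ (formInChart g x₀) y v v' + fderiv ℝ (formInChart g x₀) y v' v
    - ((fderiv ℝ (formInChart g x₀) y).flip v).flip v')

/-- The Christoffel symbol (of the second kind) `Γ(v, v')` of the Levi-Civita connection of the
metric `g` in the chart around `x₀`, at the point with coordinates `y`: the vector that represents
the form `christoffelFirst g x₀ y v v'` with respect to the metric. -/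
def christoffel
    (g : ∀ x : M, TangentSpace 𝓘(ℝ, E) x →L[ℝ] TangentSpace 𝓘(ℝ, E) x →L[ℝ] ℝ)
    (x₀ : M) (y v v' : E) : E :=
  (formInChart g x₀ y).inverse (christoffelFirst g x₀ y v v')

/-- The Levi-Civita covariant derivative `(∇_X Y)(p)`, computed in the chart around `p` as
`DY (X) + Γ(X, Y)`. -/
def leviCivita
    (g : ∀ x : M, TangentSpace 𝓘(ℝ, E) x →L[ℝ] TangentSpace 𝓘(ℝ, E) x →L[ℝ] ℝ)
    (X Y : ∀ x : M, TangentSpace 𝓘(ℝ, E) x) (p : M) : TangentSpace 𝓘(ℝ, E) p :=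
  let y : E := extChartAt 𝓘(ℝ, E) p p
  mfderiv 𝓘(ℝ, E) 𝓘(ℝ, E) (extChartAt 𝓘(ℝ, E) p).symm y
    (fderiv ℝ (fieldInChart Y p) y (fieldInChart X p y)
      + christoffel g p y (fieldInChart X p y) (fieldInChart Y p y))

/-- `γ : ℝ → M` is a (complete) geodesic of the metric `g`: it is smooth, and `∇_{γ'} γ' = 0`,
i.e. the geodesic equation `c'' + Γ(c', c') = 0` holds in all charts. -/
structure IsGeodesic
    (g : ∀ x : M, TangentSpace 𝓘(ℝ, E) x →L[ℝ] TangentSpace 𝓘(ℝ, E) x →L[ℝ] ℝ)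
    (γ : ℝ → M) : Prop where
  contMDiff : ContMDiff 𝓘(ℝ, ℝ) 𝓘(ℝ, E) ∞ γ
  equation : ∀ (x₀ : M) (t : ℝ), γ t ∈ (extChartAt 𝓘(ℝ, E) x₀).source →
    deriv (deriv (fun s ↦ extChartAt 𝓘(ℝ, E) x₀ (γ s))) t
      + christoffel g x₀ (extChartAt 𝓘(ℝ, E) x₀ (γ t))
        (deriv (fun s ↦ extChartAt 𝓘(ℝ, E) x₀ (γ s)) t)
        (deriv (fun s ↦ extChartAt 𝓘(ℝ, E) x₀ (γ s)) t) = 0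

/-- Completeness of a Riemannian manifold: for each tangent vector `v`, the geodesic with initial
velocity `v` is defined on all of `ℝ`. -/
def IsCompleteMetric
    (g : ∀ x : M, TangentSpace 𝓘(ℝ, E) x →L[ℝ] TangentSpace 𝓘(ℝ, E) x →L[ℝ] ℝ) : Prop :=
  ∀ v : TangentBundle 𝓘(ℝ, E) M, ∃ γ : ℝ → M, IsGeodesic g γ ∧
    tangentMap 𝓘(ℝ, ℝ) 𝓘(ℝ, E) γ ⟨0, (1 : ℝ)⟩ = v

/-- The distribution `D` is autoparallel on the open set `U`: for all smooth sections `X`, `Y` of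
`D` over an open subset of `U`, the vector field `∇_X Y` is a section of `D` as well. -/
def IsAutoparallelOn [IsManifold 𝓘(ℝ, E) ∞ M]
    (g : ∀ x : M, TangentSpace 𝓘(ℝ, E) x →L[ℝ] TangentSpace 𝓘(ℝ, E) x →L[ℝ] ℝ)
    (D : ∀ x : M, Submodule ℝ (TangentSpace 𝓘(ℝ, E) x)) (U : Set M) : Prop :=
  ∀ (V : Set M), IsOpen V → V ⊆ U → ∀ X Y : ∀ x : M, TangentSpace 𝓘(ℝ, E) x,
    ContMDiffOn 𝓘(ℝ, E) 𝓘(ℝ, E).tangent ∞ (fun x ↦ (⟨x, X x⟩ : TangentBundle 𝓘(ℝ, E) M)) V →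
    ContMDiffOn 𝓘(ℝ, E) 𝓘(ℝ, E).tangent ∞ (fun x ↦ (⟨x, Y x⟩ : TangentBundle 𝓘(ℝ, E) M)) V →
    (∀ x ∈ V, X x ∈ D x) → (∀ x ∈ V, Y x ∈ D x) →
    ∀ x ∈ V, leviCivita g X Y x ∈ D x

end LeviCivita

section Kernel

variable (E : Type*) [NormedAddCommGroup E] [NormedSpace ℝ E]
  {M : Type*} [TopologicalSpace M] [ChartedSpace E M]
  (F : Type*) [NormedAddCommGroup F] [NormedSpace ℝ F]
  {N : Type*} [TopologicalSpace N] [ChartedSpace F N]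

/-- The rank of `f` at `x`, i.e. the rank of its differential at `x`. -/
def rankAt (f : M → N) (x : M) : ℕ :=
  Module.finrank ℝ (mfderiv 𝓘(ℝ, E) 𝓘(ℝ, F) f x).range

/-- The set of points at which the rank of `f` is maximal. -/
def maxRankSet (f : M → N) : Set M :=
  {x | ∀ y, rankAt E F f y ≤ rankAt E F f x}

/-- The field of kernels `ker (df)`. -/
def kerDistribution (f : M → N) (x : M) : Submodule ℝ (TangentSpace 𝓘(ℝ, E) x) :=
  (mfderiv 𝓘(ℝ, E) 𝓘(ℝ, F) f x).ker

end Kernel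

section IntegralManifold

variable {E : Type*} [NormedAddCommGroup E] [NormedSpace ℝ E]
  {M : Type u} [TopologicalSpace M] [ChartedSpace E M]
  (K : Type*) [NormedAddCommGroup K] [NormedSpace ℝ K]

/-- The injective immersion `j : L → M` of a connected manifold `L` is an integral manifold of the
distribution `D` on `U`. -/
structure IsIntegralManifold (D : ∀ x : M, Submodule ℝ (TangentSpace 𝓘(ℝ, E) x)) (U : Set M)
    {L : Type u} [TopologicalSpace L] [ChartedSpace K L] (j : L → M) : Prop where
  connected : ConnectedSpace L
  contMDiff : ContMDiff 𝓘(ℝ, K) 𝓘(ℝ, E) ∞ j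
  injective : Function.Injective j
  injective_mfderiv : ∀ q, Function.Injective (mfderiv 𝓘(ℝ, K) 𝓘(ℝ, E) j q)
  mem : ∀ q, j q ∈ U
  range_mfderiv : ∀ q, (mfderiv 𝓘(ℝ, K) 𝓘(ℝ, E) j q).range = D (j q)

/-- An integral manifold is maximal if it is not properly contained in another (connected)
integral manifold. -/
def IsMaximalIntegralManifold (D : ∀ x : M, Submodule ℝ (TangentSpace 𝓘(ℝ, E) x)) (U : Set M)
    {L : Type u} [TopologicalSpace L] [ChartedSpace K L] (j : L → M) : Prop :=
  IsIntegralManifold K D U j ∧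
    ∀ (L' : Type u) [TopologicalSpace L'] [ChartedSpace K L'] [IsManifold 𝓘(ℝ, K) ∞ L']
      (j' : L' → M), IsIntegralManifold K D U j' →
      Set.range j ⊆ Set.range j' → Set.range j' = Set.range j

/-- The metric that `j : L → M` induces on `L`. -/
def inducedMetric (g : ∀ x : M, TangentSpace 𝓘(ℝ, E) x →L[ℝ] TangentSpace 𝓘(ℝ, E) x →L[ℝ] ℝ)
    {L : Type u} [TopologicalSpace L] [ChartedSpace K L] (j : L → M) (q : L) :
    TangentSpace 𝓘(ℝ, K) q →L[ℝ] TangentSpace 𝓘(ℝ, K) q →L[ℝ] ℝ :=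
  pullbackForm (g (j q)) (mfderiv 𝓘(ℝ, K) 𝓘(ℝ, E) j q)

end IntegralManifold

end KernelFoliation

end

/-!
Let `γ` be the geodesic of `M` whose initial velocity is tangent to the integral manifold, and
consider the times at which `γ` passes through `U` with velocity in `ker df`. In charts,
autoparallelism says that the Hessian `D²f - Df ∘ Γ` vanishes on `ker df`, so along `γ` the
quantity `df(γ')` solves a homogeneous linear differential equation as long as `γ` stays in `U`;
hence the set of these times is open. The point is that it is closed. Suppose that `γ(t)` lies in
`U` for `t < b`, with velocity in `ker df`. A Jacobi field `ζ` along `γ` whose variation of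
`df(γ')` vanishes to first order at one time `a < b` keeps this property up to `b`, and `df(ζ)` is
then constant on `[a, b]`. Since `ζ(a)` can be chosen arbitrarily, the range of `df` at `γ(a)` is
contained in its range at `γ(b)`, so the rank does not drop at `b`.

Consequently `f ∘ γ` is constant and `γ` stays in a connected component of a fiber of `f` in `U`.
By the constant rank theorem this component is an integral manifold, so by maximality it is the
image of `j`. Thus `γ` factors through `j`, smoothly because `j` is locally inverted on the fiber
by smooth maps, and by the Gauss formula the factor is a geodesic of the induced metric.
-/

noncomputable section

namespace KernelFoliation

set_option maxSynthPendingDepth 3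

open Set Filter Topology

/-! ### Linear maps of locally maximal rank -/

section ConstantRank

variable {E F : Type*} [NormedAddCommGroup E] [NormedSpace ℝ E]
  [NormedAddCommGroup F] [NormedSpace ℝ F]

lemma exists_comp_comp_eq_self [FiniteDimensional ℝ E] (A : E →L[ℝ] F) :
    ∃ R : F →L[ℝ] E, A ∘L R ∘L A = A := by
  obtain ⟨s, hs⟩ := A.toLinearMap.rangeRestrict.exists_rightInverse_of_surjective
    A.toLinearMap.range_rangeRestrict
  obtain ⟨R, hR⟩ :=
    (LinearMap.toContinuousLinearMap s).exist_extension_of_finiteDimensional_range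
  refine ⟨R, ContinuousLinearMap.ext fun x ↦ ?_⟩
  have hRs : R (A x) = s ⟨A x, x, rfl⟩ := (DFunLike.congr_fun hR ⟨A x, x, rfl⟩).symm
  rw [ContinuousLinearMap.comp_apply, ContinuousLinearMap.comp_apply, hRs]
  exact congrArg Subtype.val (LinearMap.congr_fun hs ⟨A x, x, rfl⟩)

/-- The perturbation `1 + R (A - A₀)` of the identity. If `R` is a generalized inverse of `A₀`, that
is, `A₀ R A₀ = A₀`, then it carries the kernel of `A` into the kernel of `A₀`. -/
def kernelTransport (A₀ : E →L[ℝ] F) (R : F →L[ℝ] E) (A : E →L[ℝ] F) : E →L[ℝ] E :=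
  ContinuousLinearMap.id ℝ E + R ∘L (A - A₀)

variable {A₀ A : E →L[ℝ] F} {R : F →L[ℝ] E}

lemma kernelTransport_self : kernelTransport A₀ R A₀ = ContinuousLinearMap.id ℝ E := by
  simp [kernelTransport]

lemma comp_kernelTransport (hR : A₀ ∘L R ∘L A₀ = A₀) :
    A₀ ∘L kernelTransport A₀ R A = A₀ ∘L R ∘L A := by
  simp [kernelTransport, hR]

lemma map_kernelTransport_ker [FiniteDimensional ℝ E] (hR : A₀ ∘L R ∘L A₀ = A₀)
    (hT : Function.Injective (kernelTransport A₀ R A))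
    (hrank : Module.finrank ℝ A.range ≤ Module.finrank ℝ A₀.range) :
    A.ker.map (kernelTransport A₀ R A).toLinearMap = A₀.ker := by
  have hle : A.ker.map (kernelTransport A₀ R A).toLinearMap ≤ A₀.ker := by
    rintro _ ⟨x, hx, rfl⟩
    have hx : A x = 0 := hx
    simpa [hx] using DFunLike.congr_fun (comp_kernelTransport (A := A) hR) x
  have hker : Module.finrank ℝ (A.ker.map (kernelTransport A₀ R A).toLinearMap) =
      Module.finrank ℝ A.ker :=
    (Submodule.equivMapOfInjective _ hT A.ker).finrank_eq.symm
  have hA := A.toLinearMap.finrank_range_add_finrank_ker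
  have hA₀ := A₀.toLinearMap.finrank_range_add_finrank_ker
  exact Submodule.eq_of_le_of_finrank_le hle (by omega)

lemma eventually_finrank_range_le [FiniteDimensional ℝ E] {X : Type*} [TopologicalSpace X]
    {A : X → E →L[ℝ] F} {x₀ : X} (hA : ContinuousAt A x₀) :
    ∀ᶠ x in 𝓝 x₀, Module.finrank ℝ (A x₀).range ≤ Module.finrank ℝ (A x).range := by
  have hrank : ∀ (r : ℕ) (B : E →L[ℝ] F), r ≤ B.toLinearMap.rank ↔ r ≤ Module.finrank ℝ B.range :=
    fun r B ↦ by rw [LinearMap.rank, ← Module.finrank_eq_rank, Nat.cast_le]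
  have hopen : IsOpen {B : E →L[ℝ] F | Module.finrank ℝ (A x₀).range ≤ B.toLinearMap.rank} :=
    isOpen_setOfPred_nat_le_rank _
  filter_upwards [hA (hopen.mem_nhds ((hrank _ _).2 le_rfl))] with x hx using (hrank _ _).1 hx

/-- Near `x₀`, `P` and `R` are as smooth as `A`, and they split the identity into a part `P` which
lies in the kernel of `A` as long as the rank of `A` does not exceed its value at `x₀`, and a part
which depends on the values of `A` only. -/
lemma exists_kernel_splitting [FiniteDimensional ℝ E] {X : Type*} [NormedAddCommGroup X]
    [NormedSpace ℝ X] {A : X → E →L[ℝ] F} {x₀ : X} (hA : ContinuousAt A x₀) :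
    ∃ (P : X → E →L[ℝ] E) (R : X → F →L[ℝ] E), ∀ᶠ x in 𝓝 x₀,
      (∀ n : WithTop ℕ∞, ContDiffAt ℝ n A x → ContDiffAt ℝ n P x ∧ ContDiffAt ℝ n R x) ∧
        (∀ u, P x u + R x (A x u) = u) ∧
        (Module.finrank ℝ (A x).range ≤ Module.finrank ℝ (A x₀).range → ∀ u, A x (P x u) = 0) := by
  obtain ⟨R₀, hR₀⟩ := exists_comp_comp_eq_self (A x₀)
  set Q := ContinuousLinearMap.id ℝ E - R₀ ∘L A x₀ with hQ
  have hAQ : A x₀ ∘L Q = 0 := by simp [hQ, hR₀]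
  set T : X → E →L[ℝ] E := fun x ↦ kernelTransport (A x₀) R₀ (A x) with hTdef
  have hT₀ : T x₀ = (ContinuousLinearEquiv.refl ℝ E : E →L[ℝ] E) := kernelTransport_self
  have hTcont : ContinuousAt T x₀ :=
    continuousAt_const.add (continuousAt_const.clm_comp (hA.sub continuousAt_const))
  have hTinv : ∀ᶠ x in 𝓝 x₀, (T x).IsInvertible :=
    hTcont (by rw [hT₀]; exact ContinuousLinearEquiv.nhds _)
  refine ⟨fun x ↦ (T x).inverse ∘L Q, fun x ↦ (T x).inverse ∘L R₀, ?_⟩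
  filter_upwards [hTinv] with x hx
  refine ⟨fun n hAx ↦ ?_, fun u ↦ hx.injective ?_, fun hrank u ↦ ?_⟩
  · have hTx : ContDiffAt ℝ n T x :=
      contDiffAt_const.add (contDiffAt_const.clm_comp (hAx.sub contDiffAt_const))
    have hS : ContDiffAt ℝ n (fun x ↦ (T x).inverse) x := hx.contDiffAt_map_inverse.comp x hTx
    exact ⟨hS.clm_comp contDiffAt_const, hS.clm_comp contDiffAt_const⟩
  · simp only [ContinuousLinearMap.comp_apply, map_add, hx.self_apply_inverse]
    simp only [hTdef, hQ, kernelTransport, add_apply, sub_apply, ContinuousLinearMap.comp_apply,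
      ContinuousLinearMap.id_apply, map_sub]
    abel
  · have hmem : Q u ∈ (A x).ker.map (T x).toLinearMap := by
      rw [map_kernelTransport_ker hR₀ hx.injective hrank]
      exact DFunLike.congr_fun hAQ u
    obtain ⟨v, hv, hvu⟩ := hmem
    have hvu : T x v = Q u := hvu
    rw [ContinuousLinearMap.comp_apply, ← hvu, hx.inverse_apply_self]
    exact hv

lemma contDiffAt_clm_of_apply {X : Type*} [NormedAddCommGroup X] [NormedSpace ℝ X]
    [FiniteDimensional ℝ E] {A : X → E →L[ℝ] F} {x : X} {n : WithTop ℕ∞}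
    (h : ∀ u, ContDiffAt ℝ n (fun y ↦ A y u) x) : ContDiffAt ℝ n A x := by
  let e₁ := ContinuousLinearEquiv.ofFinrankEq
    (Module.finrank_fin_fun ℝ (n := Module.finrank ℝ E)).symm
  let e₂ := (e₁.arrowCongr (1 : F ≃L[ℝ] F)).trans (ContinuousLinearEquiv.piRing _)
  rw [← Function.id_comp A, ← e₂.symm_comp_self]
  exact e₂.symm.contDiff.contDiffAt.comp x (contDiffAt_pi.2 fun i ↦ h _)

lemma fderiv_apply_mem_range [FiniteDimensional ℝ E] {X : Type*} [NormedAddCommGroup X]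
    [NormedSpace ℝ X] {A : X → E →L[ℝ] F} {x : X} (hA : ContDiffAt ℝ 1 A x)
    (hrank : ∀ᶠ y in 𝓝 x, Module.finrank ℝ (A y).range ≤ Module.finrank ℝ (A x).range)
    {v : E} (hv : A x v = 0) (w : X) : fderiv ℝ A x w v ∈ (A x).range := by
  obtain ⟨P, R, hsplit⟩ := exists_kernel_splitting hA.continuousAt
  have hPx : P x v = v := by simpa [hv] using hsplit.self_of_nhds.2.1 v
  have hPv : DifferentiableAt ℝ (fun y ↦ P y v) x :=
    ((hsplit.self_of_nhds.1 1 hA).1.differentiableAt one_ne_zero).clm_apply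
      (differentiableAt_const _)
  have hzero : (fun y ↦ A y (P y v)) =ᶠ[𝓝 x] fun _ ↦ 0 := by
    filter_upwards [hsplit, hrank] with y hy hr using hy.2.2 hr v
  have hD := DFunLike.congr_fun (hzero.fderiv_eq (𝕜 := ℝ)) w
  rw [fderiv_clm_apply (hA.differentiableAt one_ne_zero) hPv] at hD
  simp only [add_apply, ContinuousLinearMap.comp_apply, ContinuousLinearMap.flip_apply, hPx,
    fderiv_fun_const, Pi.zero_apply, zero_apply] at hD
  refine ⟨-fderiv ℝ (fun y ↦ P y v) x w, ?_⟩
  simpa using (eq_neg_of_add_eq_zero_right hD).symm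

end ConstantRank

/-! ### Linear differential equations -/

section LinearODE

variable {X : Type*} [NormedAddCommGroup X] [NormedSpace ℝ X]

lemma exists_forall_mem_Icc_hasDerivWithinAt_linear [CompleteSpace X] {A : ℝ → X →L[ℝ] X}
    {p q K : ℝ} (hA : ContinuousOn A (Icc p q)) (hK : ∀ t ∈ Icc p q, ‖A t‖ ≤ K)
    (hpq : 2 * K * (q - p) ≤ 1) {a : ℝ} (ha : a ∈ Icc p q) (x₀ : X) :
    ∃ ζ : ℝ → X, ζ a = x₀ ∧
      ∀ t ∈ Icc p q, HasDerivWithinAt ζ (A t (ζ t)) (Icc p q) t := by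
  have hK₀ : 0 ≤ K := (norm_nonneg _).trans (hK a ha)
  lift K to NNReal using hK₀
  have hpl : IsPicardLindelof (fun t x ↦ A t x) ⟨a, ha⟩ x₀ ‖x₀‖₊ 0 (K * (2 * ‖x₀‖₊)) K := by
    refine ⟨fun t ht ↦ ((A t).lipschitz.weaken (hK t ht)).lipschitzOnWith,
      fun x _ ↦ hA.clm_apply continuousOn_const, fun t ht x hx ↦ ?_, ?_⟩
    · have hx : ‖x‖ ≤ 2 * ‖x₀‖ := by
        have hsub : ‖x - x₀‖ ≤ ‖x₀‖ := by simpa [dist_eq_norm] using hx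
        linarith [norm_sub_norm_le x x₀]
      simp only [NNReal.coe_mul, coe_nnnorm, NNReal.coe_ofNat]
      exact (A t).le_of_opNorm_le_of_le (hK t ht) hx
    · simp only [NNReal.coe_mul, coe_nnnorm, NNReal.coe_ofNat, NNReal.coe_zero, sub_zero]
      have hmax : max (q - a) (a - p) ≤ q - p := max_le (by linarith [ha.1]) (by linarith [ha.2])
      calc K * (2 * ‖x₀‖) * max (q - a) (a - p) ≤ K * (2 * ‖x₀‖) * (q - p) := by gcongr
        _ = (2 * K * (q - p)) * ‖x₀‖ := by ring
        _ ≤ ‖x₀‖ := mul_le_of_le_one_left (norm_nonneg _) hpq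
  exact hpl.exists_eq_forall_mem_Icc_hasDerivWithinAt₀

/-- The length of the interval on which a solution of a linear equation exists does not depend on
the initial value. -/
lemma exists_forall_hasDerivAt_linear [CompleteSpace X] {A : ℝ → X →L[ℝ] X} {b : ℝ}
    (hA : ∀ᶠ t in 𝓝 b, ContinuousAt A t) :
    ∃ ε > 0, ∀ a ∈ Ioo (b - ε) (b + ε), ∀ x₀ : X, ∃ ζ : ℝ → X, ζ a = x₀ ∧
      ∀ t ∈ Ioo (b - ε) (b + ε), HasDerivAt ζ (A t (ζ t)) t := by
  set K : ℝ := ‖A b‖ + 1 with hK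
  have hbound : ∀ᶠ t in 𝓝 b, ‖A t‖ < K :=
    hA.self_of_nhds.norm.eventually_lt continuousAt_const (by simp [hK])
  have hsmall : ∀ᶠ ε in 𝓝[>] (0 : ℝ), 2 * K * (b + ε - (b - ε)) ≤ 1 := by
    have hcont : Tendsto (fun ε : ℝ ↦ 2 * K * (b + ε - (b - ε))) (𝓝 0) (𝓝 0) := by
      have hcont : Continuous fun ε : ℝ ↦ 2 * K * (b + ε - (b - ε)) := by fun_prop
      simpa using hcont.tendsto 0
    exact (hcont.eventually (Iic_mem_nhds one_pos)).filter_mono nhdsWithin_le_nhds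
  have hIcc : ∀ᶠ ε in 𝓝[>] (0 : ℝ), Icc (b - ε) (b + ε) ⊆ {t | ContinuousAt A t ∧ ‖A t‖ < K} := by
    obtain ⟨δ, hδ, hball⟩ := Metric.nhds_basis_closedBall.eventually_iff.1 (hA.and hbound)
    filter_upwards [Ioo_mem_nhdsGT hδ] with ε hε t ht
    refine hball ?_
    rw [Real.closedBall_eq_Icc]
    exact ⟨by linarith [ht.1, hε.2], by linarith [ht.2, hε.2]⟩
  obtain ⟨ε, ⟨hε₁, hε₂⟩, hε⟩ := ((hsmall.and hIcc).and self_mem_nhdsWithin).exists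
  refine ⟨ε, hε, fun a ha x₀ ↦ ?_⟩
  obtain ⟨ζ, hζa, hζ⟩ := exists_forall_mem_Icc_hasDerivWithinAt_linear
    (fun t ht ↦ (hε₂ ht).1.continuousWithinAt) (fun t ht ↦ (hε₂ ht).2.le) hε₁
    (Ioo_subset_Icc_self ha) x₀
  exact ⟨ζ, hζa, fun t ht ↦ (hζ t (Ioo_subset_Icc_self ht)).hasDerivAt (Icc_mem_nhds ht.1 ht.2)⟩

lemma eventually_eq_zero_of_linear {B : ℝ → X →L[ℝ] X} {x : ℝ → X} {t : ℝ}
    (hB : ContinuousAt B t) (hx : ∀ᶠ s in 𝓝 t, HasDerivAt x (B s (x s)) s) (h0 : x t = 0) :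
    ∀ᶠ s in 𝓝 t, x s = 0 := by
  have hbound : ∀ᶠ s in 𝓝 t, ‖B s‖₊ < ‖B t‖₊ + 1 :=
    hB.nnnorm.eventually_lt continuousAt_const (by simp)
  refine ODE_solution_unique_of_eventually (v := fun s y ↦ B s y) (s := fun _ ↦ univ)
    (g := fun _ ↦ 0) (hbound.mono fun s hs ↦ ((B s).lipschitz.weaken hs.le).lipschitzOnWith)
    (hx.mono fun s hs ↦ ⟨hs, mem_univ _⟩) (.of_forall fun s ↦ ⟨?_, mem_univ _⟩) h0
  simpa using hasDerivAt_const s (0 : X)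

lemma eq_zero_of_linear {x : ℝ → X} {I : Set ℝ} (hI : IsOpen I) (hI' : IsPreconnected I)
    (hx : ∀ t ∈ I, ∃ B : ℝ → X →L[ℝ] X, ContinuousAt B t ∧
      ∀ᶠ s in 𝓝 t, HasDerivAt x (B s (x s)) s)
    {t₀ : ℝ} (ht₀ : t₀ ∈ I) (h0 : x t₀ = 0) : ∀ t ∈ I, x t = 0 := by
  have hlocal : ∀ t ∈ I, x t = 0 → ∀ᶠ s in 𝓝 t, x s = 0 := fun t ht h ↦
    let ⟨_, hB, hd⟩ := hx t ht
    eventually_eq_zero_of_linear hB hd h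
  have hcont : ContinuousOn x I := fun t ht ↦
    let ⟨_, _, hd⟩ := hx t ht
    hd.self_of_nhds.continuousAt.continuousWithinAt
  have hsub : I ⊆ {t | ∀ᶠ s in 𝓝 t, x s = 0} :=
    hI'.subset_left_of_subset_union (v := I ∩ x ⁻¹' {0}ᶜ) isOpen_setOfPred_eventually_nhds
      (hcont.isOpen_inter_preimage hI isOpen_compl_singleton)
      (disjoint_left.2 fun t h h' ↦ h'.2 (Eventually.self_of_nhds (p := fun s ↦ x s = 0) h))
      (fun t ht ↦ (em (x t = 0)).imp (hlocal t ht) fun h ↦ ⟨ht, h⟩) ⟨t₀, ht₀, hlocal t₀ ht₀ h0⟩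
  exact fun t ht ↦ Eventually.self_of_nhds (p := fun s ↦ x s = 0) (hsub ht)

/-- If `ζ` solves the linearization of `z' = V z`, then the derivative of `Dk(ζ)` along `z` is the
differential of the Lie derivative of `k` along `V`, applied to `ζ`. -/
lemma hasDerivAt_fderiv_variation {Y : Type*} [NormedAddCommGroup Y] [NormedSpace ℝ Y]
    {V : X → X} {k : X → Y} {z ζ : ℝ → X} {t : ℝ}
    (hk : ContDiffAt ℝ 2 k (z t)) (hV : DifferentiableAt ℝ V (z t))
    (hz : HasDerivAt z (V (z t)) t) (hζ : HasDerivAt ζ (fderiv ℝ V (z t) (ζ t)) t) :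
    HasDerivAt (fun s ↦ fderiv ℝ k (z s) (ζ s))
      (fderiv ℝ (fun y ↦ fderiv ℝ k y (V y)) (z t) (ζ t)) t := by
  have hd : DifferentiableAt ℝ (fderiv ℝ k) (z t) :=
    (hk.fderiv_right (m := 1) le_rfl).differentiableAt one_ne_zero
  refine ((hd.hasFDerivAt.comp_hasDerivAt t hz).clm_apply hζ).congr_deriv ?_
  have hsymm : IsSymmSndFDerivAt ℝ k (z t) := hk.isSymmSndFDerivAt (by simp)
  rw [fderiv_clm_apply hd hV, hsymm.eq (V (z t)) (ζ t)]
  simp only [add_apply, ContinuousLinearMap.comp_apply, ContinuousLinearMap.flip_apply,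
    Function.comp_apply]
  abel

end LinearODE

/-! ### Geodesics tangent to the kernel, in coordinates -/

lemma two_le_infty : (2 : WithTop ℕ∞) ≤ ∞ := by norm_cast

section GeodesicField

variable {E F : Type*} [NormedAddCommGroup E] [NormedSpace ℝ E]
  [NormedAddCommGroup F] [NormedSpace ℝ F]

/-- The Hessian `D²f - Df ∘ Γ` of `f` with respect to the connection with Christoffel symbol `Γ`. -/
def hessianAt (f : E → F) (Γ : E → E →L[ℝ] E →L[ℝ] E) (x : E) : E →L[ℝ] E →L[ℝ] F :=
  fderiv ℝ (fderiv ℝ f) x - (ContinuousLinearMap.compL ℝ E E F (fderiv ℝ f x)).comp (Γ x)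

lemma hessianAt_apply (f : E → F) (Γ : E → E →L[ℝ] E →L[ℝ] E) (x u v : E) :
    hessianAt f Γ x u v = fderiv ℝ (fderiv ℝ f) x u v - fderiv ℝ f x (Γ x u v) := rfl

/-- The vector field on the tangent bundle whose integral curves are the geodesics of the connection
with Christoffel symbol `Γ`. -/
def geodesicField (Γ : E → E →L[ℝ] E →L[ℝ] E) (z : E × E) : E × E :=
  (z.2, -Γ z.1 z.2 z.2)

/-- The differential of `f` as a map on the tangent bundle, without the base point. -/
def differentialMap (f : E → F) (z : E × E) : F := fderiv ℝ f z.1 z.2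

variable {f : E → F} {Γ : E → E →L[ℝ] E →L[ℝ] E} {z : E × E}

lemma contDiffAt_differentialMap (hf : ContDiffAt ℝ ∞ f z.1) :
    ContDiffAt ℝ ∞ (differentialMap f) z :=
  ((hf.fderiv_right (m := ∞) (by simp)).comp z contDiffAt_fst).clm_apply contDiffAt_snd

lemma contDiffAt_geodesicField (hΓ : ContDiffAt ℝ ∞ Γ z.1) :
    ContDiffAt ℝ ∞ (geodesicField Γ) z :=
  contDiffAt_snd.prodMk
    (((hΓ.comp z contDiffAt_fst).clm_apply contDiffAt_snd).clm_apply contDiffAt_snd).neg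

lemma contDiffAt_hessianAt {x : E} (hf : ContDiffAt ℝ ∞ f x) (hΓ : ContDiffAt ℝ ∞ Γ x) :
    ContDiffAt ℝ ∞ (hessianAt f Γ) x := by
  have hDf : ContDiffAt ℝ ∞ (fderiv ℝ f) x := hf.fderiv_right (m := ∞) (by simp)
  exact (hDf.fderiv_right (m := ∞) (by simp)).sub
    (((ContinuousLinearMap.compL ℝ E E F).contDiff.contDiffAt.comp x hDf).clm_comp hΓ)

lemma fderiv_differentialMap (hf : ContDiffAt ℝ 2 f z.1) (ζ : E × E) :
    fderiv ℝ (differentialMap f) z ζ =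
      fderiv ℝ (fderiv ℝ f) z.1 ζ.1 z.2 + fderiv ℝ f z.1 ζ.2 := by
  have hd : DifferentiableAt ℝ (fderiv ℝ f) z.1 :=
    (hf.fderiv_right (m := 1) le_rfl).differentiableAt one_ne_zero
  have h := (hd.hasFDerivAt.comp z hasFDerivAt_fst).clm_apply (hasFDerivAt_snd (p := z))
  rw [show differentialMap f = fun z : E × E ↦ (fderiv ℝ f ∘ Prod.fst) z z.2 from rfl, h.fderiv]
  simp [add_comm]

lemma fderiv_differentialMap_geodesicField (hf : ContDiffAt ℝ 2 f z.1) :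
    fderiv ℝ (differentialMap f) z (geodesicField Γ z) = hessianAt f Γ z.1 z.2 z.2 := by
  rw [fderiv_differentialMap hf, hessianAt_apply]
  simp [geodesicField, sub_eq_add_neg]

lemma fderiv_comp_fst (hf : DifferentiableAt ℝ f z.1) (ζ : E × E) :
    fderiv ℝ (f ∘ Prod.fst) z ζ = fderiv ℝ f z.1 ζ.1 :=
  DFunLike.congr_fun (hf.hasFDerivAt.comp z hasFDerivAt_fst).fderiv ζ

/-- The local form of the hypothesis on `f`: on the open set `Ω`, the rank of `f` is at most `r`,
and where it is `r` the kernel of `Df` is autoparallel for the connection with Christoffel symbol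
`Γ`, which is expressed by the Hessian of `f`. -/
structure IsAutoparallelKernel (f : E → F) (Γ : E → E →L[ℝ] E →L[ℝ] E) (Ω : Set E) (r : ℕ) :
    Prop where
  isOpen : IsOpen Ω
  contDiffOn : ContDiffOn ℝ ∞ f Ω
  contDiffOn_symbol : ContDiffOn ℝ ∞ Γ Ω
  finrank_range_le : ∀ x ∈ Ω, Module.finrank ℝ (fderiv ℝ f x).range ≤ r
  hessianAt_eq_zero : ∀ x ∈ Ω, Module.finrank ℝ (fderiv ℝ f x).range = r → ∀ u v,
    fderiv ℝ f x u = 0 → fderiv ℝ f x v = 0 → hessianAt f Γ x u v = 0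

/-- The curve `z` in the tangent bundle consists, on `I`, of the velocities of a geodesic in `Ω`
which is tangent to the kernel of `Df` and along which the rank of `f` is `r`. -/
structure IsKernelGeodesicOn (f : E → F) (Γ : E → E →L[ℝ] E →L[ℝ] E) (Ω : Set E) (r : ℕ)
    (z : ℝ → E × E) (I : Set ℝ) : Prop where
  hasDerivAt : ∀ t ∈ I, HasDerivAt z (geodesicField Γ (z t)) t
  mem : ∀ t ∈ I, (z t).1 ∈ Ω
  finrank_range : ∀ t ∈ I, Module.finrank ℝ (fderiv ℝ f (z t).1).range = r
  differentialMap_eq_zero : ∀ t ∈ I, differentialMap f (z t) = 0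

namespace IsAutoparallelKernel

variable {Ω : Set E} {r : ℕ} (h : IsAutoparallelKernel f Γ Ω r)
include h

lemma contDiffAt {x : E} (hx : x ∈ Ω) : ContDiffAt ℝ ∞ f x :=
  h.contDiffOn.contDiffAt (h.isOpen.mem_nhds hx)

lemma contDiffAt_symbol {x : E} (hx : x ∈ Ω) : ContDiffAt ℝ ∞ Γ x :=
  h.contDiffOn_symbol.contDiffAt (h.isOpen.mem_nhds hx)

lemma eventually_fst_mem (hz : z.1 ∈ Ω) : ∀ᶠ y in 𝓝 z, y.1 ∈ Ω :=
  continuousAt_fst (h.isOpen.mem_nhds hz)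

lemma hasDerivAt_fderiv_fst {z ζ : ℝ → E × E} {t : ℝ} (hzΩ : (z t).1 ∈ Ω)
    (hz : HasDerivAt z (geodesicField Γ (z t)) t)
    (hζ : HasDerivAt ζ (fderiv ℝ (geodesicField Γ) (z t) (ζ t)) t) :
    HasDerivAt (fun s ↦ fderiv ℝ f (z s).1 (ζ s).1)
      (fderiv ℝ (differentialMap f) (z t) (ζ t)) t := by
  have hfst : ∀ᶠ y in 𝓝 (z t), ∀ η, fderiv ℝ (f ∘ Prod.fst) y η = fderiv ℝ f y.1 η.1 :=
    (h.eventually_fst_mem hzΩ).mono fun y hy ↦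
      fderiv_comp_fst ((h.contDiffAt hy).differentiableAt (by simp))
  have hderiv := hasDerivAt_fderiv_variation
    (((h.contDiffAt hzΩ).comp (z t) contDiffAt_fst).of_le two_le_infty)
    ((contDiffAt_geodesicField (h.contDiffAt_symbol hzΩ)).differentiableAt (by simp)) hz hζ
  have heq : (fun y ↦ fderiv ℝ (f ∘ Prod.fst) y (geodesicField Γ y)) =ᶠ[𝓝 (z t)]
      differentialMap f := hfst.mono fun y hy ↦ hy _
  rw [heq.fderiv_eq] at hderiv
  exact hderiv.congr_of_eventuallyEq
    ((hz.continuousAt.eventually hfst).mono fun s hs ↦ (hs _).symm)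

lemma eqOn_fderiv_fst {z ζ : ℝ → E × E} {I : Set ℝ} (hI : IsOpen I) (hI' : IsPreconnected I)
    (hz : IsKernelGeodesicOn f Γ Ω r z I)
    (hζ : ∀ t ∈ I, HasDerivAt ζ (fderiv ℝ (geodesicField Γ) (z t) (ζ t)) t)
    (h0 : ∀ t ∈ I, fderiv ℝ (differentialMap f) (z t) (ζ t) = 0) {a : ℝ} (ha : a ∈ I) :
    ∀ t ∈ I, fderiv ℝ f (z t).1 (ζ t).1 = fderiv ℝ f (z a).1 (ζ a).1 := by
  have hderiv : ∀ t ∈ I, HasDerivAt (fun s ↦ fderiv ℝ f (z s).1 (ζ s).1) 0 t := fun t ht ↦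
    h0 t ht ▸ h.hasDerivAt_fderiv_fst (hz.mem t ht) (hz.hasDerivAt t ht) (hζ t ht)
  exact fun t ht ↦ hI.is_const_of_deriv_eq_zero hI'
    (fun s hs ↦ (hderiv s hs).differentiableAt.differentiableWithinAt)
    (fun s hs ↦ (hderiv s hs).deriv) ht ha

variable [FiniteDimensional ℝ E]

/-- The vertical and horizontal parts of a vector are separated by a smooth splitting of the kernel
of `Df`; the Hessian vanishes on the purely vertical part. -/
lemma exists_hessianAt_eq (hz : z.1 ∈ Ω) (hzr : Module.finrank ℝ (fderiv ℝ f z.1).range = r) :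
    ∃ B : E × E → F →L[ℝ] F, ContDiffAt ℝ 1 B z ∧
      ∀ᶠ y in 𝓝 z, hessianAt f Γ y.1 y.2 y.2 = B y (differentialMap f y) := by
  have hDf : ContDiffAt ℝ ∞ (fderiv ℝ f) z.1 := (h.contDiffAt hz).fderiv_right (m := ∞) (by simp)
  obtain ⟨P, R, hsplit⟩ := exists_kernel_splitting hDf.continuousAt
  obtain ⟨hP, hR⟩ := hsplit.self_of_nhds.1 ∞ hDf
  have hHz := (contDiffAt_hessianAt (h.contDiffAt hz) (h.contDiffAt_symbol hz)).comp z
    contDiffAt_fst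
  have hRz := hR.comp z contDiffAt_fst
  have hHflip : ContDiffAt ℝ ∞ (fun y : E × E ↦ (hessianAt f Γ y.1).flip) z :=
    (ContinuousLinearMap.flipₗᵢ ℝ E E F).contDiff.contDiffAt.comp z hHz
  have hPz : ContDiffAt ℝ ∞ (fun y : E × E ↦ P y.1 y.2) z :=
    (hP.comp z contDiffAt_fst).clm_apply contDiffAt_snd
  refine ⟨fun y ↦ hessianAt f Γ y.1 y.2 ∘L R y.1 + (hessianAt f Γ y.1).flip (P y.1 y.2) ∘L R y.1,
    (((hHz.clm_apply contDiffAt_snd).clm_comp hRz).add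
      ((hHflip.clm_apply hPz).clm_comp hRz)).of_le (by norm_cast), ?_⟩
  filter_upwards [h.eventually_fst_mem hz, (continuousAt_fst (p := z)).eventually hsplit,
    (continuousAt_fst (p := z)).eventually (eventually_finrank_range_le hDf.continuousAt)]
    with y hy ⟨_, hsum, hker⟩ hrank
  have hyr : Module.finrank ℝ (fderiv ℝ f y.1).range = r :=
    le_antisymm (h.finrank_range_le _ hy) (hzr ▸ hrank)
  have hPy := hker (by rw [hyr, hzr]) y.2
  have hH := h.hessianAt_eq_zero _ hy hyr _ _ hPy hPy
  simp only [add_apply, ContinuousLinearMap.comp_apply, ContinuousLinearMap.flip_apply,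
    differentialMap]
  have hy₂ := hsum y.2
  set w := R y.1 (fderiv ℝ f y.1 y.2)
  set p := P y.1 y.2
  rw [← hy₂]
  simp only [map_add, add_apply, hH]
  abel

lemma eventually_differentialMap_eq_zero {z : ℝ → E × E} {t : ℝ}
    (hz : ∀ᶠ s in 𝓝 t, HasDerivAt z (geodesicField Γ (z s)) s) (hzΩ : (z t).1 ∈ Ω)
    (hzr : Module.finrank ℝ (fderiv ℝ f (z t).1).range = r) (h0 : differentialMap f (z t) = 0) :
    ∀ᶠ s in 𝓝 t, differentialMap f (z s) = 0 := by
  obtain ⟨B, hB, hBH⟩ := h.exists_hessianAt_eq hzΩ hzr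
  have hzc : ContinuousAt z t := hz.self_of_nhds.continuousAt
  refine eventually_eq_zero_of_linear (B := fun s ↦ B (z s)) (hB.continuousAt.comp hzc) ?_ h0
  filter_upwards [hz, hzc.eventually hBH, hzc.eventually (h.eventually_fst_mem hzΩ)]
    with s hs hBs hΩs
  have hfs := h.contDiffAt hΩs
  refine (((contDiffAt_differentialMap hfs).differentiableAt (by simp)).hasFDerivAt.comp_hasDerivAt
    s hs).congr_deriv ?_
  rw [fderiv_differentialMap_geodesicField (hfs.of_le two_le_infty), hBs]

lemma fderiv_differentialMap_eq_zero {z ζ : ℝ → E × E} {I : Set ℝ} (hI : IsOpen I)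
    (hI' : IsPreconnected I) (hz : IsKernelGeodesicOn f Γ Ω r z I)
    (hζ : ∀ t ∈ I, HasDerivAt ζ (fderiv ℝ (geodesicField Γ) (z t) (ζ t)) t)
    {a : ℝ} (ha : a ∈ I) (h0 : fderiv ℝ (differentialMap f) (z a) (ζ a) = 0) :
    ∀ t ∈ I, fderiv ℝ (differentialMap f) (z t) (ζ t) = 0 := by
  refine eq_zero_of_linear hI hI' (fun t ht ↦ ?_) ha h0
  obtain ⟨B, hB, hBH⟩ := h.exists_hessianAt_eq (hz.mem t ht) (hz.finrank_range t ht)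
  have hzt := (hz.hasDerivAt t ht).continuousAt
  refine ⟨fun s ↦ B (z s), hB.continuousAt.comp hzt, ?_⟩
  filter_upwards [hI.mem_nhds ht, hzt.eventually hBH.eventually_nhds,
    hzt.eventually (hB.eventually (by simp))] with s hs hBHs hBs
  have hfs := contDiffAt_differentialMap (h.contDiffAt (hz.mem s hs))
  have hΓs := contDiffAt_geodesicField (h.contDiffAt_symbol (hz.mem s hs))
  refine (hasDerivAt_fderiv_variation (hfs.of_le two_le_infty) (hΓs.differentiableAt (by simp))
    (hz.hasDerivAt s hs) (hζ s hs)).congr_deriv ?_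
  have heq : (fun y ↦ fderiv ℝ (differentialMap f) y (geodesicField Γ y)) =ᶠ[𝓝 (z s)]
      fun y ↦ B y (differentialMap f y) := by
    filter_upwards [hBHs, h.eventually_fst_mem (hz.mem s hs)] with y hy hyΩ
    rw [fderiv_differentialMap_geodesicField ((h.contDiffAt hyΩ).of_le two_le_infty), hy]
  rw [heq.fderiv_eq, fderiv_clm_apply (hBs.differentiableAt (by simp))
    (hfs.differentiableAt (by simp))]
  simp [hz.differentialMap_eq_zero s hs]

lemma exists_fderiv_differentialMap_eq_zero (hz : z.1 ∈ Ω)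
    (hzr : Module.finrank ℝ (fderiv ℝ f z.1).range = r) (h0 : differentialMap f z = 0) (w : E) :
    ∃ w', fderiv ℝ (differentialMap f) z (w, w') = 0 := by
  have hfz := (h.contDiffAt hz).of_le two_le_infty
  obtain ⟨w', hw'⟩ := fderiv_apply_mem_range (hfz.fderiv_right (m := 1) le_rfl)
    ((h.isOpen.eventually_mem hz).mono fun y hy ↦ hzr ▸ h.finrank_range_le y hy) h0 w
  refine ⟨-w', ?_⟩
  have hw' : fderiv ℝ f z.1 w' = fderiv ℝ (fderiv ℝ f) z.1 w z.2 := hw'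
  rw [fderiv_differentialMap hfz, map_neg, hw', add_neg_cancel]

/-- The velocity of a geodesic solves an autonomous differential equation, and `ζ` is a Jacobi field
along it. If the geodesic is tangent to the kernel of `Df` and so is the variation, to first order,
then `Df (ζ)` is constant; hence the range of `Df` does not shrink at the end of the geodesic. -/
lemma range_fderiv_le {z : ℝ → E × E} {p q a b : ℝ}
    (hz : IsKernelGeodesicOn f Γ Ω r z (Ioo p b)) (hzb : ContinuousAt z b) (hbΩ : (z b).1 ∈ Ω)
    (ha : a ∈ Ioo p b) (hbq : b < q)
    (hsol : ∀ w : E × E, ∃ ζ : ℝ → E × E, ζ a = w ∧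
      ∀ t ∈ Ioo p q, HasDerivAt ζ (fderiv ℝ (geodesicField Γ) (z t) (ζ t)) t) :
    (fderiv ℝ f (z a).1).range ≤ (fderiv ℝ f (z b).1).range := by
  rintro _ ⟨w, rfl⟩
  obtain ⟨w', hw'⟩ := h.exists_fderiv_differentialMap_eq_zero (hz.mem a ha)
    (hz.finrank_range a ha) (hz.differentialMap_eq_zero a ha) w
  obtain ⟨ζ, hζa, hζ⟩ := hsol (w, w')
  have hζI : ∀ t ∈ Ioo p b, HasDerivAt ζ (fderiv ℝ (geodesicField Γ) (z t) (ζ t)) t :=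
    fun t ht ↦ hζ t ⟨ht.1, ht.2.trans hbq⟩
  have hconst : ∀ t ∈ Ioo p b, fderiv ℝ f (z t).1 (ζ t).1 = fderiv ℝ f (z a).1 w := by
    have hvar := h.fderiv_differentialMap_eq_zero isOpen_Ioo isPreconnected_Ioo hz hζI ha
      (by rw [hζa, hw'])
    simpa only [hζa] using h.eqOn_fderiv_fst isOpen_Ioo isPreconnected_Ioo hz hζI hvar ha
  have hcont : ContinuousAt (fun t ↦ fderiv ℝ f (z t).1 (ζ t).1) b :=
    ContinuousAt.clm_apply
      (((h.contDiffAt hbΩ).fderiv_right (m := ∞) (by simp)).continuousAt.comp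
        (f := fun t ↦ (z t).1) (continuousAt_fst.comp hzb))
      (continuousAt_fst.comp (hζ b ⟨ha.1.trans ha.2, hbq⟩).continuousAt)
  refine ⟨(ζ b).1, tendsto_nhds_unique (hcont.tendsto.mono_left nhdsWithin_le_nhds)
    (tendsto_const_nhds.congr' ?_ : Tendsto _ (𝓝[<] b) _)⟩
  filter_upwards [Ioo_mem_nhdsLT (ha.1.trans ha.2)] with t ht using (hconst t ht).symm

theorem finrank_range_eq_of_eventually_left {z : ℝ → E × E} {b : ℝ}
    (hz : ∀ᶠ s in 𝓝 b, HasDerivAt z (geodesicField Γ (z s)) s) (hzΩ : (z b).1 ∈ Ω)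
    (hleft : ∀ᶠ s in 𝓝[<] b, Module.finrank ℝ (fderiv ℝ f (z s).1).range = r ∧
      differentialMap f (z s) = 0) :
    Module.finrank ℝ (fderiv ℝ f (z b).1).range = r := by
  have hΩ : ∀ᶠ s in 𝓝 b, (z s).1 ∈ Ω :=
    hz.self_of_nhds.continuousAt.eventually (h.eventually_fst_mem hzΩ)
  have hA : ∀ᶠ s in 𝓝 b, ContinuousAt (fun s ↦ fderiv ℝ (geodesicField Γ) (z s)) s := by
    filter_upwards [hz, hΩ] with s hs hsΩ
    exact ((contDiffAt_geodesicField (h.contDiffAt_symbol hsΩ)).fderiv_right (m := ∞)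
      (by simp)).continuousAt.comp (f := z) hs.continuousAt
  obtain ⟨ε, hε, hsol⟩ := exists_forall_hasDerivAt_linear hA
  obtain ⟨l, hl, hkernel⟩ := mem_nhdsLT_iff_exists_Ioo_subset.1
    (((hz.and hΩ).filter_mono nhdsWithin_le_nhds).and hleft)
  have hgeod : IsKernelGeodesicOn f Γ Ω r z (Ioo (max (b - ε) l) b) := by
    have hsub : Ioo (max (b - ε) l) b ⊆ Ioo l b := Ioo_subset_Ioo_left (le_max_right _ _)
    exact ⟨fun t ht ↦ (hkernel (hsub ht)).1.1, fun t ht ↦ (hkernel (hsub ht)).1.2,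
      fun t ht ↦ (hkernel (hsub ht)).2.1, fun t ht ↦ (hkernel (hsub ht)).2.2⟩
  obtain ⟨a, ha⟩ : (Ioo (max (b - ε) l) b).Nonempty :=
    nonempty_Ioo.2 (max_lt (sub_lt_self b hε) hl)
  have hεb : b < b + ε := lt_add_of_pos_right b hε
  have hrange := h.range_fderiv_le hgeod hz.self_of_nhds.continuousAt hzΩ ha hεb fun w ↦ by
    obtain ⟨ζ, hζa, hζ⟩ := hsol a ⟨(le_max_left _ _).trans_lt ha.1, ha.2.trans hεb⟩ w
    exact ⟨ζ, hζa, fun t ht ↦ hζ t ⟨(le_max_left _ _).trans_lt ht.1, ht.2⟩⟩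
  exact le_antisymm (h.finrank_range_le _ hzΩ)
    ((hgeod.finrank_range a ha).symm.trans_le (Submodule.finrank_mono hrange))

end IsAutoparallelKernel

end GeodesicField

/-! ### Maps and metrics in charts -/

section Charts

variable {E : Type*} [NormedAddCommGroup E] [NormedSpace ℝ E]
  {M : Type*} [TopologicalSpace M] [ChartedSpace E M]
  {K : Type*} [NormedAddCommGroup K] [NormedSpace ℝ K]
  {L : Type*} [TopologicalSpace L] [ChartedSpace K L]

/-- The expression of a map `j : L → M` in the charts around `q₀` and `x₀`. -/
def inCharts (q₀ : L) (x₀ : M) (j : L → M) (y : K) : E :=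
  extChartAt 𝓘(ℝ, E) x₀ (j ((extChartAt 𝓘(ℝ, K) q₀).symm y))

section

variable [IsManifold 𝓘(ℝ, E) ∞ M] {x₀ x : M} {y : E}

lemma contMDiffAt_extChartAt_symm (hy : y ∈ (extChartAt 𝓘(ℝ, E) x₀).target) :
    ContMDiffAt 𝓘(ℝ, E) 𝓘(ℝ, E) ∞ (extChartAt 𝓘(ℝ, E) x₀).symm y :=
  (contMDiffOn_extChartAt_symm x₀).contMDiffAt ((isOpen_extChartAt_target x₀).mem_nhds hy)

lemma contMDiffAt_extChartAt_of_mem (hx : x ∈ (extChartAt 𝓘(ℝ, E) x₀).source) :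
    ContMDiffAt 𝓘(ℝ, E) 𝓘(ℝ, E) ∞ (extChartAt 𝓘(ℝ, E) x₀) x :=
  contMDiffAt_extChartAt' (by rwa [extChartAt_source] at hx)

lemma isInvertible_mfderiv_extChartAt_of_mem (hx : x ∈ (extChartAt 𝓘(ℝ, E) x₀).source) :
    (mfderiv 𝓘(ℝ, E) 𝓘(ℝ, E) (extChartAt 𝓘(ℝ, E) x₀) x).IsInvertible := by
  have : IsManifold 𝓘(ℝ, E) 1 M := .of_le (n := ∞) (by norm_cast)
  exact isInvertible_mfderiv_extChartAt hx

lemma isInvertible_mfderiv_extChartAt_symm (hy : y ∈ (extChartAt 𝓘(ℝ, E) x₀).target) :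
    (mfderiv 𝓘(ℝ, E) 𝓘(ℝ, E) (extChartAt 𝓘(ℝ, E) x₀).symm y).IsInvertible := by
  have : IsManifold 𝓘(ℝ, E) 1 M := .of_le (n := ∞) (by norm_cast)
  have h := isInvertible_mfderivWithin_extChartAt_symm (I := 𝓘(ℝ, E)) hy
  rwa [ModelWithCorners.range_eq_univ, mfderivWithin_univ] at h

lemma mfderiv_extChartAt_comp_symm (hy : y ∈ (extChartAt 𝓘(ℝ, E) x₀).target) :
    (mfderiv 𝓘(ℝ, E) 𝓘(ℝ, E) (extChartAt 𝓘(ℝ, E) x₀) ((extChartAt 𝓘(ℝ, E) x₀).symm y)) ∘L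
      (mfderiv 𝓘(ℝ, E) 𝓘(ℝ, E) (extChartAt 𝓘(ℝ, E) x₀).symm y) =
      ContinuousLinearMap.id ℝ _ := by
  have : IsManifold 𝓘(ℝ, E) 1 M := .of_le (n := ∞) (by norm_cast)
  have h := mfderiv_extChartAt_comp_mfderivWithin_extChartAt_symm (I := 𝓘(ℝ, E)) hy
  rwa [ModelWithCorners.range_eq_univ, mfderivWithin_univ] at h

end

variable [IsManifold 𝓘(ℝ, K) ∞ L] {q₀ : L} {x₀ : M} {j : L → M} {y : K}

lemma contMDiffAt_comp_extChartAt_symm (hy : y ∈ (extChartAt 𝓘(ℝ, K) q₀).target)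
    (hj : ContMDiffAt 𝓘(ℝ, K) 𝓘(ℝ, E) ∞ j ((extChartAt 𝓘(ℝ, K) q₀).symm y)) :
    ContMDiffAt 𝓘(ℝ, K) 𝓘(ℝ, E) ∞ (j ∘ (extChartAt 𝓘(ℝ, K) q₀).symm) y :=
  hj.comp y (contMDiffAt_extChartAt_symm hy)

lemma mfderiv_comp_extChartAt_symm (hy : y ∈ (extChartAt 𝓘(ℝ, K) q₀).target)
    (hj : ContMDiffAt 𝓘(ℝ, K) 𝓘(ℝ, E) ∞ j ((extChartAt 𝓘(ℝ, K) q₀).symm y)) :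
    mfderiv 𝓘(ℝ, K) 𝓘(ℝ, E) (j ∘ (extChartAt 𝓘(ℝ, K) q₀).symm) y =
      mfderiv 𝓘(ℝ, K) 𝓘(ℝ, E) j ((extChartAt 𝓘(ℝ, K) q₀).symm y) ∘L
        mfderiv 𝓘(ℝ, K) 𝓘(ℝ, K) (extChartAt 𝓘(ℝ, K) q₀).symm y :=
  mfderiv_comp y (hj.mdifferentiableAt (by simp))
    ((contMDiffAt_extChartAt_symm hy).mdifferentiableAt (by simp))

variable [IsManifold 𝓘(ℝ, E) ∞ M]

lemma contDiffAt_inCharts (hy : y ∈ (extChartAt 𝓘(ℝ, K) q₀).target)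
    (hj : ContMDiffAt 𝓘(ℝ, K) 𝓘(ℝ, E) ∞ j ((extChartAt 𝓘(ℝ, K) q₀).symm y))
    (hjy : j ((extChartAt 𝓘(ℝ, K) q₀).symm y) ∈ (extChartAt 𝓘(ℝ, E) x₀).source) :
    ContDiffAt ℝ ∞ (inCharts q₀ x₀ j : K → E) y :=
  contMDiffAt_iff_contDiffAt.1 ((contMDiffAt_extChartAt_of_mem hjy).comp y
    (contMDiffAt_comp_extChartAt_symm hy hj))

lemma fderiv_inCharts (hy : y ∈ (extChartAt 𝓘(ℝ, K) q₀).target)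
    (hj : ContMDiffAt 𝓘(ℝ, K) 𝓘(ℝ, E) ∞ j ((extChartAt 𝓘(ℝ, K) q₀).symm y))
    (hjy : j ((extChartAt 𝓘(ℝ, K) q₀).symm y) ∈ (extChartAt 𝓘(ℝ, E) x₀).source) (v : K) :
    fderiv ℝ (inCharts q₀ x₀ j : K → E) y v =
      mfderiv 𝓘(ℝ, E) 𝓘(ℝ, E) (extChartAt 𝓘(ℝ, E) x₀) (j ((extChartAt 𝓘(ℝ, K) q₀).symm y))
        (mfderiv 𝓘(ℝ, K) 𝓘(ℝ, E) j ((extChartAt 𝓘(ℝ, K) q₀).symm y)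
          (mfderiv 𝓘(ℝ, K) 𝓘(ℝ, K) (extChartAt 𝓘(ℝ, K) q₀).symm y v)) := by
  have h : mfderiv 𝓘(ℝ, K) 𝓘(ℝ, E) (inCharts q₀ x₀ j : K → E) y = _ :=
    mfderiv_comp y ((contMDiffAt_extChartAt_of_mem hjy).mdifferentiableAt (by simp))
      ((contMDiffAt_comp_extChartAt_symm hy hj).mdifferentiableAt (by simp))
  rw [← mfderiv_eq_fderiv, h]
  exact congrArg (mfderiv 𝓘(ℝ, E) 𝓘(ℝ, E) (extChartAt 𝓘(ℝ, E) x₀)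
    (j ((extChartAt 𝓘(ℝ, K) q₀).symm y)))
    (DFunLike.congr_fun (mfderiv_comp_extChartAt_symm hy hj) v)

lemma fderiv_inCharts_injective (hy : y ∈ (extChartAt 𝓘(ℝ, K) q₀).target)
    (hj : ContMDiffAt 𝓘(ℝ, K) 𝓘(ℝ, E) ∞ j ((extChartAt 𝓘(ℝ, K) q₀).symm y))
    (hjy : j ((extChartAt 𝓘(ℝ, K) q₀).symm y) ∈ (extChartAt 𝓘(ℝ, E) x₀).source)
    (hinj : Function.Injective
      (mfderiv 𝓘(ℝ, K) 𝓘(ℝ, E) j ((extChartAt 𝓘(ℝ, K) q₀).symm y))) :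
    Function.Injective (fderiv ℝ (inCharts q₀ x₀ j : K → E) y) := by
  intro v w hvw
  rw [fderiv_inCharts hy hj hjy, fderiv_inCharts hy hj hjy] at hvw
  exact (isInvertible_mfderiv_extChartAt_symm hy).injective
    (hinj ((isInvertible_mfderiv_extChartAt_of_mem hjy).injective hvw))

end Charts

section PullbackForm

lemma pullbackForm_apply {V W : Type*} [AddCommGroup V] [Module ℝ V] [TopologicalSpace V]
    [AddCommGroup W] [Module ℝ W] [TopologicalSpace W] (B : W →L[ℝ] W →L[ℝ] ℝ) (A : V →L[ℝ] W)
    (v w : V) : pullbackForm B A v w = B (A v) (A w) := rfl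

variable {E : Type*} [NormedAddCommGroup E] [NormedSpace ℝ E]
  {K : Type*} [NormedAddCommGroup K] [NormedSpace ℝ K]

lemma differentiableAt_pullbackForm {X : Type*} [NormedAddCommGroup X] [NormedSpace ℝ X]
    {B : X → E →L[ℝ] E →L[ℝ] ℝ} {A : X → K →L[ℝ] E} {x : X}
    (hB : DifferentiableAt ℝ B x) (hA : DifferentiableAt ℝ A x) :
    DifferentiableAt ℝ (fun z ↦ pullbackForm (B z) (A z)) x :=
  ((ContinuousLinearMap.compL ℝ K E ℝ).flip.differentiableAt.comp x hA).clm_comp (hB.clm_comp hA)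

lemma fderiv_pullbackForm {G : E → E →L[ℝ] E →L[ℝ] ℝ} {i : K → E} {y : K}
    (hG : DifferentiableAt ℝ G (i y)) (hi : ContDiffAt ℝ 2 i y) (u v w : K) :
    fderiv ℝ (fun z ↦ pullbackForm (G (i z)) (fderiv ℝ i z)) y u v w =
      fderiv ℝ G (i y) (fderiv ℝ i y u) (fderiv ℝ i y v) (fderiv ℝ i y w)
        + G (i y) (fderiv ℝ (fderiv ℝ i) y u v) (fderiv ℝ i y w)
        + G (i y) (fderiv ℝ i y v) (fderiv ℝ (fderiv ℝ i) y u w) := by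
  have hi' : DifferentiableAt ℝ i y := hi.differentiableAt (by simp)
  have hDi : DifferentiableAt ℝ (fderiv ℝ i) y :=
    (hi.fderiv_right (m := 1) le_rfl).differentiableAt one_ne_zero
  have hDi_apply (a : K) := hDi.hasFDerivAt.clm_apply (hasFDerivAt_const a y)
  have hpull := differentiableAt_pullbackForm (hG.comp y hi') hDi
  have happly := ((hG.hasFDerivAt.comp y hi'.hasFDerivAt).clm_apply (hDi_apply v)).clm_apply
    (hDi_apply w)
  have heval := (hpull.hasFDerivAt.clm_apply (hasFDerivAt_const v y)).clm_apply
    (hasFDerivAt_const w y)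
  have h := DFunLike.congr_fun (happly.unique heval) u
  simp only [add_apply, ContinuousLinearMap.comp_apply, ContinuousLinearMap.flip_apply,
    zero_add, Function.comp_apply, ContinuousLinearMap.comp_zero] at h
  exact h.symm.trans (by ring)

variable {M : Type*} [TopologicalSpace M] [ChartedSpace E M]

lemma pullbackForm_mfderiv_congr
    (g : ∀ x : M, TangentSpace 𝓘(ℝ, E) x →L[ℝ] TangentSpace 𝓘(ℝ, E) x →L[ℝ] ℝ)
    {h h' : K → M} {y : K} (hh : h =ᶠ[𝓝 y] h') :
    pullbackForm (g (h y)) (mfderiv 𝓘(ℝ, K) 𝓘(ℝ, E) h y) =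
      pullbackForm (g (h' y)) (mfderiv 𝓘(ℝ, K) 𝓘(ℝ, E) h' y) := by
  let G : M → E →L[ℝ] E →L[ℝ] ℝ := g
  change pullbackForm (V := K) (W := E) (G (h y)) (mfderiv 𝓘(ℝ, K) 𝓘(ℝ, E) h y) =
    pullbackForm (V := K) (W := E) (G (h' y)) (mfderiv 𝓘(ℝ, K) 𝓘(ℝ, E) h' y)
  rw [hh.eq_of_nhds]
  exact congrArg (pullbackForm (V := K) (W := E) (G (h' y))) hh.mfderiv_eq

end PullbackForm

section InducedMetric

variable {E : Type*} [NormedAddCommGroup E] [NormedSpace ℝ E]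
  {M : Type u} [TopologicalSpace M] [ChartedSpace E M]
  (g : ∀ x : M, TangentSpace 𝓘(ℝ, E) x →L[ℝ] TangentSpace 𝓘(ℝ, E) x →L[ℝ] ℝ)

lemma inducedMetric_id : inducedMetric E g (id : M → M) = g := by
  ext x v w
  simp only [inducedMetric, mfderiv_id]
  rfl

variable [IsManifold 𝓘(ℝ, E) ∞ M] {K : Type*} [NormedAddCommGroup K] [NormedSpace ℝ K]
  {L : Type u} [TopologicalSpace L] [ChartedSpace K L] [IsManifold 𝓘(ℝ, K) ∞ L]
  {q₀ : L} {x₀ : M} {j : L → M} {y : K}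

lemma formInChart_inducedMetric (hy : y ∈ (extChartAt 𝓘(ℝ, K) q₀).target)
    (hj : ContMDiffAt 𝓘(ℝ, K) 𝓘(ℝ, E) ∞ j ((extChartAt 𝓘(ℝ, K) q₀).symm y))
    (hjy : j ((extChartAt 𝓘(ℝ, K) q₀).symm y) ∈ (extChartAt 𝓘(ℝ, E) x₀).source) :
    formInChart (inducedMetric K g j) q₀ y =
      pullbackForm (formInChart g x₀ (inCharts q₀ x₀ j y))
        (fderiv ℝ (inCharts q₀ x₀ j : K → E) y) := by
  have htarget : inCharts (E := E) q₀ x₀ j y ∈ (extChartAt 𝓘(ℝ, E) x₀).target :=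
    (extChartAt 𝓘(ℝ, E) x₀).map_source hjy
  have hchart : mfderiv 𝓘(ℝ, K) 𝓘(ℝ, E)
      ((extChartAt 𝓘(ℝ, E) x₀).symm ∘ inCharts (E := E) q₀ x₀ j) y = _ :=
    mfderiv_comp y ((contMDiffAt_extChartAt_symm htarget).mdifferentiableAt (by simp))
      ((contMDiffAt_iff_contDiffAt.2 (contDiffAt_inCharts hy hj hjy)).mdifferentiableAt (by simp))
  have heq : j ∘ (extChartAt 𝓘(ℝ, K) q₀).symm =ᶠ[𝓝 y]
      (extChartAt 𝓘(ℝ, E) x₀).symm ∘ inCharts (E := E) q₀ x₀ j := by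
    filter_upwards [(contMDiffAt_comp_extChartAt_symm hy hj).continuousAt
      ((isOpen_extChartAt_source x₀).mem_nhds hjy)] with z hz
    exact ((extChartAt 𝓘(ℝ, E) x₀).left_inv hz).symm
  have h := pullbackForm_mfderiv_congr g heq
  rw [mfderiv_comp_extChartAt_symm hy hj, hchart, mfderiv_eq_fderiv] at h
  exact h

end InducedMetric

section Christoffel

lemma isInvertible_of_pos {E : Type*} [NormedAddCommGroup E] [NormedSpace ℝ E]
    [FiniteDimensional ℝ E] {B : E →L[ℝ] E →L[ℝ] ℝ} (hB : ∀ v, v ≠ 0 → 0 < B v v) :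
    B.IsInvertible := by
  have hinj : Function.Injective B := by
    refine (injective_iff_map_eq_zero B).2 fun v hv ↦ ?_
    by_contra hne
    simpa [hv] using hB v hne
  have hfinrank : Module.finrank ℝ E = Module.finrank ℝ (E →L[ℝ] ℝ) := by
    rw [← (LinearMap.toContinuousLinearMap : (E →ₗ[ℝ] ℝ) ≃ₗ[ℝ] E →L[ℝ] ℝ).finrank_eq]
    exact (Subspace.dual_finrank_eq (K := ℝ) (V := E)).symm
  exact ⟨(LinearEquiv.ofInjectiveOfFinrankEq B.toLinearMap hinj hfinrank).toContinuousLinearEquiv,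
    rfl⟩

variable {E : Type*} [NormedAddCommGroup E] [NormedSpace ℝ E]
  {M : Type*} [TopologicalSpace M] [ChartedSpace E M]
  (g : ∀ x : M, TangentSpace 𝓘(ℝ, E) x →L[ℝ] TangentSpace 𝓘(ℝ, E) x →L[ℝ] ℝ) {x₀ : M} {y : E}

lemma christoffelFirst_apply (x₀ : M) (y v v' w : E) :
    christoffelFirst g x₀ y v v' w = (1 / 2 : ℝ) * (fderiv ℝ (formInChart g x₀) y v v' w +
      fderiv ℝ (formInChart g x₀) y v' v w - fderiv ℝ (formInChart g x₀) y w v v') := rfl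

/-- The Christoffel symbol as a continuous bilinear map. -/
def christoffelBilin (x₀ : M) (y : E) : E →L[ℝ] E →L[ℝ] E :=
  ContinuousLinearMap.compL ℝ E (E →L[ℝ] ℝ) E (formInChart g x₀ y).inverse ∘L
    ((1 / 2 : ℝ) • (fderiv ℝ (formInChart g x₀) y + (fderiv ℝ (formInChart g x₀) y).flip -
      (ContinuousLinearMap.flipₗᵢ ℝ E E ℝ : _ →L[ℝ] _) ∘L (fderiv ℝ (formInChart g x₀) y).flip))

lemma christoffelBilin_apply (x₀ : M) (y v v' : E) :
    christoffelBilin g x₀ y v v' = christoffel g x₀ y v v' := rfl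

variable {g}

lemma formInChart_christoffel (h : (formInChart g x₀ y).IsInvertible) (v v' : E) :
    formInChart g x₀ y (christoffel g x₀ y v v') = christoffelFirst g x₀ y v v' :=
  h.self_apply_inverse _

lemma contDiffAt_christoffelBilin [CompleteSpace E] (h : (formInChart g x₀ y).IsInvertible)
    (hg : ContDiffAt ℝ ∞ (formInChart g x₀) y) :
    ContDiffAt ℝ ∞ (christoffelBilin g x₀) y := by
  have hD : ContDiffAt ℝ ∞ (fderiv ℝ (formInChart g x₀)) y := hg.fderiv_right (m := ∞) (by simp)
  have hflip : ContDiffAt ℝ ∞ (fun z ↦ (fderiv ℝ (formInChart g x₀) z).flip) y :=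
    (ContinuousLinearMap.flipₗᵢ ℝ E E (E →L[ℝ] ℝ)).contDiff.contDiffAt.comp y hD
  have hinv : ContDiffAt ℝ ∞ (fun z ↦ (formInChart g x₀ z).inverse) y :=
    h.contDiffAt_map_inverse.comp y hg
  exact ((ContinuousLinearMap.compL ℝ E (E →L[ℝ] ℝ) E).contDiff.contDiffAt.comp y hinv).clm_comp
    (((hD.add hflip).sub (contDiffAt_const.clm_comp hflip)).const_smul (1 / 2 : ℝ))

end Christoffel

/-! ### The Levi-Civita connection in charts -/

section Metric

variable {E : Type*} [NormedAddCommGroup E] [NormedSpace ℝ E]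
  {M : Type*} [TopologicalSpace M] [ChartedSpace E M] [IsManifold 𝓘(ℝ, E) ∞ M] {x₀ : M} {y : E}

lemma contMDiffAt_mfderiv_extChartAt_symm (hy : y ∈ (extChartAt 𝓘(ℝ, E) x₀).target) {X : E → E}
    (hX : ContDiffAt ℝ ∞ X y) :
    ContMDiffAt 𝓘(ℝ, E) 𝓘(ℝ, E).tangent ∞
      (fun z ↦ (⟨(extChartAt 𝓘(ℝ, E) x₀).symm z,
        mfderiv 𝓘(ℝ, E) 𝓘(ℝ, E) (extChartAt 𝓘(ℝ, E) x₀).symm z (X z)⟩ :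
        TangentBundle 𝓘(ℝ, E) M)) y := by
  have hopen := isOpen_extChartAt_target (I := 𝓘(ℝ, E)) x₀
  have hfield : ContMDiffAt 𝓘(ℝ, E) 𝓘(ℝ, E).tangent ∞
      (fun z ↦ (⟨z, X z⟩ : TangentBundle 𝓘(ℝ, E) E)) y := by
    rw [Bundle.contMDiffAt_totalSpace]
    refine ⟨contMDiffAt_id, ?_⟩
    simpa using! contMDiffAt_iff_contDiffAt.2 hX
  have htangent : ContMDiffAt 𝓘(ℝ, E).tangent 𝓘(ℝ, E).tangent ∞
      (tangentMapWithin 𝓘(ℝ, E) 𝓘(ℝ, E) (extChartAt 𝓘(ℝ, E) x₀).symm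
        (extChartAt 𝓘(ℝ, E) x₀).target) (⟨y, X y⟩ : TangentBundle 𝓘(ℝ, E) E) :=
    ((contMDiffOn_extChartAt_symm (n := ∞) x₀).contMDiffOn_tangentMapWithin (m := ∞) (by simp)
      hopen.uniqueMDiffOn).contMDiffAt
        ((hopen.preimage (FiberBundle.continuous_proj E _)).mem_nhds hy)
  refine (htangent.comp y hfield).congr_of_eventuallyEq ?_
  filter_upwards [hopen.mem_nhds hy] with z hz
  simp only [Function.comp_apply, tangentMapWithin, mfderivWithin_of_isOpen hopen hz]

variable (g : Bundle.ContMDiffRiemannianMetric 𝓘(ℝ, E) ∞ E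
  (fun x : M ↦ TangentSpace 𝓘(ℝ, E) x))

lemma contDiffAt_formInChart [FiniteDimensional ℝ E] (hy : y ∈ (extChartAt 𝓘(ℝ, E) x₀).target) :
    ContDiffAt ℝ ∞ (formInChart g.inner x₀) y := by
  refine contDiffAt_clm_of_apply fun v ↦ contDiffAt_clm_of_apply fun w ↦ ?_
  rw [← contMDiffAt_iff_contDiffAt]
  have h : ContMDiffAt 𝓘(ℝ, E) (𝓘(ℝ, E).prod 𝓘(ℝ, ℝ)) ∞
      (fun z ↦ Bundle.TotalSpace.mk' ℝ (E := Bundle.Trivial M ℝ)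
        ((extChartAt 𝓘(ℝ, E) x₀).symm z)
        (g.inner ((extChartAt 𝓘(ℝ, E) x₀).symm z)
          (mfderiv 𝓘(ℝ, E) 𝓘(ℝ, E) (extChartAt 𝓘(ℝ, E) x₀).symm z v)
          (mfderiv 𝓘(ℝ, E) 𝓘(ℝ, E) (extChartAt 𝓘(ℝ, E) x₀).symm z w))) y :=
    ContMDiffAt.clm_bundle_apply₂ (F₁ := E) (F₂ := E)
      (g.contMDiff.contMDiffAt.comp y (contMDiffAt_extChartAt_symm hy))
      (contMDiffAt_mfderiv_extChartAt_symm hy (X := fun _ ↦ v) contDiffAt_const)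
      (contMDiffAt_mfderiv_extChartAt_symm hy (X := fun _ ↦ w) contDiffAt_const)
  simp only [Bundle.contMDiffAt_totalSpace] at h
  exact h.2

lemma formInChart_symm (v w : E) :
    formInChart g.inner x₀ y v w = formInChart g.inner x₀ y w v :=
  g.symm _ _ _

lemma formInChart_pos (hy : y ∈ (extChartAt 𝓘(ℝ, E) x₀).target) {v : E} (hv : v ≠ 0) :
    0 < formInChart g.inner x₀ y v v :=
  g.pos _ _ ((map_ne_zero_iff _ (isInvertible_mfderiv_extChartAt_symm hy).injective).2 hv)

lemma isInvertible_formInChart [FiniteDimensional ℝ E]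
    (hy : y ∈ (extChartAt 𝓘(ℝ, E) x₀).target) : (formInChart g.inner x₀ y).IsInvertible :=
  isInvertible_of_pos fun _ ↦ formInChart_pos g hy

end Metric

section Gauss

variable {E : Type*} [NormedAddCommGroup E] [NormedSpace ℝ E] [FiniteDimensional ℝ E]
  {M : Type u} [TopologicalSpace M] [ChartedSpace E M] [IsManifold 𝓘(ℝ, E) ∞ M]
  (g : Bundle.ContMDiffRiemannianMetric 𝓘(ℝ, E) ∞ E (fun x : M ↦ TangentSpace 𝓘(ℝ, E) x))

/-- The Gauss formula: the induced Levi-Civita connection is the tangential part of the ambient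
one. -/
lemma christoffelFirst_inducedMetric {K : Type*} [NormedAddCommGroup K] [NormedSpace ℝ K]
    {L : Type u} [TopologicalSpace L] [ChartedSpace K L] [IsManifold 𝓘(ℝ, K) ∞ L]
    {q₀ : L} {x₀ : M} {j : L → M} {y : K}
    (hy : y ∈ (extChartAt 𝓘(ℝ, K) q₀).target) (hj : ContMDiff 𝓘(ℝ, K) 𝓘(ℝ, E) ∞ j)
    (hjy : j ((extChartAt 𝓘(ℝ, K) q₀).symm y) ∈ (extChartAt 𝓘(ℝ, E) x₀).source) (v v' w : K) :
    christoffelFirst (inducedMetric K g.inner j) q₀ y v v' w =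
      formInChart g.inner x₀ (inCharts q₀ x₀ j y)
        (fderiv ℝ (fderiv ℝ (inCharts (E := E) q₀ x₀ j)) y v v' +
          christoffel g.inner x₀ (inCharts q₀ x₀ j y)
            (fderiv ℝ (inCharts (E := E) q₀ x₀ j) y v)
            (fderiv ℝ (inCharts (E := E) q₀ x₀ j) y v'))
        (fderiv ℝ (inCharts (E := E) q₀ x₀ j) y w) := by
  have htarget : inCharts (E := E) q₀ x₀ j y ∈ (extChartAt 𝓘(ℝ, E) x₀).target :=
    (extChartAt 𝓘(ℝ, E) x₀).map_source hjy
  have hi : ContDiffAt ℝ 2 (inCharts (E := E) q₀ x₀ j) y :=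
    (contDiffAt_inCharts hy hj.contMDiffAt hjy).of_le two_le_infty
  have heq : formInChart (inducedMetric K g.inner j) q₀ =ᶠ[𝓝 y]
      fun z ↦ pullbackForm (formInChart g.inner x₀ (inCharts q₀ x₀ j z))
        (fderiv ℝ (inCharts (E := E) q₀ x₀ j) z) := by
    filter_upwards [(isOpen_extChartAt_target q₀).mem_nhds hy,
      (contMDiffAt_comp_extChartAt_symm hy hj.contMDiffAt).continuousAt
        ((isOpen_extChartAt_source x₀).mem_nhds hjy)] with z hz hjz
    exact formInChart_inducedMetric g.inner hz hj.contMDiffAt hjz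
  have hpull := fderiv_pullbackForm
    ((contDiffAt_formInChart g htarget).differentiableAt (by simp)) hi
  have hsymm : IsSymmSndFDerivAt ℝ (inCharts (E := E) q₀ x₀ j) y :=
    hi.isSymmSndFDerivAt (by simp)
  rw [christoffelFirst_apply, heq.fderiv_eq, hpull, hpull, hpull, map_add, add_apply,
    formInChart_christoffel (isInvertible_formInChart g htarget), christoffelFirst_apply,
    hsymm.eq v' v, hsymm.eq w v, hsymm.eq w v',
    formInChart_symm g (fderiv ℝ (inCharts (E := E) q₀ x₀ j) y v') _]
  ring

/-- The transformation law of the Christoffel symbol is the Gauss formula for the identity. -/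
lemma fderiv_inCharts_christoffel {p x : M} {y : E}
    (hy : y ∈ (extChartAt 𝓘(ℝ, E) x).target)
    (hyp : (extChartAt 𝓘(ℝ, E) x).symm y ∈ (extChartAt 𝓘(ℝ, E) p).source) (v v' : E) :
    fderiv ℝ (inCharts (E := E) x p (id : M → M)) y (christoffel g.inner x y v v') =
      fderiv ℝ (fderiv ℝ (inCharts (E := E) x p (id : M → M))) y v v' +
        christoffel g.inner p (inCharts x p (id : M → M) y)
          (fderiv ℝ (inCharts (E := E) x p (id : M → M)) y v)
          (fderiv ℝ (inCharts (E := E) x p (id : M → M)) y v') := by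
  have hinj : Function.Injective (fderiv ℝ (inCharts (E := E) x p (id : M → M)) y) :=
    fderiv_inCharts_injective hy contMDiff_id.contMDiffAt hyp
      (by rw [mfderiv_id]; exact Function.injective_id)
  have hinv := isInvertible_formInChart g ((extChartAt 𝓘(ℝ, E) p).map_source hyp)
  refine hinv.injective (ContinuousLinearMap.ext fun w ↦ ?_)
  obtain ⟨w, rfl⟩ := (LinearMap.injective_iff_surjective
    (f := (fderiv ℝ (inCharts (E := E) x p (id : M → M)) y : E →ₗ[ℝ] E))).1 hinj w
  refine Eq.trans ?_ (christoffelFirst_inducedMetric g hy contMDiff_id hyp v v' w)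
  rw [inducedMetric_id, ← formInChart_christoffel (isInvertible_formInChart g hy)]
  have h := formInChart_inducedMetric g.inner hy contMDiff_id.contMDiffAt hyp
  rw [inducedMetric_id] at h
  rw [h, pullbackForm_apply]
  rfl

end Gauss

section Hessian

lemma hessianAt_comp {E F : Type*} [NormedAddCommGroup E] [NormedSpace ℝ E]
    [NormedAddCommGroup F] [NormedSpace ℝ F] {E' : Type*} [NormedAddCommGroup E']
    [NormedSpace ℝ E'] {f : E → F} {i : E' → E} {y : E'}
    {Γ : E → E →L[ℝ] E →L[ℝ] E} {Γ' : E' → E' →L[ℝ] E' →L[ℝ] E'}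
    (hf : ContDiffAt ℝ 2 f (i y)) (hi : ContDiffAt ℝ 2 i y) {u v : E'}
    (hΓ : fderiv ℝ i y (Γ' y u v) =
      fderiv ℝ (fderiv ℝ i) y u v + Γ (i y) (fderiv ℝ i y u) (fderiv ℝ i y v)) :
    hessianAt (f ∘ i) Γ' y u v = hessianAt f Γ (i y) (fderiv ℝ i y u) (fderiv ℝ i y v) := by
  have heq : fderiv ℝ (f ∘ i) =ᶠ[𝓝 y] fun z ↦ (fderiv ℝ f (i z)).comp (fderiv ℝ i z) := by
    filter_upwards [hi.eventually (by simp), hi.continuousAt.eventually (hf.eventually (by simp))]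
      with z hiz hfz
    exact fderiv_comp z (hfz.differentiableAt (by simp)) (hiz.differentiableAt (by simp))
  have hDf : DifferentiableAt ℝ (fderiv ℝ f) (i y) :=
    (hf.fderiv_right (m := 1) le_rfl).differentiableAt one_ne_zero
  have hDi : DifferentiableAt ℝ (fderiv ℝ i) y :=
    (hi.fderiv_right (m := 1) le_rfl).differentiableAt one_ne_zero
  have hsecond : fderiv ℝ (fderiv ℝ (f ∘ i)) y u v =
      fderiv ℝ (fderiv ℝ f) (i y) (fderiv ℝ i y u) (fderiv ℝ i y v) +
        fderiv ℝ f (i y) (fderiv ℝ (fderiv ℝ i) y u v) := by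
    have h := ((hDf.hasFDerivAt.comp y (hi.differentiableAt (by simp)).hasFDerivAt).clm_comp
      hDi.hasFDerivAt).fderiv
    rw [heq.fderiv_eq]
    refine (DFunLike.congr_fun (DFunLike.congr_fun h u) v).trans ?_
    simp [add_comm]
  rw [hessianAt_apply, hessianAt_apply, hsecond, heq.self_of_nhds,
    ContinuousLinearMap.comp_apply, hΓ, map_add]
  abel

end Hessian

/-! ### Autoparallel kernels -/

section Kernel

lemma finrank_range_of_comp {V V' W W' : Type*} [AddCommGroup V] [Module ℝ V] [AddCommGroup V']
    [Module ℝ V'] [AddCommGroup W] [Module ℝ W] [AddCommGroup W'] [Module ℝ W']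
    {A : W →ₗ[ℝ] W'} {B : V →ₗ[ℝ] W} {C : V' →ₗ[ℝ] V} {D : V' →ₗ[ℝ] W'}
    (hA : Function.Injective A) (hC : Function.Surjective C) (hD : ∀ v, D v = A (B (C v))) :
    Module.finrank ℝ D.range = Module.finrank ℝ B.range := by
  obtain rfl : D = A ∘ₗ B ∘ₗ C := LinearMap.ext hD
  rw [LinearMap.range_comp, LinearMap.range_comp_of_range_eq_top _ (LinearMap.range_eq_top.2 hC)]
  exact (Submodule.equivMapOfInjective A hA _).finrank_eq.symm

variable {E : Type*} [NormedAddCommGroup E] [NormedSpace ℝ E]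
  {M : Type*} [TopologicalSpace M] [ChartedSpace E M]
  {F : Type*} [NormedAddCommGroup F] [NormedSpace ℝ F]
  {N : Type*} [TopologicalSpace N] [ChartedSpace F N]
  {f : M → N} {x₀ x : M} {y₀ : N} {y : E}

lemma isOpen_extChartAt_target_inter_preimage (hf : Continuous f) (x₀ : M) (y₀ : N) :
    IsOpen ((extChartAt 𝓘(ℝ, E) x₀).target ∩
      (extChartAt 𝓘(ℝ, E) x₀).symm ⁻¹' (f ⁻¹' (extChartAt 𝓘(ℝ, F) y₀).source)) :=
  (continuousOn_extChartAt_symm x₀).isOpen_inter_preimage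
    (isOpen_extChartAt_target x₀) ((isOpen_extChartAt_source y₀).preimage hf)

lemma extChartAt_mem_target_inter_preimage (hx : x ∈ (extChartAt 𝓘(ℝ, E) x₀).source)
    (hfx : f x ∈ (extChartAt 𝓘(ℝ, F) y₀).source) :
    extChartAt 𝓘(ℝ, E) x₀ x ∈ (extChartAt 𝓘(ℝ, E) x₀).target ∩
      (extChartAt 𝓘(ℝ, E) x₀).symm ⁻¹' (f ⁻¹' (extChartAt 𝓘(ℝ, F) y₀).source) :=
  ⟨(extChartAt 𝓘(ℝ, E) x₀).map_source hx, by
    rwa [mem_preimage, (extChartAt 𝓘(ℝ, E) x₀).left_inv hx]⟩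

variable [IsManifold 𝓘(ℝ, E) ∞ M] [IsManifold 𝓘(ℝ, F) ∞ N]

lemma fderiv_inCharts_eq_zero_iff (hf : ContMDiff 𝓘(ℝ, E) 𝓘(ℝ, F) ∞ f)
    (hy : y ∈ (extChartAt 𝓘(ℝ, E) x₀).target)
    (hfy : f ((extChartAt 𝓘(ℝ, E) x₀).symm y) ∈ (extChartAt 𝓘(ℝ, F) y₀).source) (v : E) :
    fderiv ℝ (inCharts (E := F) x₀ y₀ f) y v = 0 ↔
      mfderiv 𝓘(ℝ, E) 𝓘(ℝ, F) f ((extChartAt 𝓘(ℝ, E) x₀).symm y)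
        (mfderiv 𝓘(ℝ, E) 𝓘(ℝ, E) (extChartAt 𝓘(ℝ, E) x₀).symm y v) = 0 := by
  rw [fderiv_inCharts hy hf.contMDiffAt hfy]
  exact map_eq_zero_iff _ (isInvertible_mfderiv_extChartAt_of_mem hfy).injective

lemma finrank_range_fderiv_inCharts (hf : ContMDiff 𝓘(ℝ, E) 𝓘(ℝ, F) ∞ f)
    (hy : y ∈ (extChartAt 𝓘(ℝ, E) x₀).target)
    (hfy : f ((extChartAt 𝓘(ℝ, E) x₀).symm y) ∈ (extChartAt 𝓘(ℝ, F) y₀).source) :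
    Module.finrank ℝ (fderiv ℝ (inCharts (E := F) x₀ y₀ f) y).range =
      rankAt E F f ((extChartAt 𝓘(ℝ, E) x₀).symm y) :=
  finrank_range_of_comp
    (A := (mfderiv 𝓘(ℝ, F) 𝓘(ℝ, F) (extChartAt 𝓘(ℝ, F) y₀)
      (f ((extChartAt 𝓘(ℝ, E) x₀).symm y))).toLinearMap)
    (B := (mfderiv 𝓘(ℝ, E) 𝓘(ℝ, F) f ((extChartAt 𝓘(ℝ, E) x₀).symm y)).toLinearMap)
    (C := (mfderiv 𝓘(ℝ, E) 𝓘(ℝ, E) (extChartAt 𝓘(ℝ, E) x₀).symm y).toLinearMap)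
    (isInvertible_mfderiv_extChartAt_of_mem hfy).injective
    (isInvertible_mfderiv_extChartAt_symm hy).surjective
    (fun v ↦ fderiv_inCharts hy hf.contMDiffAt hfy v)

variable [FiniteDimensional ℝ E]

lemma eventually_rankAt_le (hf : ContMDiff 𝓘(ℝ, E) 𝓘(ℝ, F) ∞ f) (x : M) :
    ∀ᶠ z in 𝓝 x, rankAt E F f x ≤ rankAt E F f z := by
  have hmem (z : M) (hz : z ∈ (extChartAt 𝓘(ℝ, E) x).source)
      (hfz : f z ∈ (extChartAt 𝓘(ℝ, F) (f x)).source) :=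
    extChartAt_mem_target_inter_preimage hz hfz
  have hx := hmem x (mem_extChartAt_source x) (mem_extChartAt_source (f x))
  have hsemi := eventually_finrank_range_le
    ((contDiffAt_inCharts hx.1 hf.contMDiffAt hx.2).fderiv_right (m := ∞) (by simp)).continuousAt
  filter_upwards [(continuousAt_extChartAt x).eventually hsemi,
    extChartAt_source_mem_nhds (I := 𝓘(ℝ, E)) x,
    hf.continuous.continuousAt (extChartAt_source_mem_nhds (I := 𝓘(ℝ, F)) (f x))]
    with z hz hzs hfz
  have hz' := hmem z hzs hfz
  rwa [finrank_range_fderiv_inCharts hf hx.1 hx.2, finrank_range_fderiv_inCharts hf hz'.1 hz'.2,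
    extChartAt_to_inv, (extChartAt 𝓘(ℝ, E) x).left_inv hzs] at hz

lemma isOpen_maxRankSet (hf : ContMDiff 𝓘(ℝ, E) 𝓘(ℝ, F) ∞ f) : IsOpen (maxRankSet E F f) := by
  refine isOpen_iff_mem_nhds.2 fun x hx ↦ ?_
  filter_upwards [eventually_rankAt_le hf x] with z hz w using (hx w).trans hz

end Kernel

section Autoparallel

variable {E : Type*} [NormedAddCommGroup E] [NormedSpace ℝ E]
  {F : Type*} [NormedAddCommGroup F] [NormedSpace ℝ F]

/-- Differentiate `Df (Y) = 0` in the direction `u`. -/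
lemma hessianAt_eq_neg_of_eventually_fderiv_eq_zero {f : E → F} {Γ : E → E →L[ℝ] E →L[ℝ] E}
    {Y : E → E} {x : E} (hf : ContDiffAt ℝ 2 f x) (hY : DifferentiableAt ℝ Y x)
    (h : ∀ᶠ z in 𝓝 x, fderiv ℝ f z (Y z) = 0) (u : E) :
    hessianAt f Γ x u (Y x) = -fderiv ℝ f x (fderiv ℝ Y x u + Γ x u (Y x)) := by
  have hDf : DifferentiableAt ℝ (fderiv ℝ f) x :=
    (hf.fderiv_right (m := 1) le_rfl).differentiableAt one_ne_zero
  have hzero : (fun z ↦ fderiv ℝ f z (Y z)) =ᶠ[𝓝 x] fun _ ↦ 0 := h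
  have hderiv := DFunLike.congr_fun (hzero.fderiv_eq (𝕜 := ℝ)) u
  rw [fderiv_clm_apply hDf hY] at hderiv
  simp only [add_apply, ContinuousLinearMap.comp_apply, ContinuousLinearMap.flip_apply,
    fderiv_fun_const, Pi.zero_apply, zero_apply] at hderiv
  rw [hessianAt_apply, map_add, eq_neg_of_add_eq_zero_right hderiv]
  abel

variable {M : Type*} [TopologicalSpace M] [ChartedSpace E M]

/-- The vector field with coordinate expression `X` in the chart around `p`; it is meaningful only
on the domain of this chart. -/
def chartField (p : M) (X : E → E) (x : M) : TangentSpace 𝓘(ℝ, E) x :=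
  mfderiv 𝓘(ℝ, E) 𝓘(ℝ, E) (extChartAt 𝓘(ℝ, E) p).symm (extChartAt 𝓘(ℝ, E) p x)
    (X (extChartAt 𝓘(ℝ, E) p x))

variable [IsManifold 𝓘(ℝ, E) ∞ M] {N : Type*} [TopologicalSpace N] [ChartedSpace F N]
  {f : M → N} {p x x₀ : M} {y₀ : N} {X Y : E → E} {y : E}

lemma fieldInChart_chartField (hy : y ∈ (extChartAt 𝓘(ℝ, E) p).target) :
    fieldInChart (chartField p X) p y = X y := by
  let V (z : E) : E := mfderiv 𝓘(ℝ, E) 𝓘(ℝ, E) (extChartAt 𝓘(ℝ, E) p).symm z (X z)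
  have h : V (extChartAt 𝓘(ℝ, E) p ((extChartAt 𝓘(ℝ, E) p).symm y)) = V y :=
    congrArg V ((extChartAt 𝓘(ℝ, E) p).right_inv hy)
  exact (congrArg (mfderiv 𝓘(ℝ, E) 𝓘(ℝ, E) (extChartAt 𝓘(ℝ, E) p)
    ((extChartAt 𝓘(ℝ, E) p).symm y)) h).trans
      (DFunLike.congr_fun (mfderiv_extChartAt_comp_symm hy) (X y))

lemma contMDiffAt_chartField (hx : x ∈ (extChartAt 𝓘(ℝ, E) p).source)
    (hX : ContDiffAt ℝ ∞ X (extChartAt 𝓘(ℝ, E) p x)) :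
    ContMDiffAt 𝓘(ℝ, E) 𝓘(ℝ, E).tangent ∞
      (fun z ↦ (⟨z, chartField p X z⟩ : TangentBundle 𝓘(ℝ, E) M)) x := by
  have hcongr : ∀ (z z' : M) (_ : z = z') (w : E),
      (⟨z, w⟩ : TangentBundle 𝓘(ℝ, E) M) = ⟨z', w⟩ := by
    rintro z _ rfl w
    rfl
  refine ((contMDiffAt_mfderiv_extChartAt_symm ((extChartAt 𝓘(ℝ, E) p).map_source hx) hX).comp x
    (contMDiffAt_extChartAt_of_mem hx)).congr_of_eventuallyEq ?_
  filter_upwards [(isOpen_extChartAt_source p).mem_nhds hx] with z hz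
  exact hcongr _ _ ((extChartAt 𝓘(ℝ, E) p).left_inv hz).symm _

lemma leviCivita_chartField
    (g : ∀ x : M, TangentSpace 𝓘(ℝ, E) x →L[ℝ] TangentSpace 𝓘(ℝ, E) x →L[ℝ] ℝ) :
    leviCivita g (chartField p X) (chartField p Y) p =
      mfderiv 𝓘(ℝ, E) 𝓘(ℝ, E) (extChartAt 𝓘(ℝ, E) p).symm (extChartAt 𝓘(ℝ, E) p p)
        (fderiv ℝ Y (extChartAt 𝓘(ℝ, E) p p) (X (extChartAt 𝓘(ℝ, E) p p)) +
          christoffel g p (extChartAt 𝓘(ℝ, E) p p) (X (extChartAt 𝓘(ℝ, E) p p))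
            (Y (extChartAt 𝓘(ℝ, E) p p))) := by
  have htarget := mem_extChartAt_target (I := 𝓘(ℝ, E)) p
  have heq : fieldInChart (chartField p Y) p =ᶠ[𝓝 (extChartAt 𝓘(ℝ, E) p p)] Y := by
    filter_upwards [(isOpen_extChartAt_target p).mem_nhds htarget] with z hz
    exact fieldInChart_chartField hz
  rw [leviCivita, heq.fderiv_eq, fieldInChart_chartField htarget, fieldInChart_chartField htarget]

variable [IsManifold 𝓘(ℝ, F) ∞ N]

lemma fderiv_inCharts_extChartAt_eq_zero_iff (hf : ContMDiff 𝓘(ℝ, E) 𝓘(ℝ, F) ∞ f)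
    (hx : x ∈ (extChartAt 𝓘(ℝ, E) p).source)
    (hfx : f x ∈ (extChartAt 𝓘(ℝ, F) y₀).source) (v : E) :
    fderiv ℝ (inCharts (E := F) p y₀ f) (extChartAt 𝓘(ℝ, E) p x) v = 0 ↔
      mfderiv 𝓘(ℝ, E) 𝓘(ℝ, E) (extChartAt 𝓘(ℝ, E) p).symm (extChartAt 𝓘(ℝ, E) p x) v ∈
        kerDistribution E F f x := by
  obtain ⟨htarget, hfsymm⟩ := extChartAt_mem_target_inter_preimage hx hfx
  let D (z : M) : E →L[ℝ] F := mfderiv 𝓘(ℝ, E) 𝓘(ℝ, F) f z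
  let w : E := mfderiv 𝓘(ℝ, E) 𝓘(ℝ, E) (extChartAt 𝓘(ℝ, E) p).symm (extChartAt 𝓘(ℝ, E) p x) v
  rw [fderiv_inCharts_eq_zero_iff hf htarget hfsymm]
  change D ((extChartAt 𝓘(ℝ, E) p).symm (extChartAt 𝓘(ℝ, E) p x)) w = 0 ↔ D x w = 0
  rw [(extChartAt 𝓘(ℝ, E) p).left_inv hx]

variable [FiniteDimensional ℝ E]

lemma fderiv_add_christoffel_eq_zero
    {g : ∀ x : M, TangentSpace 𝓘(ℝ, E) x →L[ℝ] TangentSpace 𝓘(ℝ, E) x →L[ℝ] ℝ}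
    (hf : ContMDiff 𝓘(ℝ, E) 𝓘(ℝ, F) ∞ f)
    (hauto : IsAutoparallelOn g (kerDistribution E F f) (maxRankSet E F f))
    (hp : p ∈ maxRankSet E F f) (hfp : f p ∈ (extChartAt 𝓘(ℝ, F) y₀).source)
    (hX : ∀ᶠ z in 𝓝 (extChartAt 𝓘(ℝ, E) p p), ContDiffAt ℝ ∞ X z ∧
      fderiv ℝ (inCharts (E := F) p y₀ f) z (X z) = 0)
    (hY : ∀ᶠ z in 𝓝 (extChartAt 𝓘(ℝ, E) p p), ContDiffAt ℝ ∞ Y z ∧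
      fderiv ℝ (inCharts (E := F) p y₀ f) z (Y z) = 0) :
    fderiv ℝ (inCharts (E := F) p y₀ f) (extChartAt 𝓘(ℝ, E) p p)
      (fderiv ℝ Y (extChartAt 𝓘(ℝ, E) p p) (X (extChartAt 𝓘(ℝ, E) p p)) +
        christoffel g p (extChartAt 𝓘(ℝ, E) p p) (X (extChartAt 𝓘(ℝ, E) p p))
          (Y (extChartAt 𝓘(ℝ, E) p p))) = 0 := by
  have hps := mem_extChartAt_source (I := 𝓘(ℝ, E)) p
  have hnhds : ∀ᶠ x in 𝓝 p, x ∈ maxRankSet E F f ∧ x ∈ (extChartAt 𝓘(ℝ, E) p).source ∧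
      f x ∈ (extChartAt 𝓘(ℝ, F) y₀).source :=
    ((isOpen_maxRankSet hf).eventually_mem hp).and
      (((isOpen_extChartAt_source p).eventually_mem hps).and
        (hf.continuous.continuousAt.eventually ((isOpen_extChartAt_source y₀).eventually_mem hfp)))
  have hchart := continuousAt_extChartAt (I := 𝓘(ℝ, E)) p
  obtain ⟨V, hV, hVopen, hpV⟩ := mem_nhds_iff.1
    (hnhds.and ((hchart.eventually hX).and (hchart.eventually hY)))
  have hker : ∀ Z : E → E, ∀ x ∈ V,
      fderiv ℝ (inCharts (E := F) p y₀ f) (extChartAt 𝓘(ℝ, E) p x)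
        (Z (extChartAt 𝓘(ℝ, E) p x)) = 0 → chartField p Z x ∈ kerDistribution E F f x :=
    fun Z x hx ↦ (fderiv_inCharts_extChartAt_eq_zero_iff hf (hV hx).1.2.1 (hV hx).1.2.2 _).1
  have hmem := hauto V hVopen (fun x hx ↦ (hV hx).1.1) (chartField p X) (chartField p Y)
    (fun x hx ↦ (contMDiffAt_chartField (hV hx).1.2.1 (hV hx).2.1.1).contMDiffWithinAt)
    (fun x hx ↦ (contMDiffAt_chartField (hV hx).1.2.1 (hV hx).2.2.1).contMDiffWithinAt)
    (fun x hx ↦ hker X x hx (hV hx).2.1.2) (fun x hx ↦ hker Y x hx (hV hx).2.2.2) p hpV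
  rw [leviCivita_chartField] at hmem
  exact (fderiv_inCharts_extChartAt_eq_zero_iff hf hps hfp _).2 hmem

lemma exists_contDiffAt_fderiv_inCharts_eq_zero (hf : ContMDiff 𝓘(ℝ, E) 𝓘(ℝ, F) ∞ f)
    (hp : p ∈ maxRankSet E F f) (hfp : f p ∈ (extChartAt 𝓘(ℝ, F) y₀).source) :
    ∃ P : E → E →L[ℝ] E,
      (∀ᶠ z in 𝓝 (extChartAt 𝓘(ℝ, E) p p), ContDiffAt ℝ ∞ P z ∧
        ∀ v, fderiv ℝ (inCharts (E := F) p y₀ f) z (P z v) = 0) ∧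
      ∀ v, fderiv ℝ (inCharts (E := F) p y₀ f) (extChartAt 𝓘(ℝ, E) p p) v = 0 →
        P (extChartAt 𝓘(ℝ, E) p p) v = v := by
  have hpΩ := extChartAt_mem_target_inter_preimage (mem_extChartAt_source (I := 𝓘(ℝ, E)) p) hfp
  have hsmooth : ∀ z ∈ (extChartAt 𝓘(ℝ, E) p).target ∩
      (extChartAt 𝓘(ℝ, E) p).symm ⁻¹' (f ⁻¹' (extChartAt 𝓘(ℝ, F) y₀).source),
      ContDiffAt ℝ ∞ (fderiv ℝ (inCharts (E := F) p y₀ f)) z := fun z hz ↦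
    (contDiffAt_inCharts hz.1 hf.contMDiffAt hz.2).fderiv_right (m := ∞) (by simp)
  obtain ⟨P, R, hsplit⟩ := exists_kernel_splitting (hsmooth _ hpΩ).continuousAt
  refine ⟨P, ?_, fun v hv ↦ ?_⟩
  · filter_upwards [hsplit, (isOpen_extChartAt_target_inter_preimage hf.continuous p y₀).mem_nhds
      hpΩ] with z ⟨hsmoothP, _, hker⟩ hz
    refine ⟨(hsmoothP ∞ (hsmooth z hz)).1, hker ?_⟩
    rw [finrank_range_fderiv_inCharts hf hz.1 hz.2,
      finrank_range_fderiv_inCharts hf hpΩ.1 hpΩ.2, extChartAt_to_inv]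
    exact hp _
  · have h := hsplit.self_of_nhds.2.1 v
    rwa [hv, map_zero, add_zero] at h

lemma hessianAt_center_eq_zero
    {g : ∀ x : M, TangentSpace 𝓘(ℝ, E) x →L[ℝ] TangentSpace 𝓘(ℝ, E) x →L[ℝ] ℝ}
    (hf : ContMDiff 𝓘(ℝ, E) 𝓘(ℝ, F) ∞ f)
    (hauto : IsAutoparallelOn g (kerDistribution E F f) (maxRankSet E F f))
    (hp : p ∈ maxRankSet E F f) (hfp : f p ∈ (extChartAt 𝓘(ℝ, F) y₀).source) {u v : E}
    (hu : fderiv ℝ (inCharts (E := F) p y₀ f) (extChartAt 𝓘(ℝ, E) p p) u = 0)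
    (hv : fderiv ℝ (inCharts (E := F) p y₀ f) (extChartAt 𝓘(ℝ, E) p p) v = 0) :
    hessianAt (inCharts (E := F) p y₀ f) (christoffelBilin g p) (extChartAt 𝓘(ℝ, E) p p) u v
      = 0 := by
  obtain ⟨P, hP, hPfix⟩ := exists_contDiffAt_fderiv_inCharts_eq_zero hf hp hfp
  have hpΩ := extChartAt_mem_target_inter_preimage (mem_extChartAt_source (I := 𝓘(ℝ, E)) p) hfp
  have hfield (w : E) : ∀ᶠ z in 𝓝 (extChartAt 𝓘(ℝ, E) p p), ContDiffAt ℝ ∞ (fun z ↦ P z w) z ∧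
      fderiv ℝ (inCharts (E := F) p y₀ f) z (P z w) = 0 :=
    hP.mono fun z hz ↦ ⟨hz.1.clm_apply contDiffAt_const, hz.2 w⟩
  have hneg := hessianAt_eq_neg_of_eventually_fderiv_eq_zero (Γ := christoffelBilin g p)
    ((contDiffAt_inCharts hpΩ.1 hf.contMDiffAt hpΩ.2).of_le two_le_infty)
    ((hfield v).self_of_nhds.1.differentiableAt (by simp)) ((hfield v).mono fun z hz ↦ hz.2) u
  have hzero := fderiv_add_christoffel_eq_zero hf hauto hp hfp (hfield u) (hfield v)
  rw [hPfix u hu, hPfix v hv] at hzero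
  rwa [hPfix v hv, christoffelBilin_apply, hzero, neg_zero] at hneg

end Autoparallel

section AutoparallelInCharts

variable {E : Type*} [NormedAddCommGroup E] [NormedSpace ℝ E] [FiniteDimensional ℝ E]
  {M : Type u} [TopologicalSpace M] [ChartedSpace E M] [IsManifold 𝓘(ℝ, E) ∞ M]
  {F : Type*} [NormedAddCommGroup F] [NormedSpace ℝ F]
  {N : Type*} [TopologicalSpace N] [ChartedSpace F N] [IsManifold 𝓘(ℝ, F) ∞ N]
  {g : Bundle.ContMDiffRiemannianMetric 𝓘(ℝ, E) ∞ E (fun x : M ↦ TangentSpace 𝓘(ℝ, E) x)}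
  {f : M → N}

lemma hessianAt_inCharts_eq_zero {x₀ : M} {y₀ : N} {y : E}
    (hf : ContMDiff 𝓘(ℝ, E) 𝓘(ℝ, F) ∞ f)
    (hauto : IsAutoparallelOn g.inner (kerDistribution E F f) (maxRankSet E F f))
    (hy : y ∈ (extChartAt 𝓘(ℝ, E) x₀).target)
    (hfy : f ((extChartAt 𝓘(ℝ, E) x₀).symm y) ∈ (extChartAt 𝓘(ℝ, F) y₀).source)
    (hyU : (extChartAt 𝓘(ℝ, E) x₀).symm y ∈ maxRankSet E F f) {u v : E}
    (hu : fderiv ℝ (inCharts (E := F) x₀ y₀ f) y u = 0)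
    (hv : fderiv ℝ (inCharts (E := F) x₀ y₀ f) y v = 0) :
    hessianAt (inCharts (E := F) x₀ y₀ f) (christoffelBilin g.inner x₀) y u v = 0 := by
  set p := (extChartAt 𝓘(ℝ, E) x₀).symm y
  set i := inCharts (K := E) (E := E) x₀ p (id : M → M)
  have hps := mem_extChartAt_source (I := 𝓘(ℝ, E)) p
  have hi : ContDiffAt ℝ ∞ i y := contDiffAt_inCharts hy contMDiff_id.contMDiffAt hps
  have hfi : ContDiffAt ℝ ∞ (inCharts (E := F) p y₀ f) (i y) := by
    obtain ⟨htarget, hfsymm⟩ := extChartAt_mem_target_inter_preimage hps hfy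
    exact contDiffAt_inCharts htarget hf.contMDiffAt hfsymm
  have heq : inCharts (E := F) x₀ y₀ f =ᶠ[𝓝 y] inCharts (E := F) p y₀ f ∘ i := by
    filter_upwards [(contMDiffAt_extChartAt_symm hy).continuousAt
      ((isOpen_extChartAt_source p).mem_nhds hps)] with z hz
    exact (congrArg (fun x ↦ extChartAt 𝓘(ℝ, F) y₀ (f x))
      ((extChartAt 𝓘(ℝ, E) p).left_inv hz)).symm
  rw [heq.fderiv_eq, fderiv_comp y (hfi.differentiableAt (by simp))
    (hi.differentiableAt (by simp))] at hu hv
  rw [show hessianAt (inCharts (E := F) x₀ y₀ f) (christoffelBilin g.inner x₀) y =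
      hessianAt (inCharts (E := F) p y₀ f ∘ i) (christoffelBilin g.inner x₀) y by
    rw [hessianAt, hessianAt, heq.fderiv_eq, heq.fderiv.fderiv_eq],
    hessianAt_comp (Γ := christoffelBilin g.inner p) (hfi.of_le two_le_infty)
      (hi.of_le two_le_infty) (fderiv_inCharts_christoffel g hy hps u v)]
  exact hessianAt_center_eq_zero hf hauto hyU hfy hu hv

lemma isAutoparallelKernel_inCharts (hf : ContMDiff 𝓘(ℝ, E) 𝓘(ℝ, F) ∞ f)
    (hauto : IsAutoparallelOn g.inner (kerDistribution E F f) (maxRankSet E F f))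
    {p : M} (hp : p ∈ maxRankSet E F f) (x₀ : M) (y₀ : N) :
    IsAutoparallelKernel (inCharts (E := F) x₀ y₀ f) (christoffelBilin g.inner x₀)
      ((extChartAt 𝓘(ℝ, E) x₀).target ∩
        (extChartAt 𝓘(ℝ, E) x₀).symm ⁻¹' (f ⁻¹' (extChartAt 𝓘(ℝ, F) y₀).source))
      (rankAt E F f p) where
  isOpen := isOpen_extChartAt_target_inter_preimage hf.continuous x₀ y₀
  contDiffOn y hy := (contDiffAt_inCharts hy.1 hf.contMDiffAt hy.2).contDiffWithinAt
  contDiffOn_symbol y hy := (contDiffAt_christoffelBilin (isInvertible_formInChart g hy.1)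
    (contDiffAt_formInChart g hy.1)).contDiffWithinAt
  finrank_range_le y hy := (finrank_range_fderiv_inCharts hf hy.1 hy.2).trans_le (hp _)
  hessianAt_eq_zero y hy hrank u v hu hv := by
    rw [finrank_range_fderiv_inCharts hf hy.1 hy.2] at hrank
    exact hessianAt_inCharts_eq_zero hf hauto hy.1 hy.2 (fun z ↦ (hp z).trans_eq hrank.symm) hu hv

end AutoparallelInCharts

/-! ### Geodesics tangent to the kernel, on manifolds -/

section VanishingDifferential

variable {K : Type*} [NormedAddCommGroup K] [NormedSpace ℝ K]
  {L : Type*} [TopologicalSpace L] [ChartedSpace K L] [IsManifold 𝓘(ℝ, K) ∞ L]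
  {F : Type*} [NormedAddCommGroup F] [NormedSpace ℝ F]
  {N : Type*} [TopologicalSpace N] [ChartedSpace F N] [IsManifold 𝓘(ℝ, F) ∞ N]
  {f : L → N}

lemma isLocallyConstant_of_mfderiv_eq_zero (hf : ContMDiff 𝓘(ℝ, K) 𝓘(ℝ, F) ∞ f)
    (h0 : ∀ q, mfderiv 𝓘(ℝ, K) 𝓘(ℝ, F) f q = 0) : IsLocallyConstant f := by
  refine (IsLocallyConstant.iff_eventually_eq f).2 fun q ↦ ?_
  have hopen := (isOpen_extChartAt_target_inter_preimage (E := K) (F := F) hf.continuous q (f q)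
    ).isOpen_inter_preimage_of_fderiv_eq_zero (𝕜 := ℝ)
      (f := inCharts (E := F) q (f q) f)
      (fun y hy ↦ ((contDiffAt_inCharts hy.1 hf.contMDiffAt hy.2).differentiableAt
        (by simp)).differentiableWithinAt)
      (fun y hy ↦ by
        ext v
        rw [fderiv_inCharts hy.1 hf.contMDiffAt hy.2, h0]
        exact map_zero _)
      {extChartAt 𝓘(ℝ, F) (f q) (f q)}
  have hq := hopen.mem_nhds ⟨extChartAt_mem_target_inter_preimage (mem_extChartAt_source q)
    (mem_extChartAt_source (f q)),
    congrArg (fun x ↦ extChartAt 𝓘(ℝ, F) (f q) (f x)) (extChartAt_to_inv q)⟩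
  filter_upwards [(continuousAt_extChartAt q).eventually hq,
    extChartAt_source_mem_nhds (I := 𝓘(ℝ, K)) q] with x ⟨⟨_, hx⟩, hconst⟩ hxs
  rw [← (extChartAt 𝓘(ℝ, K) q).left_inv hxs]
  exact (extChartAt 𝓘(ℝ, F) (f q)).injOn hx (mem_extChartAt_source (f q)) hconst

lemma eq_of_mfderiv_eq_zero [PreconnectedSpace L] (hf : ContMDiff 𝓘(ℝ, K) 𝓘(ℝ, F) ∞ f)
    (h0 : ∀ q, mfderiv 𝓘(ℝ, K) 𝓘(ℝ, F) f q = 0) (p q : L) : f p = f q :=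
  (isLocallyConstant_of_mfderiv_eq_zero hf h0).apply_eq_of_preconnectedSpace p q

end VanishingDifferential

section Curves

variable {F : Type*} [NormedAddCommGroup F] [NormedSpace ℝ F]
  {N : Type*} [TopologicalSpace N] [ChartedSpace F N] {c : ℝ → N} {t : ℝ} {y₀ : N}

lemma mfderiv_curve_eq_zero_iff :
    mfderiv 𝓘(ℝ, ℝ) 𝓘(ℝ, F) c t = 0 ↔ mfderiv 𝓘(ℝ, ℝ) 𝓘(ℝ, F) c t (1 : ℝ) = 0 :=
  ⟨fun h ↦ by rw [h]; rfl, fun h ↦ ContinuousLinearMap.ext_ring (R₁ := ℝ) (M₁ := F) h⟩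

/-- The velocity of the curve `c` in the coordinates of the chart around `y₀`, as a point of the
tangent bundle `F × F` of the model space. -/
def velocityInChart (y₀ : N) (c : ℝ → N) (t : ℝ) : F × F :=
  (extChartAt 𝓘(ℝ, F) y₀ (c t), deriv (fun s ↦ extChartAt 𝓘(ℝ, F) y₀ (c s)) t)

variable [IsManifold 𝓘(ℝ, F) ∞ N]

lemma contDiffAt_extChartAt_comp (hc : ContMDiffAt 𝓘(ℝ, ℝ) 𝓘(ℝ, F) ∞ c t)
    (ht : c t ∈ (extChartAt 𝓘(ℝ, F) y₀).source) :
    ContDiffAt ℝ ∞ (fun s ↦ extChartAt 𝓘(ℝ, F) y₀ (c s)) t :=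
  contMDiffAt_iff_contDiffAt.1 ((contMDiffAt_extChartAt_of_mem ht).comp t hc)

lemma hasDerivAt_extChartAt_comp (hc : ContMDiffAt 𝓘(ℝ, ℝ) 𝓘(ℝ, F) ∞ c t)
    (ht : c t ∈ (extChartAt 𝓘(ℝ, F) y₀).source) :
    HasDerivAt (fun s ↦ extChartAt 𝓘(ℝ, F) y₀ (c s)) (velocityInChart y₀ c t).2 t :=
  ((contDiffAt_extChartAt_comp hc ht).differentiableAt (by simp)).hasDerivAt

lemma deriv_extChartAt_comp_eq_zero_iff (hc : ContMDiffAt 𝓘(ℝ, ℝ) 𝓘(ℝ, F) ∞ c t)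
    (ht : c t ∈ (extChartAt 𝓘(ℝ, F) y₀).source) :
    deriv (fun s ↦ extChartAt 𝓘(ℝ, F) y₀ (c s)) t = 0 ↔ mfderiv 𝓘(ℝ, ℝ) 𝓘(ℝ, F) c t = 0 := by
  have hcomp : mfderiv 𝓘(ℝ, ℝ) 𝓘(ℝ, F) (fun s ↦ extChartAt 𝓘(ℝ, F) y₀ (c s)) t = _ :=
    mfderiv_comp t ((contMDiffAt_extChartAt_of_mem ht).mdifferentiableAt (by simp))
      (hc.mdifferentiableAt (by simp))
  rw [← fderiv_apply_one_eq_deriv, ← mfderiv_eq_fderiv, hcomp, mfderiv_curve_eq_zero_iff]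
  exact map_eq_zero_iff _ (isInvertible_mfderiv_extChartAt_of_mem ht).injective

lemma mfderiv_comp_neg_eq_zero_iff (hc : ContMDiff 𝓘(ℝ, ℝ) 𝓘(ℝ, F) ∞ c) :
    mfderiv 𝓘(ℝ, ℝ) 𝓘(ℝ, F) (fun s ↦ c (-s)) (-t) = 0 ↔ mfderiv 𝓘(ℝ, ℝ) 𝓘(ℝ, F) c t = 0 := by
  have hneg : ContMDiff 𝓘(ℝ, ℝ) 𝓘(ℝ, F) ∞ fun s ↦ c (-s) :=
    hc.comp (contMDiff_iff_contDiff.2 contDiff_neg)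
  rw [← deriv_extChartAt_comp_eq_zero_iff (y₀ := c t) hneg.contMDiffAt
      (by rw [neg_neg]; exact mem_extChartAt_source _),
    ← deriv_extChartAt_comp_eq_zero_iff hc.contMDiffAt (mem_extChartAt_source (c t)),
    deriv_comp_neg (fun s ↦ extChartAt 𝓘(ℝ, F) (c t) (c s)), neg_neg, neg_eq_zero]

variable {E : Type*} [NormedAddCommGroup E] [NormedSpace ℝ E]
  {M : Type*} [TopologicalSpace M] [ChartedSpace E M] [IsManifold 𝓘(ℝ, E) ∞ M]
  {f : M → N} {γ : ℝ → M} {x₀ : M}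

lemma differentialMap_velocityInChart_eq_zero_iff (hf : ContMDiff 𝓘(ℝ, E) 𝓘(ℝ, F) ∞ f)
    (hγ : ContMDiff 𝓘(ℝ, ℝ) 𝓘(ℝ, E) ∞ γ) (ht : γ t ∈ (extChartAt 𝓘(ℝ, E) x₀).source)
    (hft : f (γ t) ∈ (extChartAt 𝓘(ℝ, F) y₀).source) :
    differentialMap (inCharts (E := F) x₀ y₀ f) (velocityInChart (F := E) x₀ γ t) = 0 ↔
      mfderiv 𝓘(ℝ, ℝ) 𝓘(ℝ, F) (f ∘ γ) t = 0 := by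
  have hmem := extChartAt_mem_target_inter_preimage ht hft
  have hcomp := ((contDiffAt_inCharts hmem.1 hf.contMDiffAt hmem.2).differentiableAt
    (by simp)).hasFDerivAt.comp_hasDerivAt t (hasDerivAt_extChartAt_comp hγ.contMDiffAt ht)
  have heq : (fun s ↦ extChartAt 𝓘(ℝ, F) y₀ ((f ∘ γ) s)) =ᶠ[𝓝 t]
      inCharts (E := F) x₀ y₀ f ∘ fun s ↦ extChartAt 𝓘(ℝ, E) x₀ (γ s) := by
    filter_upwards [hγ.continuous.continuousAt ((isOpen_extChartAt_source x₀).mem_nhds ht)]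
      with s hs
    exact congrArg (fun x ↦ extChartAt 𝓘(ℝ, F) y₀ (f x))
      ((extChartAt 𝓘(ℝ, E) x₀).left_inv hs).symm
  rw [← deriv_extChartAt_comp_eq_zero_iff (hf.comp hγ).contMDiffAt hft, heq.deriv_eq, hcomp.deriv]
  rfl

end Curves

section Geodesic

lemma Ici_subset_of_isOpen_of_eventually_left {A : Set ℝ} {a : ℝ} (hA : IsOpen A) (ha : a ∈ A)
    (hleft : ∀ b, (∀ᶠ s in 𝓝[<] b, s ∈ A) → b ∈ A) : Ici a ⊆ A := by
  by_contra hne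
  obtain ⟨t, ht, htA⟩ := not_subset.1 hne
  have hbdd : BddBelow (Ici a ∩ Aᶜ) := ⟨a, fun s hs ↦ hs.1⟩
  obtain ⟨hab, hbA⟩ := (isClosed_Ici.inter hA.isClosed_compl).csInf_mem ⟨t, ht, htA⟩ hbdd
  refine hbA (hleft _ ?_)
  filter_upwards [Ioo_mem_nhdsLT (lt_of_le_of_ne hab fun h ↦ hbA (h ▸ ha))] with s hs
  by_contra hsA
  exact (csInf_le hbdd ⟨hs.1.le, hsA⟩).not_gt hs.2

variable {E : Type*} [NormedAddCommGroup E] [NormedSpace ℝ E]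
  {M : Type u} [TopologicalSpace M] [ChartedSpace E M]

section

variable {g : ∀ x : M, TangentSpace 𝓘(ℝ, E) x →L[ℝ] TangentSpace 𝓘(ℝ, E) x →L[ℝ] ℝ} {γ : ℝ → M}

lemma isGeodesic_comp_neg (hγ : IsGeodesic g γ) : IsGeodesic g (fun t ↦ γ (-t)) := by
  refine ⟨hγ.contMDiff.comp (contMDiff_iff_contDiff.2 contDiff_neg), fun x₀ t ht ↦ ?_⟩
  have hderiv : deriv (fun s ↦ extChartAt 𝓘(ℝ, E) x₀ (γ (-s))) =
      fun s ↦ -deriv (fun s ↦ extChartAt 𝓘(ℝ, E) x₀ (γ s)) (-s) :=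
    funext fun s ↦ deriv_comp_neg (fun s ↦ extChartAt 𝓘(ℝ, E) x₀ (γ s)) s
  have heq := hγ.equation x₀ (-t) ht
  rw [hderiv, deriv.fun_neg, deriv_comp_neg, neg_neg]
  simp only [← christoffelBilin_apply, map_neg, neg_apply, neg_neg] at heq ⊢
  exact heq

lemma hasDerivAt_velocityInChart [IsManifold 𝓘(ℝ, E) ∞ M] (hγ : IsGeodesic g γ) {x₀ : M} {t : ℝ}
    (ht : γ t ∈ (extChartAt 𝓘(ℝ, E) x₀).source) :
    HasDerivAt (velocityInChart x₀ γ)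
      (geodesicField (christoffelBilin g x₀) (velocityInChart (F := E) x₀ γ t)) t := by
  have hc := contDiffAt_extChartAt_comp hγ.contMDiff.contMDiffAt ht
  have hdc : ContDiffAt ℝ ∞ (deriv fun s ↦ extChartAt 𝓘(ℝ, E) x₀ (γ s)) t :=
    (hc.fderiv_right (m := ∞) (by simp)).clm_apply contDiffAt_const
  exact ((hasDerivAt_extChartAt_comp hγ.contMDiff.contMDiffAt ht).prodMk
    (hdc.differentiableAt (by simp)).hasDerivAt).congr_deriv
      (Prod.ext rfl (eq_neg_of_add_eq_zero_left (hγ.equation x₀ t ht)))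

end

variable {F : Type*} [NormedAddCommGroup F] [NormedSpace ℝ F]
  {N : Type*} [TopologicalSpace N] [ChartedSpace F N]
  {f : M → N} {γ : ℝ → M}

/-- The set of times at which the curve `γ` passes through a point of maximal rank of `f` with a
velocity in the kernel of the differential of `f`. -/
def kernelTimes (E : Type*) [NormedAddCommGroup E] [NormedSpace ℝ E] [ChartedSpace E M]
    (F : Type*) [NormedAddCommGroup F] [NormedSpace ℝ F] [ChartedSpace F N]
    (f : M → N) (γ : ℝ → M) : Set ℝ :=
  {t | γ t ∈ maxRankSet E F f ∧ mfderiv 𝓘(ℝ, ℝ) 𝓘(ℝ, F) (f ∘ γ) t = 0}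

lemma rankAt_eq_of_mem_maxRankSet {x y : M} (hx : x ∈ maxRankSet E F f)
    (hy : y ∈ maxRankSet E F f) : rankAt E F f x = rankAt E F f y :=
  (hy x).antisymm (hx y)

lemma eventually_mem_extChartAt_source_and (hf : ContMDiff 𝓘(ℝ, E) 𝓘(ℝ, F) ∞ f)
    (hγ : Continuous γ) (b : ℝ) :
    ∀ᶠ t in 𝓝 b, γ t ∈ (extChartAt 𝓘(ℝ, E) (γ b)).source ∧
      f (γ t) ∈ (extChartAt 𝓘(ℝ, F) (f (γ b))).source :=
  (hγ.continuousAt.eventually (extChartAt_source_mem_nhds (γ b))).and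
    ((hf.continuous.comp hγ).continuousAt.eventually (extChartAt_source_mem_nhds (f (γ b))))

variable [IsManifold 𝓘(ℝ, F) ∞ N]

lemma neg_mem_kernelTimes_comp_neg_iff (hf : ContMDiff 𝓘(ℝ, E) 𝓘(ℝ, F) ∞ f)
    (hγ : ContMDiff 𝓘(ℝ, ℝ) 𝓘(ℝ, E) ∞ γ) {t : ℝ} :
    -t ∈ kernelTimes E F f (fun s ↦ γ (-s)) ↔ t ∈ kernelTimes E F f γ :=
  and_congr (by simp only [neg_neg]) (mfderiv_comp_neg_eq_zero_iff (hf.comp hγ))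

variable [IsManifold 𝓘(ℝ, E) ∞ M]

lemma finrank_range_fderiv_velocityInChart (hf : ContMDiff 𝓘(ℝ, E) 𝓘(ℝ, F) ∞ f) {x₀ : M} {y₀ : N}
    {t : ℝ} (ht : γ t ∈ (extChartAt 𝓘(ℝ, E) x₀).source)
    (hft : f (γ t) ∈ (extChartAt 𝓘(ℝ, F) y₀).source) :
    Module.finrank ℝ
      (fderiv ℝ (inCharts (E := F) x₀ y₀ f) (velocityInChart (F := E) x₀ γ t).1).range =
        rankAt E F f (γ t) := by
  obtain ⟨htarget, hfsymm⟩ := extChartAt_mem_target_inter_preimage ht hft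
  rw [velocityInChart, finrank_range_fderiv_inCharts hf htarget hfsymm,
    (extChartAt 𝓘(ℝ, E) x₀).left_inv ht]

variable [FiniteDimensional ℝ E]
  {g : Bundle.ContMDiffRiemannianMetric 𝓘(ℝ, E) ∞ E (fun x : M ↦ TangentSpace 𝓘(ℝ, E) x)}

lemma isOpen_kernelTimes (hf : ContMDiff 𝓘(ℝ, E) 𝓘(ℝ, F) ∞ f)
    (hauto : IsAutoparallelOn g.inner (kerDistribution E F f) (maxRankSet E F f))
    (hγ : IsGeodesic g.inner γ) : IsOpen (kernelTimes E F f γ) := by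
  refine isOpen_iff_mem_nhds.2 fun b ⟨hb, hb'⟩ ↦ ?_
  have hnear := eventually_mem_extChartAt_source_and hf hγ.contMDiff.continuous b
  have hγb := hnear.self_of_nhds
  have hzero := (isAutoparallelKernel_inCharts hf hauto hb (γ b)
    (f (γ b))).eventually_differentialMap_eq_zero
      (hnear.mono fun t ht ↦ hasDerivAt_velocityInChart hγ ht.1)
      (extChartAt_mem_target_inter_preimage hγb.1 hγb.2)
      (finrank_range_fderiv_velocityInChart hf hγb.1 hγb.2)
      ((differentialMap_velocityInChart_eq_zero_iff hf hγ.contMDiff hγb.1 hγb.2).2 hb')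
  filter_upwards [hnear, hzero, hγ.contMDiff.continuous.continuousAt
    ((isOpen_maxRankSet hf).mem_nhds hb)] with t ht ht0 htU
  exact ⟨htU, (differentialMap_velocityInChart_eq_zero_iff hf hγ.contMDiff ht.1 ht.2).1 ht0⟩

lemma mem_maxRankSet_of_eventually_left (hf : ContMDiff 𝓘(ℝ, E) 𝓘(ℝ, F) ∞ f)
    (hauto : IsAutoparallelOn g.inner (kerDistribution E F f) (maxRankSet E F f))
    (hγ : IsGeodesic g.inner γ) {b : ℝ} (hleft : ∀ᶠ t in 𝓝[<] b, t ∈ kernelTimes E F f γ) :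
    γ b ∈ maxRankSet E F f := by
  obtain ⟨s, hs, -⟩ := hleft.exists
  have hnear := eventually_mem_extChartAt_source_and hf hγ.contMDiff.continuous b
  have hγb := hnear.self_of_nhds
  have hrank := (isAutoparallelKernel_inCharts hf hauto hs (γ b)
    (f (γ b))).finrank_range_eq_of_eventually_left
      (hnear.mono fun t ht ↦ hasDerivAt_velocityInChart hγ ht.1)
      (extChartAt_mem_target_inter_preimage hγb.1 hγb.2) (by
        filter_upwards [hleft, hnear.filter_mono nhdsWithin_le_nhds] with t ht ht'
        exact ⟨(finrank_range_fderiv_velocityInChart hf ht'.1 ht'.2).trans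
            (rankAt_eq_of_mem_maxRankSet ht.1 hs),
          (differentialMap_velocityInChart_eq_zero_iff hf hγ.contMDiff ht'.1 ht'.2).2 ht.2⟩)
  rw [finrank_range_fderiv_velocityInChart hf hγb.1 hγb.2] at hrank
  exact fun x ↦ (hs x).trans_eq hrank.symm

lemma mem_kernelTimes_of_eventually_left (hf : ContMDiff 𝓘(ℝ, E) 𝓘(ℝ, F) ∞ f)
    (hauto : IsAutoparallelOn g.inner (kerDistribution E F f) (maxRankSet E F f))
    (hγ : IsGeodesic g.inner γ) {b : ℝ} (hleft : ∀ᶠ t in 𝓝[<] b, t ∈ kernelTimes E F f γ) :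
    b ∈ kernelTimes E F f γ := by
  have hnear := eventually_mem_extChartAt_source_and hf hγ.contMDiff.continuous b
  have hγb := hnear.self_of_nhds
  have hmem := extChartAt_mem_target_inter_preimage hγb.1 hγb.2
  refine ⟨mem_maxRankSet_of_eventually_left hf hauto hγ hleft,
    (differentialMap_velocityInChart_eq_zero_iff hf hγ.contMDiff hγb.1 hγb.2).1 ?_⟩
  have hcont : ContinuousAt (fun t ↦ differentialMap (inCharts (E := F) (γ b) (f (γ b)) f)
      (velocityInChart (γ b) γ t)) b :=
    (contDiffAt_differentialMap (z := velocityInChart (γ b) γ b)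
      (contDiffAt_inCharts hmem.1 hf.contMDiffAt hmem.2)).continuousAt.comp
        (f := velocityInChart (γ b) γ) (hasDerivAt_velocityInChart hγ hγb.1).continuousAt
  refine tendsto_nhds_unique (hcont.tendsto.mono_left (nhdsWithin_le_nhds (s := Iio b)))
    (tendsto_const_nhds.congr' ?_)
  filter_upwards [hleft, hnear.filter_mono nhdsWithin_le_nhds] with t ht ht'
  exact ((differentialMap_velocityInChart_eq_zero_iff hf hγ.contMDiff ht'.1 ht'.2).2 ht.2).symm

lemma Ici_subset_kernelTimes (hf : ContMDiff 𝓘(ℝ, E) 𝓘(ℝ, F) ∞ f)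
    (hauto : IsAutoparallelOn g.inner (kerDistribution E F f) (maxRankSet E F f))
    (hγ : IsGeodesic g.inner γ) {a : ℝ} (ha : a ∈ kernelTimes E F f γ) :
    Ici a ⊆ kernelTimes E F f γ :=
  Ici_subset_of_isOpen_of_eventually_left (isOpen_kernelTimes hf hauto hγ) ha fun _ ↦
    mem_kernelTimes_of_eventually_left hf hauto hγ

theorem kernelTimes_eq_univ (hf : ContMDiff 𝓘(ℝ, E) 𝓘(ℝ, F) ∞ f)
    (hauto : IsAutoparallelOn g.inner (kerDistribution E F f) (maxRankSet E F f))
    (hγ : IsGeodesic g.inner γ) {a : ℝ} (ha : a ∈ kernelTimes E F f γ) :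
    kernelTimes E F f γ = univ := by
  refine eq_univ_of_forall fun t ↦ ?_
  obtain hat | hta := le_total a t
  · exact Ici_subset_kernelTimes hf hauto hγ ha hat
  · exact (neg_mem_kernelTimes_comp_neg_iff hf hγ.contMDiff).1
      (Ici_subset_kernelTimes hf hauto (isGeodesic_comp_neg hγ)
        ((neg_mem_kernelTimes_comp_neg_iff hf hγ.contMDiff).2 ha) (neg_le_neg hta))

end Geodesic

/-! ### Slice charts -/

section Slice

variable {E : Type*} [NormedAddCommGroup E] [NormedSpace ℝ E]
  {M : Type*} [TopologicalSpace M] [ChartedSpace E M]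
  {K : Type*} [NormedAddCommGroup K] [NormedSpace ℝ K]

/-- A smooth parametrization `param` by a connected open set of the vector space `K` of an open
subset `C ∩ nhd` of `C`, together with a smooth left inverse `coord` on an open set of `M`. The
subset `C` of `M` is a submanifold if it is covered by slice charts. -/
structure SliceChart (E : Type*) [NormedAddCommGroup E] [NormedSpace ℝ E]
    {M : Type*} [TopologicalSpace M] [ChartedSpace E M]
    (K : Type*) [NormedAddCommGroup K] [NormedSpace ℝ K] (C : Set M) where
  /-- the open subset of `M` -/
  nhd : Set M
  /-- the domain of the parametrization -/
  dom : Set K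
  /-- the parametrization -/
  param : K → M
  /-- the left inverse of the parametrization -/
  coord : M → K
  isOpen_nhd : IsOpen nhd
  isOpen_dom : IsOpen dom
  isPreconnected_dom : IsPreconnected dom
  contMDiffOn_param : ContMDiffOn 𝓘(ℝ, K) 𝓘(ℝ, E) ∞ param dom
  contMDiffOn_coord : ContMDiffOn 𝓘(ℝ, E) 𝓘(ℝ, K) ∞ coord nhd
  mapsTo_param : MapsTo param dom (C ∩ nhd)
  mapsTo_coord : MapsTo coord (C ∩ nhd) dom
  coord_param : LeftInvOn coord param dom
  param_coord : LeftInvOn param coord (C ∩ nhd)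

namespace SliceChart

variable {C : Set M}

/-- The pullback to `M` of a slice chart in the coordinates of the chart around `x₀`. -/
def ofChart [IsManifold 𝓘(ℝ, E) ∞ M] (x₀ : M)
    (s : SliceChart E K ((extChartAt 𝓘(ℝ, E) x₀).target ∩ (extChartAt 𝓘(ℝ, E) x₀).symm ⁻¹' C)) :
    SliceChart E K C where
  nhd := (extChartAt 𝓘(ℝ, E) x₀).source ∩ extChartAt 𝓘(ℝ, E) x₀ ⁻¹' s.nhd
  dom := s.dom
  param := (extChartAt 𝓘(ℝ, E) x₀).symm ∘ s.param
  coord := s.coord ∘ extChartAt 𝓘(ℝ, E) x₀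
  isOpen_nhd := (continuousOn_extChartAt x₀).isOpen_inter_preimage (isOpen_extChartAt_source x₀)
    s.isOpen_nhd
  isOpen_dom := s.isOpen_dom
  isPreconnected_dom := s.isPreconnected_dom
  contMDiffOn_param := (contMDiffOn_extChartAt_symm x₀).comp s.contMDiffOn_param fun _ hz ↦
    (s.mapsTo_param hz).1.1
  contMDiffOn_coord := s.contMDiffOn_coord.comp
    (fun _ hy ↦ (contMDiffAt_extChartAt_of_mem hy.1).contMDiffWithinAt) fun _ hy ↦ hy.2
  mapsTo_param z hz := by
    obtain ⟨⟨htarget, hC⟩, hnhd⟩ := s.mapsTo_param hz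
    refine ⟨hC, (extChartAt 𝓘(ℝ, E) x₀).map_target htarget, ?_⟩
    rwa [mem_preimage, Function.comp_apply, (extChartAt 𝓘(ℝ, E) x₀).right_inv htarget]
  mapsTo_coord y hy := s.mapsTo_coord
    ⟨⟨(extChartAt 𝓘(ℝ, E) x₀).map_source hy.2.1, by
      rw [mem_preimage, (extChartAt 𝓘(ℝ, E) x₀).left_inv hy.2.1]; exact hy.1⟩, hy.2.2⟩
  coord_param z hz := by
    rw [Function.comp_apply, Function.comp_apply,
      (extChartAt 𝓘(ℝ, E) x₀).right_inv (s.mapsTo_param hz).1.1, s.coord_param hz]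
  param_coord y hy := by
    rw [Function.comp_apply, Function.comp_apply, s.param_coord
      ⟨⟨(extChartAt 𝓘(ℝ, E) x₀).map_source hy.2.1, by
        rw [mem_preimage, (extChartAt 𝓘(ℝ, E) x₀).left_inv hy.2.1]; exact hy.1⟩, hy.2.2⟩,
      (extChartAt 𝓘(ℝ, E) x₀).left_inv hy.2.1]

/-- The slice chart of a connected component of `C` that is given by a slice chart of `C` around a
point `x` of the component. -/
def restrictComponent (s : SliceChart E K C) {x₀ x : M}
    (hx : x ∈ connectedComponentIn C x₀) (hxs : x ∈ s.nhd) :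
    SliceChart E K (connectedComponentIn C x₀) where
  nhd := s.nhd
  dom := s.dom
  param := s.param
  coord := s.coord
  isOpen_nhd := s.isOpen_nhd
  isOpen_dom := s.isOpen_dom
  isPreconnected_dom := s.isPreconnected_dom
  contMDiffOn_param := s.contMDiffOn_param
  contMDiffOn_coord := s.contMDiffOn_coord
  mapsTo_param z hz := by
    have hxC : x ∈ C ∩ s.nhd := ⟨connectedComponentIn_subset _ _ hx, hxs⟩
    rw [connectedComponentIn_eq hx]
    exact ⟨(s.isPreconnected_dom.image _ s.contMDiffOn_param.continuousOn
      ).subset_connectedComponentIn ⟨s.coord x, s.mapsTo_coord hxC, s.param_coord hxC⟩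
        (image_subset_iff.2 fun _ hz ↦ (s.mapsTo_param hz).1) (mem_image_of_mem _ hz),
      (s.mapsTo_param hz).2⟩
  mapsTo_coord := s.mapsTo_coord.mono_left
    (inter_subset_inter_left _ (connectedComponentIn_subset _ _))
  coord_param := s.coord_param
  param_coord := s.param_coord.mono (inter_subset_inter_left _ (connectedComponentIn_subset _ _))

open Classical in
/-- The chart of the subspace `C` that is given by a slice chart. The point `x` serves as a junk
value outside of the target. -/
def toOpenPartialHomeomorph (s : SliceChart E K C) (x : C) : OpenPartialHomeomorph C K where
  toFun y := s.coord y
  invFun z := if h : s.param z ∈ C then ⟨s.param z, h⟩ else x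
  source := {y | (y : M) ∈ s.nhd}
  target := s.dom
  map_source' y hy := s.mapsTo_coord ⟨y.2, hy⟩
  map_target' z hz := by
    simp only [(s.mapsTo_param hz).1, dif_pos, mem_ofPred_eq]
    exact (s.mapsTo_param hz).2
  left_inv' y hy := by
    have h := s.param_coord ⟨y.2, hy⟩
    simp [h]
  right_inv' z hz := by
    simp only [(s.mapsTo_param hz).1, dif_pos]
    exact s.coord_param hz
  open_source := s.isOpen_nhd.preimage continuous_subtype_val
  open_target := s.isOpen_dom
  continuousOn_toFun := s.contMDiffOn_coord.continuousOn.comp continuous_subtype_val.continuousOn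
    fun _ h ↦ h
  continuousOn_invFun := by
    rw [Topology.IsInducing.subtypeVal.continuousOn_iff]
    refine s.contMDiffOn_param.continuousOn.congr fun z hz ↦ ?_
    simp [(s.mapsTo_param hz).1]

lemma coe_toOpenPartialHomeomorph_symm_apply (s : SliceChart E K C) (x : C) {z : K}
    (hz : z ∈ s.dom) : ((s.toOpenPartialHomeomorph x).symm z : M) = s.param z :=
  congrArg Subtype.val (dif_pos (s.mapsTo_param hz).1)

/-- The charted space structure on `C` given by a family of slice charts. -/
abbrev chartedSpace (s : C → SliceChart E K C) (hs : ∀ x : C, (x : M) ∈ (s x).nhd) :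
    ChartedSpace K C where
  atlas := range fun x ↦ (s x).toOpenPartialHomeomorph x
  chartAt x := (s x).toOpenPartialHomeomorph x
  mem_chart_source := hs
  chart_mem_atlas x := mem_range_self x

variable (s : C → SliceChart E K C) (hs : ∀ x : C, (x : M) ∈ (s x).nhd)

lemma isManifold : letI := chartedSpace s hs; IsManifold 𝓘(ℝ, K) ∞ C := by
  let := chartedSpace s hs
  apply isManifold_of_contDiffOn
  rintro _ _ ⟨x, rfl⟩ ⟨x', rfl⟩
  simp only [modelWithCornersSelf_coe, modelWithCornersSelf_coe_symm, Function.id_comp,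
    Function.comp_id, preimage_id, range_id, inter_univ]
  have htransition : ContMDiffOn 𝓘(ℝ, K) 𝓘(ℝ, K) ∞ ((s x').coord ∘ (s x).param)
      ((s x).dom ∩ (s x).param ⁻¹' (s x').nhd) :=
    (s x').contMDiffOn_coord.comp ((s x).contMDiffOn_param.mono inter_subset_left)
      fun z hz ↦ hz.2
  refine (contMDiffOn_iff_contDiffOn.1 htransition).congr_mono ?_ ?_
  · rintro z ⟨hz, -⟩
    exact congrArg (s x').coord (coe_toOpenPartialHomeomorph_symm_apply (s x) x hz)
  · rintro z ⟨hz, hz'⟩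
    refine ⟨hz, ?_⟩
    rw [mem_preimage, ← coe_toOpenPartialHomeomorph_symm_apply (s x) x hz]
    exact hz'

lemma contMDiff_coe : letI := chartedSpace s hs;
    ContMDiff 𝓘(ℝ, K) 𝓘(ℝ, E) ∞ (Subtype.val : C → M) := by
  let := chartedSpace s hs
  have := isManifold s hs
  intro x
  have hchart : ContMDiffAt 𝓘(ℝ, K) 𝓘(ℝ, K) ∞ (chartAt K x) x :=
    contMDiffOn_chart.contMDiffAt ((chartAt K x).open_source.mem_nhds (mem_chart_source K x))
  have hparam : ContMDiffAt 𝓘(ℝ, K) 𝓘(ℝ, E) ∞ (s x).param (chartAt K x x) :=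
    (s x).contMDiffOn_param.contMDiffAt
      ((s x).isOpen_dom.mem_nhds ((s x).mapsTo_coord ⟨x.2, hs x⟩))
  refine (hparam.comp x hchart).congr_of_eventuallyEq ?_
  filter_upwards [(chartAt K x).open_source.mem_nhds (mem_chart_source K x)] with y hy
  exact ((s x).param_coord ⟨y.2, hy⟩).symm

lemma injective_mfderiv_coe (x : C) : letI := chartedSpace s hs;
    Function.Injective (mfderiv 𝓘(ℝ, K) 𝓘(ℝ, E) (Subtype.val : C → M) x) := by
  let := chartedSpace s hs
  have := isManifold s hs
  have hcoord : MDifferentiableAt 𝓘(ℝ, E) 𝓘(ℝ, K) (s x).coord (x : M) :=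
    ((s x).contMDiffOn_coord.contMDiffAt ((s x).isOpen_nhd.mem_nhds (hs x))).mdifferentiableAt
      (by simp)
  have hcomp : mfderiv 𝓘(ℝ, K) 𝓘(ℝ, K) (extChartAt 𝓘(ℝ, K) x) x = _ :=
    mfderiv_comp (g := (s x).coord) (f := (Subtype.val : C → M)) x hcoord
      ((contMDiff_coe s hs).contMDiffAt.mdifferentiableAt (by simp))
  have hinj := (isInvertible_mfderiv_extChartAt_of_mem
    (mem_extChartAt_source (I := 𝓘(ℝ, K)) x)).injective
  rw [hcomp] at hinj
  exact Function.Injective.of_comp hinj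

end SliceChart

section LocalInverse

variable [FiniteDimensional ℝ K] {L : Type*} [TopologicalSpace L] [ChartedSpace K L]
  [IsManifold 𝓘(ℝ, K) ∞ L] {q : L}

lemma exists_contMDiffAt_local_inverse {α : L → K} (hα : ContMDiffAt 𝓘(ℝ, K) 𝓘(ℝ, K) ∞ α q)
    (hinj : Function.Injective (mfderiv 𝓘(ℝ, K) 𝓘(ℝ, K) α q)) :
    ∃ β : K → L, ContMDiffAt 𝓘(ℝ, K) 𝓘(ℝ, K) ∞ β (α q) ∧ β (α q) = q ∧
      ∀ᶠ z in 𝓝 (α q), α (β z) = z := by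
  set φ := extChartAt 𝓘(ℝ, K) q
  have hφq : φ q ∈ φ.target := mem_extChartAt_target q
  have hq : φ.symm (φ q) = q := extChartAt_to_inv q
  have hαq : (α ∘ φ.symm) (φ q) = α q := congrArg α hq
  rw [← hq] at hα hinj
  have hsmooth : ContDiffAt ℝ ∞ (α ∘ φ.symm) (φ q) :=
    contMDiffAt_iff_contDiffAt.1 (contMDiffAt_comp_extChartAt_symm hφq hα)
  have hDinj : Function.Injective (fderiv ℝ (α ∘ φ.symm) (φ q)) := by
    rw [← mfderiv_eq_fderiv, mfderiv_comp_extChartAt_symm hφq hα]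
    exact hinj.comp (isInvertible_mfderiv_extChartAt_symm hφq).injective
  let T : K ≃L[ℝ] K := (LinearEquiv.ofInjectiveEndo _ hDinj).toContinuousLinearEquiv
  have hT : HasFDerivAt (α ∘ φ.symm) (T : K →L[ℝ] K) (φ q) :=
    (hsmooth.differentiableAt (by simp)).hasFDerivAt
  have hinv : ContDiffAt ℝ ∞ (hsmooth.localInverse hT (by simp)) (α q) :=
    hαq ▸ hsmooth.to_localInverse hT (by simp)
  have hinvq : hsmooth.localInverse hT (by simp) (α q) = φ q :=
    hαq ▸ hsmooth.localInverse_apply_image hT (by simp)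
  refine ⟨φ.symm ∘ hsmooth.localInverse hT (by simp), ?_, ?_, ?_⟩
  · exact ContMDiffAt.comp _ (contMDiffAt_extChartAt_symm (hinvq.symm ▸ hφq))
      (contMDiffAt_iff_contDiffAt.2 hinv)
  · rw [Function.comp_apply, hinvq, hq]
  · exact hαq ▸ (hsmooth.hasStrictFDerivAt' hT (by simp)).eventually_right_inverse

variable {C : Set M} {j : L → M}

/-- An immersion into `C` is locally inverted by a smooth map on an open subset of `M`: composed
with the coordinates of a slice chart, it is a local diffeomorphism. -/
lemma SliceChart.exists_local_inverse (s : SliceChart E K C)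
    (hj : ContMDiff 𝓘(ℝ, K) 𝓘(ℝ, E) ∞ j) (hjC : ∀ p, j p ∈ C) (hq : j q ∈ s.nhd)
    (hinj : Function.Injective (mfderiv 𝓘(ℝ, K) 𝓘(ℝ, E) j q)) :
    ∃ τ : M → L, ContMDiffAt 𝓘(ℝ, E) 𝓘(ℝ, K) ∞ τ (j q) ∧
      ∀ᶠ y in 𝓝 (j q), y ∈ C → j (τ y) = y := by
  have hnhd : s.nhd ∈ 𝓝 (j q) := s.isOpen_nhd.mem_nhds hq
  have hcoord : ContMDiffAt 𝓘(ℝ, E) 𝓘(ℝ, K) ∞ s.coord (j q) := s.contMDiffOn_coord.contMDiffAt hnhd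
  have hα : ContMDiffAt 𝓘(ℝ, K) 𝓘(ℝ, K) ∞ (s.coord ∘ j) q := hcoord.comp q hj.contMDiffAt
  have hparam : ContMDiffAt 𝓘(ℝ, K) 𝓘(ℝ, E) ∞ s.param ((s.coord ∘ j) q) :=
    s.contMDiffOn_param.contMDiffAt (s.isOpen_dom.mem_nhds (s.mapsTo_coord ⟨hjC q, hq⟩))
  have hαinj : Function.Injective (mfderiv 𝓘(ℝ, K) 𝓘(ℝ, K) (s.coord ∘ j) q) := by
    have heq : s.param ∘ s.coord ∘ j =ᶠ[𝓝 q] j := by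
      filter_upwards [hj.continuous.continuousAt hnhd] with p hp
      exact s.param_coord ⟨hjC p, hp⟩
    have hcomp := mfderiv_comp q (hparam.mdifferentiableAt (by simp))
      (hα.mdifferentiableAt (by simp))
    rw [← heq.mfderiv_eq, hcomp] at hinj
    exact Function.Injective.of_comp hinj
  obtain ⟨β, hβ, hβq, hright⟩ := exists_contMDiffAt_local_inverse hα hαinj
  have hτ : ContMDiffAt 𝓘(ℝ, E) 𝓘(ℝ, K) ∞ (β ∘ s.coord) (j q) := hβ.comp (j q) hcoord
  have hjτ : ContinuousAt (j ∘ β ∘ s.coord) (j q) :=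
    hj.continuous.continuousAt.comp hτ.continuousAt
  have hjτq : (j ∘ β ∘ s.coord) (j q) = j q := congrArg j hβq
  refine ⟨β ∘ s.coord, hτ, ?_⟩
  filter_upwards [hnhd, hcoord.continuousAt.eventually hright,
    hjτ (by rw [hjτq]; exact hnhd)] with y hy hyright hyτ hyC
  exact s.param_coord.injOn ⟨hjC _, hyτ⟩ ⟨hyC, hy⟩ hyright

end LocalInverse

end Slice

/-! ### Fibers of maps of maximal rank -/

section FiberSlice

variable {E F K : Type*} [NormedAddCommGroup E] [NormedSpace ℝ E] [NormedAddCommGroup F]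
  [NormedSpace ℝ F] [NormedAddCommGroup K] [NormedSpace ℝ K]

/-- The coordinate change that straightens the fibers of `h` near `y₀`: if `R` is a generalized
inverse of the differential of `h` at `y₀`, then it maps the fiber of `h` through `y₀` into the
kernel of this differential. -/
def straightening (h : E → F) (y₀ : E) (R : F →L[ℝ] E) (y : E) : E :=
  (y - y₀) + R (h y - h y₀ - fderiv ℝ h y₀ (y - y₀))

variable {h : E → F} {y₀ y : E} {R : F →L[ℝ] E}

lemma straightening_self : straightening h y₀ R y₀ = 0 := by simp [straightening]

lemma fderiv_straightening_eq_zero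
    (hR : fderiv ℝ h y₀ ∘L R ∘L fderiv ℝ h y₀ = fderiv ℝ h y₀) (hy : h y = h y₀) :
    fderiv ℝ h y₀ (straightening h y₀ R y) = 0 := by
  have hR : fderiv ℝ h y₀ (R (fderiv ℝ h y₀ (y - y₀))) = _ := DFunLike.congr_fun hR (y - y₀)
  simp only [straightening, hy, sub_self, zero_sub, map_add, map_neg, hR, add_neg_cancel]

lemma contDiffAt_straightening {n : WithTop ℕ∞} (hh : ContDiffAt ℝ n h y) :
    ContDiffAt ℝ n (straightening h y₀ R) y :=
  (contDiffAt_id.sub contDiffAt_const).add (R.contDiff.contDiffAt.comp y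
    ((hh.sub contDiffAt_const).sub
      ((fderiv ℝ h y₀).contDiff.contDiffAt.comp y (contDiffAt_id.sub contDiffAt_const))))

lemma hasFDerivAt_straightening (hh : DifferentiableAt ℝ h y) :
    HasFDerivAt (straightening h y₀ R) (kernelTransport (fderiv ℝ h y₀) R (fderiv ℝ h y)) y := by
  have hid : HasFDerivAt (fun z ↦ z - y₀) (ContinuousLinearMap.id ℝ E) y :=
    (hasFDerivAt_id y).sub_const _
  exact hid.add (R.hasFDerivAt.comp y
    ((hh.hasFDerivAt.sub_const _).sub ((fderiv ℝ h y₀).hasFDerivAt.comp y hid)))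

variable [FiniteDimensional ℝ E]

/-- The target is shrunk to a ball because its intersection with the kernel is then connected. -/
lemma exists_straightening_openPartialHomeomorph {Ω : Set E} (hΩ : IsOpen Ω)
    (hh : ContDiffOn ℝ ∞ h Ω) (hy₀ : y₀ ∈ Ω) (R : F →L[ℝ] E) :
    ∃ e : OpenPartialHomeomorph E E, ∃ ε > 0, ⇑e = straightening h y₀ R ∧ y₀ ∈ e.source ∧
      e.source ⊆ Ω ∧ e.target = Metric.ball 0 ε ∧
      ∀ y ∈ e.source, (kernelTransport (fderiv ℝ h y₀) R (fderiv ℝ h y)).IsInvertible := by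
  have hhy₀ := hh.contDiffAt (hΩ.mem_nhds hy₀)
  have hderiv : HasFDerivAt (straightening h y₀ R)
      ((ContinuousLinearEquiv.refl ℝ E : E ≃L[ℝ] E) : E →L[ℝ] E) y₀ := by
    have hderiv := hasFDerivAt_straightening (y₀ := y₀) (R := R) (hhy₀.differentiableAt (by simp))
    rwa [kernelTransport_self] at hderiv
  set e := (contDiffAt_straightening hhy₀).toOpenPartialHomeomorph _ hderiv (by simp)
  have hsource : y₀ ∈ e.source := ContDiffAt.mem_toOpenPartialHomeomorph_source ..
  have he₀ : e y₀ = 0 := straightening_self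
  have hinv : ∀ᶠ y in 𝓝 y₀, y ∈ Ω ∧
      (kernelTransport (fderiv ℝ h y₀) R (fderiv ℝ h y)).IsInvertible := by
    have hcont : ContinuousAt (fun y ↦ kernelTransport (fderiv ℝ h y₀) R (fderiv ℝ h y)) y₀ :=
      continuousAt_const.add (continuousAt_const.clm_comp
        ((hhy₀.fderiv_right (m := ∞) (by simp)).continuousAt.sub continuousAt_const))
    have hnhds : {T : E →L[ℝ] E | T.IsInvertible} ∈
        𝓝 (kernelTransport (fderiv ℝ h y₀) R (fderiv ℝ h y₀)) := by
      rw [kernelTransport_self]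
      exact ContinuousLinearEquiv.nhds (ContinuousLinearEquiv.refl ℝ E)
    exact (hΩ.eventually_mem hy₀).and (hcont hnhds)
  have htarget : (0 : E) ∈ e.target := he₀ ▸ e.map_source hsource
  have hsymm : Tendsto e.symm (𝓝 0) (𝓝 y₀) := by
    have hcont := e.continuousAt_symm htarget
    rwa [ContinuousAt, ← he₀, e.left_inv hsource, he₀] at hcont
  obtain ⟨ε, hε, hball⟩ := Metric.eventually_nhds_iff_ball.1
    ((e.open_target.eventually_mem htarget).and (hsymm.eventually hinv))
  have hgood : ∀ y ∈ e.source ∩ e ⁻¹' Metric.ball 0 ε, y ∈ Ω ∧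
      (kernelTransport (fderiv ℝ h y₀) R (fderiv ℝ h y)).IsInvertible := fun y hy ↦ by
    have hy' := (hball _ hy.2).2
    rwa [e.left_inv hy.1] at hy'
  refine ⟨(e.symm.restrOpen _ Metric.isOpen_ball).symm, ε, hε, rfl, ⟨hsource, ?_⟩,
    fun y hy ↦ (hgood y hy).1, inter_eq_right.2 fun y hy ↦ (hball y hy).1,
    fun y hy ↦ (hgood y hy).2⟩
  simpa [he₀] using hε

lemma exists_kernel_coordinates [FiniteDimensional ℝ K] {A : E →L[ℝ] F}
    (hK : Module.finrank ℝ K = Module.finrank ℝ A.ker) :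
    ∃ (ι : K →L[ℝ] E) (κ : E →L[ℝ] K), ι.range = A.ker ∧ κ ∘L ι = ContinuousLinearMap.id ℝ K := by
  let e : K ≃L[ℝ] A.ker := ContinuousLinearEquiv.ofFinrankEq hK
  obtain ⟨κ, hκ⟩ := (A.ker.subtype ∘ₗ e.toLinearMap).exists_leftInverse_of_injective
    (LinearMap.ker_eq_bot.2 (Subtype.val_injective.comp e.injective))
  refine ⟨A.ker.subtypeL ∘L e, LinearMap.toContinuousLinearMap κ, ?_,
    ContinuousLinearMap.ext (LinearMap.congr_fun hκ)⟩
  refine le_antisymm ?_ fun w hw ↦ ⟨e.symm ⟨w, hw⟩, by simp⟩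
  rintro _ ⟨z, rfl⟩
  exact (e z).2

/-- Since the rank of the differential of `h` is maximal at `y₀`, the straightened kernel is tangent
to the kernels of the differentials of `h`. -/
lemma apply_symm_eq_of_coe_eq_straightening {e : OpenPartialHomeomorph E E} {ε : ℝ}
    (hh : ∀ y ∈ e.source, ContDiffAt ℝ 1 h y)
    (hR : fderiv ℝ h y₀ ∘L R ∘L fderiv ℝ h y₀ = fderiv ℝ h y₀)
    (he : ⇑e = straightening h y₀ R) (hy₀ : y₀ ∈ e.source) (htarget : e.target = Metric.ball 0 ε)
    (hinv : ∀ y ∈ e.source, (kernelTransport (fderiv ℝ h y₀) R (fderiv ℝ h y)).IsInvertible)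
    (hrank : ∀ y ∈ e.source, Module.finrank ℝ (fderiv ℝ h y).range ≤
      Module.finrank ℝ (fderiv ℝ h y₀).range) {ι : K →L[ℝ] E} (hι : ι.range ≤ (fderiv ℝ h y₀).ker)
    {z : K} (hz : ι z ∈ e.target) : h (e.symm (ι z)) = h y₀ := by
  have hderiv : ∀ w ∈ ι ⁻¹' e.target,
      HasFDerivAt (h ∘ e.symm ∘ ι) (0 : K →L[ℝ] F) w := fun w hw ↦ by
    have hsource := e.map_target hw
    obtain ⟨T, hT⟩ := hinv _ hsource
    have hhw := (hh _ hsource).differentiableAt one_ne_zero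
    have hsymm : HasFDerivAt e.symm (T.symm : E →L[ℝ] E) (ι w) :=
      e.hasFDerivAt_symm hw (by rw [he, hT]; exact hasFDerivAt_straightening hhw)
    refine (hhw.hasFDerivAt.comp w (hsymm.comp w ι.hasFDerivAt)).congr_fderiv ?_
    ext a
    have hmem : ι a ∈ (fderiv ℝ h (e.symm (ι w))).ker.map
        (kernelTransport (fderiv ℝ h y₀) R (fderiv ℝ h (e.symm (ι w)))).toLinearMap := by
      rw [map_kernelTransport_ker hR (hinv _ hsource).injective (hrank _ hsource)]
      exact hι ⟨a, rfl⟩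
    obtain ⟨v, hv, hva⟩ := hmem
    rw [← hT] at hva
    have hva : T v = ι a := hva
    have hv : fderiv ℝ h (e.symm (ι w)) v = 0 := hv
    simpa [← hva] using hv
  have hconvex : Convex ℝ (ι ⁻¹' e.target) := by
    rw [htarget]
    exact (convex_ball 0 ε).linear_preimage ι.toLinearMap
  have h0 : ι 0 = e y₀ := by rw [he, straightening_self, map_zero]
  have hconst := (e.open_target.preimage ι.continuous).is_const_of_fderiv_eq_zero
    hconvex.isPreconnected (fun w hw ↦ (hderiv w hw).differentiableAt.differentiableWithinAt)
    (fun w hw ↦ (hderiv w hw).fderiv) hz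
    (show (0 : K) ∈ ι ⁻¹' e.target from (h0 ▸ e.map_source hy₀ : ι 0 ∈ e.target))
  rwa [Function.comp_apply, Function.comp_apply, Function.comp_apply, Function.comp_apply, h0,
    e.left_inv hy₀] at hconst

/-- The slice chart of `C` that is given by a diffeomorphism `e` of open sets which maps `C` into
the image of the linear map `ι`. -/
def SliceChart.ofOpenPartialHomeomorph (e : OpenPartialHomeomorph E E) (ι : K →L[ℝ] E)
    (κ : E →L[ℝ] K) {C : Set E} (hconvex : Convex ℝ e.target)
    (he : ContDiffOn ℝ ∞ e e.source) (hsymm : ContDiffOn ℝ ∞ e.symm e.target)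
    (hκι : ∀ z, κ (ι z) = z) (hιC : ∀ z, ι z ∈ e.target → e.symm (ι z) ∈ C)
    (hCι : ∀ y ∈ C ∩ e.source, ι (κ (e y)) = e y) : SliceChart E K C where
  nhd := e.source
  dom := ι ⁻¹' e.target
  param := e.symm ∘ ι
  coord := κ ∘ e
  isOpen_nhd := e.open_source
  isOpen_dom := e.open_target.preimage ι.continuous
  isPreconnected_dom := (hconvex.linear_preimage ι.toLinearMap).isPreconnected
  contMDiffOn_param := contMDiffOn_iff_contDiffOn.2
    (hsymm.comp ι.contDiff.contDiffOn fun _ hz ↦ hz)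
  contMDiffOn_coord := contMDiffOn_iff_contDiffOn.2 (κ.contDiff.comp_contDiffOn he)
  mapsTo_param z hz := ⟨hιC z hz, e.map_target hz⟩
  mapsTo_coord y hy := by
    rw [mem_preimage, Function.comp_apply, hCι y hy]
    exact e.map_source hy.2
  coord_param z hz := by
    simp only [Function.comp_apply, e.right_inv hz, hκι]
  param_coord y hy := by
    simp only [Function.comp_apply, hCι y hy, e.left_inv hy.2]

lemma exists_sliceChart_fiber [FiniteDimensional ℝ K] {Ω : Set E} (hΩ : IsOpen Ω)
    (hh : ContDiffOn ℝ ∞ h Ω) (hy₀ : y₀ ∈ Ω)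
    (hrank : ∀ y ∈ Ω, Module.finrank ℝ (fderiv ℝ h y).range ≤
      Module.finrank ℝ (fderiv ℝ h y₀).range)
    (hK : Module.finrank ℝ K = Module.finrank ℝ (fderiv ℝ h y₀).ker) :
    ∃ s : SliceChart E K (Ω ∩ h ⁻¹' {h y₀}), y₀ ∈ s.nhd := by
  obtain ⟨R, hR⟩ := exists_comp_comp_eq_self (fderiv ℝ h y₀)
  obtain ⟨e, ε, -, he, hsource, hsubset, htarget, hinv⟩ :=
    exists_straightening_openPartialHomeomorph hΩ hh hy₀ R
  obtain ⟨ι, κ, hι, hκ⟩ := exists_kernel_coordinates hK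
  have hκι : ∀ z, κ (ι z) = z := DFunLike.congr_fun hκ
  have hhe : ∀ y ∈ e.source, ContDiffAt ℝ ∞ h y := fun y hy ↦
    hh.contDiffAt (hΩ.mem_nhds (hsubset hy))
  have hsmooth : ∀ y ∈ e.source, ContDiffAt ℝ ∞ e y := fun y hy ↦
    he ▸ contDiffAt_straightening (hhe y hy)
  have hsymm : ∀ y ∈ e.target, ContDiffAt ℝ ∞ e.symm y := fun y hy ↦ by
    have hy' := e.map_target hy
    obtain ⟨T, hT⟩ := hinv _ hy'
    refine e.contDiffAt_symm hy (f₀' := T) ?_ (hsmooth _ hy')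
    rw [he, hT]
    exact hasFDerivAt_straightening ((hhe _ hy').differentiableAt (by simp))
  refine ⟨.ofOpenPartialHomeomorph e ι κ (htarget ▸ convex_ball 0 ε)
    (fun y hy ↦ (hsmooth y hy).contDiffWithinAt) (fun y hy ↦ (hsymm y hy).contDiffWithinAt) hκι
    (fun z hz ↦ ⟨hsubset (e.map_target hz), ?_⟩) fun y hy ↦ ?_, hsource⟩
  · exact apply_symm_eq_of_coe_eq_straightening (fun y hy ↦ (hhe y hy).of_le (by simp)) hR he
      hsource htarget hinv (fun y hy ↦ hrank y (hsubset hy)) hι.le hz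
  · obtain ⟨z, hz⟩ : e y ∈ ι.range := hι ▸ he ▸ fderiv_straightening_eq_zero hR hy.1.2
    have hz : ι z = e y := hz
    rw [← hz, hκι]

end FiberSlice

/-! ### Maximal integral manifolds -/

section Leaf

lemma range_eq_ker_iff_finrank_add_finrank_range_eq {V V' W : Type*} [AddCommGroup V] [Module ℝ V]
    [AddCommGroup V'] [Module ℝ V'] [FiniteDimensional ℝ V'] [AddCommGroup W] [Module ℝ W]
    {A : V →ₗ[ℝ] V'} {B : V' →ₗ[ℝ] W} (hA : Function.Injective A) (hBA : ∀ v, B (A v) = 0) :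
    A.range = B.ker ↔
      Module.finrank ℝ V + Module.finrank ℝ B.range = Module.finrank ℝ V' := by
  have hrangeA := LinearMap.finrank_range_of_inj hA
  have hB := B.finrank_range_add_finrank_ker
  refine ⟨fun h ↦ by rw [← hrangeA, h]; omega, fun h ↦ ?_⟩
  refine Submodule.eq_of_le_of_finrank_eq ?_ (by omega)
  rintro _ ⟨v, rfl⟩
  exact hBA v

variable {E : Type*} [NormedAddCommGroup E] [NormedSpace ℝ E]
  {M : Type u} [TopologicalSpace M] [ChartedSpace E M]
  {F : Type*} [NormedAddCommGroup F] [NormedSpace ℝ F]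
  {N : Type*} [TopologicalSpace N] [ChartedSpace F N]
  {K : Type*} [NormedAddCommGroup K] [NormedSpace ℝ K]
  {L : Type u} [TopologicalSpace L] [ChartedSpace K L] {j : L → M} {f : M → N}

lemma mfderiv_apply_mfderiv_of_isIntegralManifold
    (hj : IsIntegralManifold K (kerDistribution E F f) (maxRankSet E F f) j) (q : L)
    (v : TangentSpace 𝓘(ℝ, K) q) :
    mfderiv 𝓘(ℝ, E) 𝓘(ℝ, F) f (j q) (mfderiv 𝓘(ℝ, K) 𝓘(ℝ, E) j q v) = 0 :=
  (hj.range_mfderiv q).le ⟨v, rfl⟩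

lemma apply_eq_of_isIntegralManifold [IsManifold 𝓘(ℝ, F) ∞ N] [IsManifold 𝓘(ℝ, K) ∞ L]
    (hf : ContMDiff 𝓘(ℝ, E) 𝓘(ℝ, F) ∞ f)
    (hj : IsIntegralManifold K (kerDistribution E F f) (maxRankSet E F f) j) (p q : L) :
    f (j p) = f (j q) := by
  have := hj.connected
  refine eq_of_mfderiv_eq_zero (f := f ∘ j) (hf.comp hj.contMDiff) (fun q ↦ ?_) p q
  rw [mfderiv_comp q (hf.contMDiffAt.mdifferentiableAt (by simp))
    (hj.contMDiff.contMDiffAt.mdifferentiableAt (by simp))]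
  exact ContinuousLinearMap.ext fun v ↦ mfderiv_apply_mfderiv_of_isIntegralManifold hj q v

variable [FiniteDimensional ℝ E]

lemma finrank_add_rankAt_of_isIntegralManifold
    (hj : IsIntegralManifold K (kerDistribution E F f) (maxRankSet E F f) j) (q : L) :
    Module.finrank ℝ K + rankAt E F f (j q) = Module.finrank ℝ E := by
  let A : K →L[ℝ] E := mfderiv 𝓘(ℝ, K) 𝓘(ℝ, E) j q
  let B : E →L[ℝ] F := mfderiv 𝓘(ℝ, E) 𝓘(ℝ, F) f (j q)
  exact (range_eq_ker_iff_finrank_add_finrank_range_eq (A := A.toLinearMap) (B := B.toLinearMap)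
    (hj.injective_mfderiv q) (mfderiv_apply_mfderiv_of_isIntegralManifold hj q)).1
    (hj.range_mfderiv q)

lemma isIntegralManifold_coe (hf : ContMDiff 𝓘(ℝ, E) 𝓘(ℝ, F) ∞ f) {x₀ : M}
    (hx₀ : x₀ ∈ maxRankSet E F f)
    (hK : Module.finrank ℝ K + rankAt E F f x₀ = Module.finrank ℝ E)
    {C : Set M} (hconn : IsConnected C) (hC : C ⊆ maxRankSet E F f ∩ f ⁻¹' {f x₀})
    (s : C → SliceChart E K C) (hs : ∀ x : C, (x : M) ∈ (s x).nhd) :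
    letI := SliceChart.chartedSpace s hs
    IsIntegralManifold K (kerDistribution E F f) (maxRankSet E F f) (Subtype.val : C → M) := by
  let := SliceChart.chartedSpace s hs
  have hsmooth := SliceChart.contMDiff_coe s hs
  have hinj := SliceChart.injective_mfderiv_coe s hs
  refine ⟨isConnected_iff_connectedSpace.1 hconn, hsmooth, Subtype.val_injective, hinj,
    fun q ↦ (hC q.2).1, fun q ↦ ?_⟩
  have hcomp : mfderiv 𝓘(ℝ, K) 𝓘(ℝ, F) (f ∘ (Subtype.val : C → M)) q = _ :=
    mfderiv_comp q (hf.contMDiffAt.mdifferentiableAt (by simp))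
      (hsmooth.contMDiffAt.mdifferentiableAt (by simp))
  have hconst : f ∘ (Subtype.val : C → M) = fun _ ↦ f x₀ := funext fun q ↦ (hC q.2).2
  rw [hconst, mfderiv_const] at hcomp
  rw [rankAt_eq_of_mem_maxRankSet hx₀ (hC q.2).1] at hK
  let A : K →L[ℝ] E := mfderiv 𝓘(ℝ, K) 𝓘(ℝ, E) (Subtype.val : C → M) q
  let B : E →L[ℝ] F := mfderiv 𝓘(ℝ, E) 𝓘(ℝ, F) f q
  exact (range_eq_ker_iff_finrank_add_finrank_range_eq (A := A.toLinearMap) (B := B.toLinearMap)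
    (hinj q) fun v ↦ (DFunLike.congr_fun hcomp v).symm).2 hK

variable [IsManifold 𝓘(ℝ, E) ∞ M] [IsManifold 𝓘(ℝ, F) ∞ N]

lemma isOpen_extChartAt_symm_preimage_maxRankSet (hf : ContMDiff 𝓘(ℝ, E) 𝓘(ℝ, F) ∞ f)
    (x : M) (y : N) :
    IsOpen ((extChartAt 𝓘(ℝ, E) x).target ∩ (extChartAt 𝓘(ℝ, E) x).symm ⁻¹'
      (maxRankSet E F f ∩ f ⁻¹' (extChartAt 𝓘(ℝ, F) y).source)) :=
  (continuousOn_extChartAt_symm x).isOpen_inter_preimage (isOpen_extChartAt_target x)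
    ((isOpen_maxRankSet hf).inter ((isOpen_extChartAt_source y).preimage hf.continuous))

lemma exists_sliceChart_fiber_maxRankSet [FiniteDimensional ℝ K]
    (hf : ContMDiff 𝓘(ℝ, E) 𝓘(ℝ, F) ∞ f) {x : M} (hx : x ∈ maxRankSet E F f)
    (hK : Module.finrank ℝ K + rankAt E F f x = Module.finrank ℝ E) :
    ∃ s : SliceChart E K (maxRankSet E F f ∩ f ⁻¹' {f x}), x ∈ s.nhd := by
  set φ := extChartAt 𝓘(ℝ, E) x
  set ψ := extChartAt 𝓘(ℝ, F) (f x)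
  set h : E → F := inCharts x (f x) f
  set Ω : Set E := φ.target ∩ φ.symm ⁻¹' (maxRankSet E F f ∩ f ⁻¹' ψ.source)
  have hxφ : x ∈ φ.source := mem_extChartAt_source x
  have hfx : f x ∈ ψ.source := mem_extChartAt_source (f x)
  have hφx : φ.symm (φ x) = x := φ.left_inv hxφ
  have hhx : h (φ x) = ψ (f x) := congrArg (fun a ↦ ψ (f a)) hφx
  have hxΩ : φ x ∈ Ω := ⟨φ.map_source hxφ, by rw [mem_preimage, hφx]; exact ⟨hx, hfx⟩⟩
  have hrank : ∀ y ∈ Ω, Module.finrank ℝ (fderiv ℝ h y).range = rankAt E F f (φ.symm y) :=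
    fun y hy ↦ finrank_range_fderiv_inCharts hf hy.1 hy.2.2
  have hrankx : Module.finrank ℝ (fderiv ℝ h (φ x)).range = rankAt E F f x := by
    rw [hrank _ hxΩ, hφx]
  have hker := (fderiv ℝ h (φ x)).toLinearMap.finrank_range_add_finrank_ker
  have hslice := exists_sliceChart_fiber (K := K) (h := h)
    (isOpen_extChartAt_symm_preimage_maxRankSet hf x (f x))
    (fun y hy ↦ (contDiffAt_inCharts hy.1 hf.contMDiffAt hy.2.2).contDiffWithinAt) hxΩ
    (fun y hy ↦ by rw [hrank y hy, hrankx]; exact hx _) (by omega)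
  have hfiber : Ω ∩ h ⁻¹' {h (φ x)} =
      φ.target ∩ φ.symm ⁻¹' (maxRankSet E F f ∩ f ⁻¹' {f x}) := by
    ext y
    constructor
    · rintro ⟨⟨hy, hyU, hfy⟩, hhy⟩
      exact ⟨hy, hyU, ψ.injOn hfy hfx (hhy.trans hhx)⟩
    · rintro ⟨hy, hyU, hfy : f (φ.symm y) = f x⟩
      exact ⟨⟨hy, hyU, by rwa [mem_preimage, hfy]⟩, (congrArg ψ hfy).trans hhx.symm⟩
  rw [hfiber] at hslice
  obtain ⟨s, hs⟩ := hslice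
  exact ⟨.ofChart x s, hxφ, hs⟩

variable [FiniteDimensional ℝ K]

lemma exists_sliceChart_connectedComponentIn (hf : ContMDiff 𝓘(ℝ, E) 𝓘(ℝ, F) ∞ f) {x₀ : M}
    (hK : ∀ x ∈ maxRankSet E F f, Module.finrank ℝ K + rankAt E F f x = Module.finrank ℝ E)
    {x : M} (hx : x ∈ connectedComponentIn (maxRankSet E F f ∩ f ⁻¹' {f x₀}) x₀) :
    ∃ s : SliceChart E K (connectedComponentIn (maxRankSet E F f ∩ f ⁻¹' {f x₀}) x₀),
      x ∈ s.nhd := by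
  obtain ⟨hxU, hfx : f x = f x₀⟩ := connectedComponentIn_subset _ _ hx
  have hslice := exists_sliceChart_fiber_maxRankSet hf hxU (hK x hxU)
  rw [hfx] at hslice
  obtain ⟨s, hs⟩ := hslice
  exact ⟨s.restrictComponent hx hs, hs⟩

/-- The component is itself an integral manifold, so that maximality applies to it. -/
lemma range_eq_connectedComponentIn [IsManifold 𝓘(ℝ, K) ∞ L] (hf : ContMDiff 𝓘(ℝ, E) 𝓘(ℝ, F) ∞ f)
    (hj : IsMaximalIntegralManifold K (kerDistribution E F f) (maxRankSet E F f) j) (q : L) :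
    range j = connectedComponentIn (maxRankSet E F f ∩ f ⁻¹' {f (j q)}) (j q) := by
  have := hj.1.connected
  have hK := finrank_add_rankAt_of_isIntegralManifold hj.1 q
  have hK' : ∀ x ∈ maxRankSet E F f,
      Module.finrank ℝ K + rankAt E F f x = Module.finrank ℝ E := fun x hx ↦ by
    rwa [rankAt_eq_of_mem_maxRankSet hx (hj.1.mem q)]
  have hq : j q ∈ maxRankSet E F f ∩ f ⁻¹' {f (j q)} := ⟨hj.1.mem q, rfl⟩
  choose s hs using fun x : connectedComponentIn (maxRankSet E F f ∩ f ⁻¹' {f (j q)}) (j q) ↦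
    exists_sliceChart_connectedComponentIn (K := K) hf hK' x.2
  let := SliceChart.chartedSpace s hs
  have := SliceChart.isManifold s hs
  have hmax := hj.2 _ _ (isIntegralManifold_coe hf (hj.1.mem q) hK
    (isConnected_connectedComponentIn_iff.2 hq) (connectedComponentIn_subset _ _)
    s hs)
  rw [Subtype.range_coe] at hmax
  refine (hmax ((isPreconnected_range hj.1.contMDiff.continuous).subset_connectedComponentIn
    (mem_range_self q) ?_)).symm
  rintro _ ⟨p, rfl⟩
  exact ⟨hj.1.mem p, apply_eq_of_isIntegralManifold hf hj.1 p q⟩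

end Leaf

/-! ### Lifting geodesics -/

section Geodesic

lemma deriv_deriv_comp {E K : Type*} [NormedAddCommGroup E] [NormedSpace ℝ E]
    [NormedAddCommGroup K] [NormedSpace ℝ K] {i : K → E} {s : ℝ → K} {t : ℝ}
    (hi : ContDiffAt ℝ 2 i (s t)) (hs : ContDiffAt ℝ 2 s t) :
    deriv (deriv (i ∘ s)) t = fderiv ℝ (fderiv ℝ i) (s t) (deriv s t) (deriv s t) +
      fderiv ℝ i (s t) (deriv (deriv s) t) := by
  have hderiv : deriv (i ∘ s) =ᶠ[𝓝 t] fun r ↦ fderiv ℝ i (s r) (deriv s r) := by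
    filter_upwards [hs.continuousAt.eventually (hi.eventually (by simp)),
      hs.eventually (by simp)] with r hir hsr
    exact fderiv_comp_deriv r (hir.differentiableAt (by simp)) (hsr.differentiableAt (by simp))
  have hDi : DifferentiableAt ℝ (fderiv ℝ i) (s t) :=
    (hi.fderiv_right (m := 1) (by norm_num)).differentiableAt (by simp)
  have hs' : ContDiffAt ℝ 1 (deriv s) t :=
    (hs.fderiv_right (m := 1) (by norm_num)).clm_apply contDiffAt_const
  rw [hderiv.deriv_eq]
  exact ((hDi.hasFDerivAt.comp_hasDerivAt t
    (hs.differentiableAt (by simp)).hasDerivAt).clm_apply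
      (hs'.differentiableAt (by simp)).hasDerivAt).deriv

variable {E : Type*} [NormedAddCommGroup E] [NormedSpace ℝ E]
  {M : Type u} [TopologicalSpace M] [ChartedSpace E M] [IsManifold 𝓘(ℝ, E) ∞ M]
  {K : Type*} [NormedAddCommGroup K] [NormedSpace ℝ K]
  {L : Type u} [TopologicalSpace L] [ChartedSpace K L] [IsManifold 𝓘(ℝ, K) ∞ L]
  (g : Bundle.ContMDiffRiemannianMetric 𝓘(ℝ, E) ∞ E (fun x : M ↦ TangentSpace 𝓘(ℝ, E) x))
  {j : L → M} {q₀ : L} {x₀ : M}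

lemma formInChart_inducedMetric_pos {y : K} (hy : y ∈ (extChartAt 𝓘(ℝ, K) q₀).target)
    (hj : ContMDiff 𝓘(ℝ, K) 𝓘(ℝ, E) ∞ j)
    (hinj : ∀ q, Function.Injective (mfderiv 𝓘(ℝ, K) 𝓘(ℝ, E) j q)) {v : K} (hv : v ≠ 0) :
    0 < formInChart (inducedMetric K g.inner j) q₀ y v v := by
  have hjy := mem_extChartAt_source (I := 𝓘(ℝ, E)) (j ((extChartAt 𝓘(ℝ, K) q₀).symm y))
  rw [formInChart_inducedMetric g.inner hy hj.contMDiffAt hjy, pullbackForm_apply]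
  exact formInChart_pos g ((extChartAt 𝓘(ℝ, E) _).map_source hjy)
    ((map_ne_zero_iff _ (fderiv_inCharts_injective hy hj.contMDiffAt hjy (hinj _))).2 hv)

variable [FiniteDimensional ℝ E]

lemma formInChart_inducedMetric_acceleration {s : ℝ → K} {t : ℝ}
    (hy : s t ∈ (extChartAt 𝓘(ℝ, K) q₀).target) (hj : ContMDiff 𝓘(ℝ, K) 𝓘(ℝ, E) ∞ j)
    (hjy : j ((extChartAt 𝓘(ℝ, K) q₀).symm (s t)) ∈ (extChartAt 𝓘(ℝ, E) x₀).source)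
    (hform : (formInChart (inducedMetric K g.inner j) q₀ (s t)).IsInvertible)
    (hs : ContDiffAt ℝ 2 s t) (w : K) :
    formInChart (inducedMetric K g.inner j) q₀ (s t) (deriv (deriv s) t +
        christoffel (inducedMetric K g.inner j) q₀ (s t) (deriv s t) (deriv s t)) w =
      formInChart g.inner x₀ (inCharts q₀ x₀ j (s t))
        (deriv (deriv (inCharts q₀ x₀ j ∘ s)) t +
          christoffel g.inner x₀ (inCharts q₀ x₀ j (s t))
            (deriv (inCharts q₀ x₀ j ∘ s) t) (deriv (inCharts q₀ x₀ j ∘ s) t))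
        (fderiv ℝ (inCharts (E := E) q₀ x₀ j) (s t) w) := by
  have hi := contDiffAt_inCharts hy hj.contMDiffAt hjy
  rw [map_add, formInChart_christoffel hform, add_apply, christoffelFirst_inducedMetric g hy hj hjy,
    formInChart_inducedMetric g.inner hy hj.contMDiffAt hjy, pullbackForm_apply, ← add_apply,
    ← map_add, deriv_deriv_comp (hi.of_le two_le_infty) hs,
    fderiv_comp_deriv t (hi.differentiableAt (by simp)) (hs.differentiableAt (by simp))]
  congr 2
  abel

lemma isGeodesic_of_isGeodesic_comp [FiniteDimensional ℝ K] (hj : ContMDiff 𝓘(ℝ, K) 𝓘(ℝ, E) ∞ j)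
    (hinj : ∀ q, Function.Injective (mfderiv 𝓘(ℝ, K) 𝓘(ℝ, E) j q)) {σ : ℝ → L}
    (hσ : ContMDiff 𝓘(ℝ, ℝ) 𝓘(ℝ, K) ∞ σ) (hγ : IsGeodesic g.inner (j ∘ σ)) :
    IsGeodesic (inducedMetric K g.inner j) σ := by
  refine ⟨hσ, fun q₀ t ht ↦ ?_⟩
  set s : ℝ → K := fun r ↦ extChartAt 𝓘(ℝ, K) q₀ (σ r)
  set x₀ := j (σ t)
  have hx₀ : x₀ ∈ (extChartAt 𝓘(ℝ, E) x₀).source := mem_extChartAt_source x₀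
  have hy : s t ∈ (extChartAt 𝓘(ℝ, K) q₀).target := (extChartAt 𝓘(ℝ, K) q₀).map_source ht
  have hjy : j ((extChartAt 𝓘(ℝ, K) q₀).symm (s t)) ∈ (extChartAt 𝓘(ℝ, E) x₀).source := by
    rwa [(extChartAt 𝓘(ℝ, K) q₀).left_inv ht]
  have hcurve : (fun r ↦ extChartAt 𝓘(ℝ, E) x₀ ((j ∘ σ) r)) =ᶠ[𝓝 t] inCharts q₀ x₀ j ∘ s := by
    filter_upwards [hσ.continuous.continuousAt ((isOpen_extChartAt_source q₀).mem_nhds ht)]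
      with r hr
    exact congrArg (fun a ↦ extChartAt 𝓘(ℝ, E) x₀ (j a)) ((extChartAt 𝓘(ℝ, K) q₀).left_inv hr).symm
  have hgeodesic := hγ.equation x₀ t hx₀
  have hpoint : extChartAt 𝓘(ℝ, E) x₀ ((j ∘ σ) t) = inCharts q₀ x₀ j (s t) := hcurve.self_of_nhds
  rw [hcurve.deriv.deriv_eq, hcurve.deriv_eq, hpoint] at hgeodesic
  have hpos := fun v ↦ formInChart_inducedMetric_pos g hy hj hinj (v := v)
  have htangential := formInChart_inducedMetric_acceleration g hy hj hjy (isInvertible_of_pos hpos)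
    ((contDiffAt_extChartAt_comp hσ.contMDiffAt ht).of_le two_le_infty)
  by_contra hne
  refine (hpos _ hne).ne' ((htangential _).trans ?_)
  rw [hgeodesic, map_zero, zero_apply]

end Geodesic

section Lift

lemma injective_tangentMap {𝕜 : Type*} [NontriviallyNormedField 𝕜]
    {E : Type*} [NormedAddCommGroup E] [NormedSpace 𝕜 E] {H : Type*} [TopologicalSpace H]
    {I : ModelWithCorners 𝕜 E H} {M : Type*} [TopologicalSpace M] [ChartedSpace H M]
    {K : Type*} [NormedAddCommGroup K] [NormedSpace 𝕜 K] {H' : Type*} [TopologicalSpace H']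
    {J : ModelWithCorners 𝕜 K H'} {L : Type*} [TopologicalSpace L] [ChartedSpace H' L]
    {j : L → M} (hj : Function.Injective j) (hDj : ∀ q, Function.Injective (mfderiv J I j q)) :
    Function.Injective (tangentMap J I j) := by
  rintro ⟨p, v⟩ ⟨q, w⟩ h
  obtain rfl : p = q := hj (congrArg Bundle.TotalSpace.proj h)
  exact congrArg (Bundle.TotalSpace.mk p)
    (hDj p (congrArg (fun z : TangentBundle I M ↦ (z.2 : E)) h))

variable {E : Type*} [NormedAddCommGroup E] [NormedSpace ℝ E]
  {M : Type u} [TopologicalSpace M] [ChartedSpace E M]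
  {F : Type*} [NormedAddCommGroup F] [NormedSpace ℝ F]
  {N : Type*} [TopologicalSpace N] [ChartedSpace F N]
  {K : Type*} [NormedAddCommGroup K] [NormedSpace ℝ K]
  {L : Type u} [TopologicalSpace L] [ChartedSpace K L] {j : L → M} {f : M → N}

lemma mem_kernelTimes_of_tangentMap_eq (hf : ContMDiff 𝓘(ℝ, E) 𝓘(ℝ, F) ∞ f)
    (hj : IsIntegralManifold K (kerDistribution E F f) (maxRankSet E F f) j) {γ : ℝ → M} {t : ℝ}
    (hγ : ContMDiff 𝓘(ℝ, ℝ) 𝓘(ℝ, E) ∞ γ) {v : TangentBundle 𝓘(ℝ, K) L}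
    (hv : tangentMap 𝓘(ℝ, ℝ) 𝓘(ℝ, E) γ ⟨t, (1 : ℝ)⟩ = tangentMap 𝓘(ℝ, K) 𝓘(ℝ, E) j v) :
    t ∈ kernelTimes E F f γ := by
  have hγt : γ t = j v.proj := congrArg Bundle.TotalSpace.proj hv
  refine ⟨hγt ▸ hj.mem v.proj, ?_⟩
  rw [mfderiv_curve_eq_zero_iff, mfderiv_comp t (hf.contMDiffAt.mdifferentiableAt (by simp))
    (hγ.contMDiffAt.mdifferentiableAt (by simp))]
  exact (congrArg (fun z : TangentBundle 𝓘(ℝ, E) M ↦ (mfderiv 𝓘(ℝ, E) 𝓘(ℝ, F) f z.1 z.2 : F))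
    hv).trans (mfderiv_apply_mfderiv_of_isIntegralManifold hj v.1 v.2)

variable [FiniteDimensional ℝ E] [FiniteDimensional ℝ K]
  [IsManifold 𝓘(ℝ, E) ∞ M] [IsManifold 𝓘(ℝ, F) ∞ N] [IsManifold 𝓘(ℝ, K) ∞ L]

/-- On its fiber, an integral manifold is locally inverted by a smooth map defined on an open subset
of `M`; this makes up for `j` not being an embedding. -/
lemma contMDiff_of_contMDiff_comp_isIntegralManifold (hf : ContMDiff 𝓘(ℝ, E) 𝓘(ℝ, F) ∞ f)
    (hj : IsIntegralManifold K (kerDistribution E F f) (maxRankSet E F f) j)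
    {V : Type*} [NormedAddCommGroup V] [NormedSpace ℝ V] {P : Type*} [TopologicalSpace P]
    [ChartedSpace V P] {σ : P → L} (hσ : ContMDiff 𝓘(ℝ, V) 𝓘(ℝ, E) ∞ (j ∘ σ)) :
    ContMDiff 𝓘(ℝ, V) 𝓘(ℝ, K) ∞ σ := by
  intro t
  have hfiber : ∀ q, j q ∈ maxRankSet E F f ∩ f ⁻¹' {f (j (σ t))} :=
    fun q ↦ ⟨hj.mem q, apply_eq_of_isIntegralManifold hf hj q (σ t)⟩
  obtain ⟨s, hs⟩ := exists_sliceChart_fiber_maxRankSet hf (hj.mem (σ t))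
    (finrank_add_rankAt_of_isIntegralManifold hj (σ t))
  obtain ⟨τ, hτ, hjτ⟩ := s.exists_local_inverse hj.contMDiff hfiber hs (hj.injective_mfderiv (σ t))
  refine (hτ.comp t (hσ t)).congr_of_eventuallyEq ?_
  filter_upwards [(hσ t).continuousAt.eventually hjτ] with r hr
  exact hj.injective (hr (hfiber (σ r))).symm

lemma mem_range_of_kernelTimes_eq_univ (hf : ContMDiff 𝓘(ℝ, E) 𝓘(ℝ, F) ∞ f)
    (hj : IsMaximalIntegralManifold K (kerDistribution E F f) (maxRankSet E F f) j) {γ : ℝ → M}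
    (hγ : ContMDiff 𝓘(ℝ, ℝ) 𝓘(ℝ, E) ∞ γ) (htimes : kernelTimes E F f γ = univ) {a : ℝ}
    (ha : γ a ∈ range j) (t : ℝ) : γ t ∈ range j := by
  obtain ⟨q, hq⟩ := ha
  have htimes := eq_univ_iff_forall.1 htimes
  rw [range_eq_connectedComponentIn hf hj q]
  refine (isPreconnected_range hγ.continuous).subset_connectedComponentIn ⟨a, hq.symm⟩ ?_
    (mem_range_self t)
  rintro _ ⟨t, rfl⟩
  exact ⟨(htimes t).1, hq ▸ eq_of_mfderiv_eq_zero (hf.comp hγ) (fun t ↦ (htimes t).2) t a⟩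

end Lift

end KernelFoliation

end

open KernelFoliation Set in
theorem mainTheorem1_general
    {E : Type*} [NormedAddCommGroup E] [NormedSpace ℝ E] [FiniteDimensional ℝ E]
    {M : Type u} [TopologicalSpace M] [ChartedSpace E M] [IsManifold 𝓘(ℝ, E) ∞ M]
    (g : Bundle.ContMDiffRiemannianMetric 𝓘(ℝ, E) ∞ E (fun x : M ↦ TangentSpace 𝓘(ℝ, E) x))
    (hcomplete : IsCompleteMetric g.inner)
    {F : Type*} [NormedAddCommGroup F] [NormedSpace ℝ F]
    {N : Type*} [TopologicalSpace N] [ChartedSpace F N] [IsManifold 𝓘(ℝ, F) ∞ N]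
    {f : M → N} (hf : ContMDiff 𝓘(ℝ, E) 𝓘(ℝ, F) ∞ f)
    (hauto : IsAutoparallelOn g.inner (kerDistribution E F f) (maxRankSet E F f))
    {K : Type*} [NormedAddCommGroup K] [NormedSpace ℝ K] [FiniteDimensional ℝ K]
    {L : Type u} [TopologicalSpace L] [ChartedSpace K L] [IsManifold 𝓘(ℝ, K) ∞ L] {j : L → M}
    (hj : IsMaximalIntegralManifold K (kerDistribution E F f) (maxRankSet E F f) j) :
    IsCompleteMetric (inducedMetric K g.inner j) := by
  intro v
  obtain ⟨γ, hγ, hv⟩ := hcomplete (tangentMap 𝓘(ℝ, K) 𝓘(ℝ, E) j v)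
  have htimes : kernelTimes E F f γ = univ :=
    kernelTimes_eq_univ hf hauto hγ (mem_kernelTimes_of_tangentMap_eq hf hj.1 hγ.contMDiff hv)
  choose σ hσ using mem_range_of_kernelTimes_eq_univ hf hj hγ.contMDiff htimes
    ⟨v.proj, (congrArg Bundle.TotalSpace.proj hv).symm⟩
  obtain rfl : j ∘ σ = γ := funext hσ
  have hσ : ContMDiff 𝓘(ℝ, ℝ) 𝓘(ℝ, K) ∞ σ :=
    contMDiff_of_contMDiff_comp_isIntegralManifold hf hj.1 hγ.contMDiff
  refine ⟨σ, isGeodesic_of_isGeodesic_comp g hj.1.contMDiff hj.1.injective_mfderiv hσ hγ,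
    injective_tangentMap hj.1.injective hj.1.injective_mfderiv ?_⟩
  rw [← hv, tangentMap_comp_at _ (hj.1.contMDiff.contMDiffAt.mdifferentiableAt (by simp))
    (hσ.contMDiffAt.mdifferentiableAt (by simp))]

theorem mainTheorem1 {m n k : ℕ}
    {M : Type u} [TopologicalSpace M] [T2Space M] [ChartedSpace (EuclideanSpace ℝ (Fin m)) M]
    [IsManifold (𝓡 m) ∞ M]
    (g : Bundle.ContMDiffRiemannianMetric (𝓡 m) ∞ (EuclideanSpace ℝ (Fin m))
      (fun x : M ↦ TangentSpace (𝓡 m) x))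
    (hcomplete : KernelFoliation.IsCompleteMetric g.inner)
    {N : Type v} [TopologicalSpace N] [T2Space N] [ChartedSpace (EuclideanSpace ℝ (Fin n)) N]
    [IsManifold (𝓡 n) ∞ N]
    (f : M → N) (hf : ContMDiff (𝓡 m) (𝓡 n) ∞ f)
    (U : Set M)
    (hU : U = KernelFoliation.maxRankSet (EuclideanSpace ℝ (Fin m)) (EuclideanSpace ℝ (Fin n)) f)
    (hauto : KernelFoliation.IsAutoparallelOn g.inner
      (KernelFoliation.kerDistribution (EuclideanSpace ℝ (Fin m)) (EuclideanSpace ℝ (Fin n)) f) U)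
    {L : Type u} [TopologicalSpace L] [ChartedSpace (EuclideanSpace ℝ (Fin k)) L]
    [IsManifold (𝓡 k) ∞ L]
    (j : L → M)
    (hj : KernelFoliation.IsMaximalIntegralManifold (EuclideanSpace ℝ (Fin k))
      (KernelFoliation.kerDistribution (EuclideanSpace ℝ (Fin m)) (EuclideanSpace ℝ (Fin n)) f)
      U j) :
    KernelFoliation.IsCompleteMetric
      (KernelFoliation.inducedMetric (EuclideanSpace ℝ (Fin k)) g.inner j) := by
  subst hU
  exact mainTheorem1_general g hcomplete hf hauto hj
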